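/- Let $d\ge 1$ and let $X=(X_i)_{i\in\mathbb Z^d}$ be a real-valued, mean zero, variance one, translation invariant random field with covariance $\mathbf E[X_iX_j]=K(i-j)$ (invariance of the first two moments suffices). Let $S(\theta)=\sum_{j\in\mathbb Z^d}e^{i\theta\cdot j}K(j)$, $\theta\in[-\pi,\pi]^d$ (series converging in mean square), be its structure function, and assume that $S$ is bounded on $[-\pi,\pi]^d$. For $L>0$ let $\mathcal B_L=\{x\in\mathbb R^d:\|x\|\le L\}$ (Euclidean norm) and $Q_{\mathcal B_L}(X)=\sum_{i\in\mathcal B_L\cap\mathbb Z^d}X_i$. For $c>0$ put $$F_c(L)=L^{2d}\int_{\|\xi\|\le c/L}S(\xi)\,d\xi+L^{d-1}\int_{\|\xi\|>c/L}\frac{S(\xi)}{\|\xi\|^{d+1}}\,d\xi ,$$ both integrals being over $\xi\in[-\pi,\pi]^d$. Then for every $c>0$: 1. There are $C,L_0>0$ such that $\mathrm{Var}(Q_{\mathcal B_L}(X))\le C\,F_c(L)$ for all real $L>L_0$. 2. Suppose moreover that $S$ is regular at the origin: there are $\epsilon,c',C'>0$ and a function $A$, integrable on the spheres $\{\|\xi\|=r\}$,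 $0<r<\epsilon$, such that $c'A(\xi)\le S(\xi)\le C'A(\xi)$ for $\|\xi\|<\epsilon$ and $r\mapsto r^{-2}\int_{\mathbb S^{d-1}}A(r\omega)\,dV_{\mathbb S^{d-1}}(\omega)$ is monotone (nondecreasing or nonincreasing) on $(0,\epsilon)$. Then $\mathrm{Var}(Q_{\mathcal B_L}(X))=\Theta(F_c(L))$ as $L\to\infty$, i.e. there are $c_1,c_2,L_0>0$ with $c_1F_c(L)\le \mathrm{Var}(Q_{\mathcal B_L}(X))\le c_2F_c(L)$ for all real $L>L_0$. -/

import Mathlib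

open MeasureTheory Filter Topology

/-- The point of `ℝ^d` with the integer coordinates `i`. -/
def latticePoint {d : ℕ} (i : Fin d → ℤ) : EuclideanSpace ℝ (Fin d) :=
  WithLp.toLp 2 (fun k => (i k : ℝ))

/-- The local mass `Q_Λ(X) = ∑_{i ∈ Λ ∩ ℤ^d} X_i` (used for bounded `Λ`, where the sum is finite). -/
noncomputable def localMass {Ω : Type*} {d : ℕ} (X : (Fin d → ℤ) → Ω → ℝ)
    (Λ : Set (EuclideanSpace ℝ (Fin d))) (ω : Ω) : ℝ :=
  ∑ᶠ (i : Fin d → ℤ) (_ : latticePoint i ∈ Λ), X i ω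

/-- The frequency domain `[-π, π]^d`. -/
def freqCube (d : ℕ) : Set (EuclideanSpace ℝ (Fin d)) :=
  {θ | ∀ k, θ k ∈ Set.Icc (-Real.pi) Real.pi}

/-- `S` is the Fourier transform `S(θ) = ∑_{j ∈ ℤ^d} e^{i θ·j} K(j)` of `K` on `[-π, π]^d`.
The series converges (unconditionally) in mean square; this covers summable `K`, for which it
converges uniformly, and every `K` whose Fourier transform is a bounded function. -/
def IsFourierTransformOf {d : ℕ} (S : EuclideanSpace ℝ (Fin d) → ℝ) (K : (Fin d → ℤ) → ℝ) : Prop :=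
  AEStronglyMeasurable S (volume.restrict (freqCube d)) ∧
  Tendsto (fun F : Finset (Fin d → ℤ) =>
      eLpNorm (fun θ : EuclideanSpace ℝ (Fin d) =>
        (∑ j ∈ F, Complex.exp (Complex.I * ((∑ k, θ k * (j k : ℝ) : ℝ) : ℂ)) * (K j : ℂ))
          - (S θ : ℂ)) 2 (volume.restrict (freqCube d)))
    atTop (𝓝 0)

/-- `r⁻² ∫_{𝕊^{d-1}} A(r ω) dV(ω)`. -/
noncomputable def scaledSphericalMean {d : ℕ} (A : EuclideanSpace ℝ (Fin d) → ℝ) (r : ℝ) : ℝ :=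
  (∫ ω : Metric.sphere (0 : EuclideanSpace ℝ (Fin d)) 1,
    A (r • (ω : EuclideanSpace ℝ (Fin d))) ∂(volume : Measure (EuclideanSpace ℝ (Fin d))).toSphere)
    / r ^ 2

/-- `f` is regular at the origin: near the origin it is comparable to an enveloping function `A`
(integrable on small spheres) for which `r⁻² ∫_{𝕊^{d-1}} A(r ω) dV(ω)` is monotone, i.e.
nondecreasing or nonincreasing, for small `r > 0`. -/
def IsRegularAtOrigin {d : ℕ} (f : EuclideanSpace ℝ (Fin d) → ℝ) : Prop :=
  ∃ (A : EuclideanSpace ℝ (Fin d) → ℝ) (ε c C : ℝ), 0 < ε ∧ 0 < c ∧ 0 < C ∧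
    (∀ ξ ∈ Metric.ball (0 : EuclideanSpace ℝ (Fin d)) ε, c * A ξ ≤ f ξ ∧ f ξ ≤ C * A ξ) ∧
    (∀ r ∈ Set.Ioo 0 ε,
      Integrable (fun ω : Metric.sphere (0 : EuclideanSpace ℝ (Fin d)) 1 =>
          A (r • (ω : EuclideanSpace ℝ (Fin d))))
        (volume : Measure (EuclideanSpace ℝ (Fin d))).toSphere) ∧
    (MonotoneOn (scaledSphericalMean A) (Set.Ioo 0 ε) ∨
      AntitoneOn (scaledSphericalMean A) (Set.Ioo 0 ε))

/-- `f(L) = Θ(g(L))` as `L → ∞`. -/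
def IsThetaAtInfinity (f g : ℝ → ℝ) : Prop :=
  ∃ c₁ c₂ L₀ : ℝ, 0 < c₁ ∧ 0 < c₂ ∧ 0 < L₀ ∧ ∀ L > L₀, c₁ * g L ≤ f L ∧ f L ≤ c₂ * g L

/-- `L^{2d} ∫_{‖ξ‖ ≤ c/L} S(ξ) dξ + L^{d-1} ∫_{‖ξ‖ > c/L} S(ξ) / ‖ξ‖^{d+1} dξ`, with `ξ` in the
frequency domain `[-π, π]^d`. -/
noncomputable def ballFluctuation {d : ℕ} (S : EuclideanSpace ℝ (Fin d) → ℝ) (c L : ℝ) : ℝ :=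
  L ^ (2 * d) * (∫ ξ in freqCube d ∩ {ξ | ‖ξ‖ ≤ c / L}, S ξ) +
    L ^ (d - 1) * (∫ ξ in freqCube d ∩ {ξ | c / L < ‖ξ‖}, S ξ / ‖ξ‖ ^ (d + 1))

/-!
Write `n = d - 1`, let `D_L(θ) = ∑_{‖j‖ ≤ L} e^{iθ·j}` be the exponential sum over the lattice points
of the ball and let `b_L` be the Fourier transform of the indicator function of the ball in `ℝ^d`.
Since `(2π)^d K` are the Fourier coefficients of `S`, the variance of the local mass is
`(2π)^{-d} ∫ S |D_L|²` (`variance_localMass`). Positive semidefiniteness of the covariance gives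
`S ≥ 0` almost everywhere, and `K 0 = 1` gives `∫ S > 0`, so `S` may be replaced by a bounded
nonnegative measurable function `f` which is not almost everywhere zero (`exists_isWeight`). The
rest is a comparison of `∫ f |D_L|²` with `ballFluctuation f`.

*From the lattice to the ball.* Averaging over the unit cell the exponential sums over the translates
of the lattice yields `b_L`; moving the lattice by `x` changes the sum only at the `O(L^n)` lattice
points near the sphere, so by Parseval `b_L` and `D_L` times the Fourier transform of the unit cell
differ by `O(L^{n/2})` in `L²` (`exists_ballFT_sub_bound`). As the latter factor is bounded above
and below on `[-π, π]^d`, the integrals `∫ f |D_L|²` and `∫ f b_L²` are comparable up to an error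
`O(L^n)` (`exists_comparison`).

*The Fourier transform of the ball.* It is radial, `b_L(ξ) = L^d v φ(L ‖ξ‖)` with an explicit profile
`φ`, and `h(s) = s^{(n+2)/2} φ(s)` solves `h'' = -h + q h / s²`. Hence `h` is bounded and
`h(s) = Re (z e^{is}) + O(1/s)` with `z ≠ 0` (`exists_normalizedProfile_bound`,
`exists_normalizedProfile_asymptotic`). The bounds `b_L² = O(L^{2d})` and
`b_L(ξ)² = O(L^n / ‖ξ‖^{d+1})` are exactly the two terms of `ballFluctuation`, which is itself at
least of order `L^n` (`exists_le_ballFluctuation`) and so absorbs the error. This is the upper bound.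

*The lower bound for regular `S`.* In polar coordinates `∫ f b_L²` near the origin becomes
`L^n ∫ h(Lr)² G(r) dr`, where `G(r) = r^{-2}` times the spherical integral is monotone up to constants.
Because `h²` has mean at least a fixed positive number over every long enough window
(`exists_window`), it can be replaced by its envelope (`exists_radial_comparison`), which gives
`ballFluctuation f ≤ a ∫ f b_L² + O(L^n)` (`exists_ballFluctuation_le`).

*Surface order from below.* The errors `O(L^n)` are absorbed because `∫ f |D_L|² ≥ a L^n` for every
nonzero weight (`IsWeight.exists_le_integral_latticeSum_sq`). For `d = 1` the sum `D_L` telescopes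
and the Riemann-Lebesgue lemma applies. For `d ≥ 2` consider the correlation
`W_L(x) = L^{-n} ∫ f b_L D_{L,x}`, where `D_{L,x}` is the exponential sum over the lattice moved by
`x`. Its Fourier coefficients over the unit cell are `L^{-n} ∫ f(θ) b_L(θ) b_L(θ + 2πk) dθ`. By the
asymptotics of `h` they tend to a limit `w > 0` for `k = 0`, and to zero for `k ≠ 0`, since the
phases `‖θ‖ ± ‖θ + 2πk‖` increase along almost every ray
(`IsPuncturedWeight.exists_tendsto_correlation`). By Weyl's criterion the averages of `W_L` near
`x = 0` are close to `w` (`eventually_norm_sub_mean_le`). The function `W_L` varies little there, for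
the same criterion shows that thin shells of width `η` contain only `O(η L^n)` lattice points
(`exists_card_shellPoints_le_mul`). So `|W_L(0)| ≥ w / 4` for large `L`, and the Cauchy-Schwarz
inequality together with `∫ f b_L² = O(L^n)`, valid when `f` vanishes near the origin, bounds
`∫ f |D_L|²` from below.
-/

namespace LatticeBall
local notation "𝔼" d:max => EuclideanSpace ℝ (Fin d)

variable {d n : ℕ}

/-! ### Characters, lattice points and the unit cell -/

/-- The character `e^{i θ·y}`. -/
noncomputable def chi {d : ℕ} (θ y : 𝔼 d) : ℂ := Complex.exp (Complex.I * (inner ℝ θ y : ℝ))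

/-- The centred half-open unit cell `[-1/2, 1/2)^d`. -/
def cell (d : ℕ) : Set (𝔼 d) := {x | ∀ k, x k ∈ Set.Ico (-(1 / 2) : ℝ) (1 / 2)}

lemma norm_chi (θ y : 𝔼 d) : ‖chi θ y‖ = 1 := by
  rw [chi, mul_comm]; exact Complex.norm_exp_ofReal_mul_I _

lemma chi_add (θ y z : 𝔼 d) : chi θ (y + z) = chi θ y * chi θ z := by
  simp only [chi, inner_add_right]; push_cast; rw [mul_add, Complex.exp_add]

lemma chi_add_left (θ η y : 𝔼 d) : chi (θ + η) y = chi θ y * chi η y := by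
  simp only [chi, inner_add_left]; push_cast; rw [mul_add, Complex.exp_add]

@[simp] lemma chi_zero (θ : 𝔼 d) : chi θ 0 = 1 := by simp [chi]

@[simp] lemma chi_zero_left (y : 𝔼 d) : chi 0 y = 1 := by simp [chi]

lemma chi_neg (θ y : 𝔼 d) : chi θ (-y) = (starRingEnd ℂ) (chi θ y) := by
  simp only [chi, inner_neg_right, ← Complex.exp_conj]
  simp

@[fun_prop] lemma continuous_chi {X : Type*} [TopologicalSpace X] {f g : X → 𝔼 d}
    (hf : Continuous f) (hg : Continuous g) : Continuous fun x => chi (f x) (g x) := by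
  unfold chi; fun_prop

lemma norm_chi_sub_one_le (θ y : 𝔼 d) : ‖chi θ y - 1‖ ≤ ‖θ‖ * ‖y‖ := by
  have h : ‖chi θ y - 1‖ ≤ ‖(inner ℝ θ y : ℝ)‖ := Real.norm_exp_I_mul_ofReal_sub_one_le
  exact h.trans (norm_inner_le_norm θ y)

/-- The character at a lattice point, in the form used by `IsFourierTransformOf`. -/
lemma chi_latticePoint (θ : 𝔼 d) (j : Fin d → ℤ) :
    chi θ (latticePoint j) = Complex.exp (Complex.I * ((∑ k, θ k * (j k : ℝ) : ℝ) : ℂ)) := by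
  simp only [chi, latticePoint, PiLp.inner_apply]
  congr 3
  exact Finset.sum_congr rfl fun k _ => by simp [mul_comm]

lemma chi_eq_prod (θ y : 𝔼 d) :
    chi θ y = ∏ k, Complex.exp (Complex.I * ((θ k * y k : ℝ) : ℂ)) := by
  rw [← Complex.exp_sum, ← Finset.mul_sum, ← Complex.ofReal_sum]
  simp only [chi, PiLp.inner_apply]
  congr 3
  exact Finset.sum_congr rfl fun k _ => by simp [mul_comm]

@[simp] lemma latticePoint_apply (j : Fin d → ℤ) (k : Fin d) : latticePoint j k = (j k : ℝ) := rfl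

@[simp] lemma latticePoint_zero : latticePoint (0 : Fin d → ℤ) = 0 := by ext; simp

lemma latticePoint_add (i j : Fin d → ℤ) :
    latticePoint (i + j) = latticePoint i + latticePoint j := by ext; simp

lemma latticePoint_sub (i j : Fin d → ℤ) :
    latticePoint (i - j) = latticePoint i - latticePoint j := by ext; simp

lemma measurableSet_coord {s : Set ℝ} (hs : MeasurableSet s) :
    MeasurableSet {x : 𝔼 d | ∀ k, x k ∈ s} := by
  simp only [Set.ofPred_forall]
  exact MeasurableSet.iInter fun k => (by fun_prop : Measurable fun x : 𝔼 d => x k) hs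

lemma measurableSet_cell : MeasurableSet (cell d) := measurableSet_coord measurableSet_Ico

lemma measurableSet_freqCube : MeasurableSet (freqCube d) := measurableSet_coord measurableSet_Icc

/-- Fubini for a product function on a product set. -/
lemma setIntegral_prod_coord {s : Set ℝ} (hs : MeasurableSet s) (f : Fin d → ℝ → ℂ) :
    ∫ x in {x : 𝔼 d | ∀ k, x k ∈ s}, ∏ k, f k (x k) = ∏ k, ∫ t in s, f k t := by
  rw [← integral_indicator (measurableSet_coord hs)]
  have h : ({x : 𝔼 d | ∀ k, x k ∈ s}.indicator fun x => ∏ k, f k (x k))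
      = fun x : 𝔼 d => ∏ k, s.indicator (f k) (x k) := by
    funext x
    by_cases hx : x ∈ {x : 𝔼 d | ∀ k, x k ∈ s}
    · rw [Set.indicator_of_mem hx]
      exact Finset.prod_congr rfl fun k _ => (Set.indicator_of_mem (hx k) _).symm
    · rw [Set.indicator_of_notMem hx]
      obtain ⟨k, hk⟩ : ∃ k, x k ∉ s := by simpa using hx
      exact (Finset.prod_eq_zero (Finset.mem_univ k) (Set.indicator_of_notMem hk _)).symm
  rw [h, ← (PiLp.volume_preserving_toLp (Fin d)).integral_comp
    (MeasurableEquiv.toLp 2 (Fin d → ℝ)).measurableEmbedding]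
  simp only []
  rw [integral_fintype_prod_volume_eq_prod (fun k => s.indicator (f k))]
  exact Finset.prod_congr rfl fun k _ => integral_indicator hs

lemma volume_real_coord {s : Set ℝ} (hs : MeasurableSet s) :
    volume.real {x : 𝔼 d | ∀ k, x k ∈ s} = volume.real s ^ d := by
  have h := setIntegral_prod_coord (d := d) hs (fun _ _ => (1 : ℂ))
  simp only [Finset.prod_const, setIntegral_const, Complex.real_smul, one_pow, mul_one,
    Finset.card_univ, Fintype.card_fin] at h
  exact_mod_cast h

lemma norm_le_of_coord_le {a : ℝ} (ha : 0 ≤ a) {x : 𝔼 d} (hx : ∀ k, |x k| ≤ a) :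
    ‖x‖ ≤ √d * a := by
  rw [EuclideanSpace.norm_eq]
  calc √(∑ i, ‖x i‖ ^ 2) ≤ √(∑ _i : Fin d, a ^ 2) := by
        apply Real.sqrt_le_sqrt
        exact Finset.sum_le_sum fun i _ => by
          rw [Real.norm_eq_abs]; exact pow_le_pow_left₀ (abs_nonneg _) (hx i) 2
    _ = √d * a := by
        simp [Real.sqrt_mul, Real.sqrt_sq ha]

lemma isBounded_freqCube : Bornology.IsBounded (freqCube d) := by
  refine Metric.isBounded_closedBall.subset (t := Metric.closedBall 0 (√d * Real.pi)) fun x hx => ?_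
  rw [mem_closedBall_zero_iff]
  exact norm_le_of_coord_le Real.pi_pos.le fun k => abs_le.2 (hx k)

lemma norm_le_of_mem_cell {x : 𝔼 d} (hx : x ∈ cell d) : ‖x‖ ≤ √d := by
  refine (norm_le_of_coord_le (a := 1) zero_le_one fun k => ?_).trans_eq (mul_one _)
  have := hx k
  rw [abs_le]; constructor <;> linarith [this.1, this.2]

lemma isBounded_cell : Bornology.IsBounded (cell d) :=
  Metric.isBounded_closedBall.subset (t := Metric.closedBall 0 (√d)) fun _ hx =>
    mem_closedBall_zero_iff.2 (norm_le_of_mem_cell hx)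

instance : IsFiniteMeasure (volume.restrict (freqCube d)) :=
  ⟨by simpa using isBounded_freqCube.measure_lt_top⟩

instance : IsFiniteMeasure (volume.restrict (cell d)) :=
  ⟨by simpa using isBounded_cell.measure_lt_top⟩

@[simp] lemma volume_real_cell : volume.real (cell d) = 1 := by
  rw [cell, volume_real_coord measurableSet_Ico]; norm_num

lemma volume_real_freqCube : volume.real (freqCube d) = (2 * Real.pi) ^ d := by
  rw [freqCube, volume_real_coord measurableSet_Icc]
  simp [Real.volume_real_Icc, two_mul, Real.pi_pos.le]

lemma integral_exp_int_mul {a : ℝ} (ha : 0 < a) {n : ℤ} (hn : n ≠ 0) :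
    ∫ t in (-a)..a, Complex.exp (Complex.I * ((t * (Real.pi / a * n) : ℝ) : ℂ)) = 0 := by
  have hc : Complex.I * (Real.pi / a * n : ℂ) ≠ 0 := by
    have := Real.pi_pos.ne'
    have := ha.ne'
    simp [*]
  have h1 : ∀ t : ℝ, Complex.exp (Complex.I * ((t * (Real.pi / a * n) : ℝ) : ℂ))
      = Complex.exp (Complex.I * (Real.pi / a * n : ℂ) * t) := fun t => by
    congr 1; push_cast; ring
  simp_rw [h1]
  rw [integral_exp_mul_complex hc, div_eq_zero_iff, sub_eq_zero]
  left
  rw [Complex.exp_eq_exp_iff_exists_int]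
  refine ⟨n, ?_⟩
  have : (a : ℂ) ≠ 0 := by exact_mod_cast ha.ne'
  push_cast
  field_simp
  ring

/-- Orthogonality of the lattice characters on the frequency cube. -/
lemma integral_chi_latticePoint (j : Fin d → ℤ) :
    ∫ θ in freqCube d, chi θ (latticePoint j) = if j = 0 then ((2 * Real.pi) ^ d : ℂ) else 0 := by
  split_ifs with h
  · subst h
    simp [volume_real_freqCube]
  · obtain ⟨k, hk⟩ : ∃ k, j k ≠ 0 := by
      by_contra! hj; exact h (funext hj)
    simp_rw [chi_eq_prod]
    rw [freqCube, setIntegral_prod_coord measurableSet_Icc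
      (fun k t => Complex.exp (Complex.I * ((t * latticePoint j k : ℝ) : ℂ)))]
    apply Finset.prod_eq_zero (Finset.mem_univ k)
    rw [integral_Icc_eq_integral_Ioc, ← intervalIntegral.integral_of_le (by linarith [Real.pi_pos])]
    have := integral_exp_int_mul Real.pi_pos hk
    rw [div_self Real.pi_pos.ne'] at this
    simpa using this

lemma integral_chi_cell {j : Fin d → ℤ} (hj : j ≠ 0) :
    ∫ x in cell d, chi ((2 * Real.pi) • latticePoint j) x = 0 := by
  obtain ⟨k, hk⟩ : ∃ k, j k ≠ 0 := by
    by_contra! h; exact hj (funext h)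
  simp_rw [chi_eq_prod]
  rw [cell, setIntegral_prod_coord measurableSet_Ico
    (fun k t => Complex.exp (Complex.I * ((((2 * Real.pi) • latticePoint j) k * t : ℝ) : ℂ)))]
  apply Finset.prod_eq_zero (Finset.mem_univ k)
  rw [integral_Ico_eq_integral_Ioc, ← intervalIntegral.integral_of_le (by norm_num)]
  have := integral_exp_int_mul (a := 1 / 2) (by norm_num) hk
  convert this using 4 with t
  congr 1; simp; ring

lemma integrable_of_continuous_of_isBounded {F : Type*} [NormedAddCommGroup F]
    {f : 𝔼 d → F} (hf : Continuous f) {s : Set (𝔼 d)} (hs : Bornology.IsBounded s) :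
    IntegrableOn f s :=
  (hf.continuousOn.integrableOn_compact hs.isCompact_closure).mono_set subset_closure

/-! ### The structure function as spectral density -/

/-- The exponential sum `∑_{j ∈ B} e^{i θ·j}`. -/
noncomputable def latticeSum (B : Finset (Fin d → ℤ)) (θ : 𝔼 d) : ℂ :=
  ∑ j ∈ B, chi θ (latticePoint j)

lemma finite_ballPoints (x : 𝔼 d) (L : ℝ) :
    {j : Fin d → ℤ | ‖latticePoint j + x‖ ≤ L}.Finite := by
  obtain ⟨N, hN⟩ := exists_nat_ge (L + ‖x‖)
  refine (Set.finite_Icc (fun _ : Fin d => -(N : ℤ)) (fun _ => (N : ℤ))).subset fun j hj => ?_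
  have hj' : ‖latticePoint j + x‖ ≤ L := hj
  have h1 : ‖latticePoint j‖ ≤ N := by
    have := norm_sub_le (latticePoint j + x) x
    rw [add_sub_cancel_right] at this
    linarith
  have h2 : ∀ k, |(j k : ℝ)| ≤ N := fun k =>
    (PiLp.norm_apply_le (latticePoint j) k).trans h1
  exact ⟨fun k => by have := (abs_le.1 (h2 k)).1; exact_mod_cast this,
    fun k => by have := (abs_le.1 (h2 k)).2; exact_mod_cast this⟩

/-- The `j ∈ ℤ^d` with `‖j + x‖ ≤ L`. -/
noncomputable def ballPoints (x : 𝔼 d) (L : ℝ) : Finset (Fin d → ℤ) :=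
  (finite_ballPoints x L).toFinset

@[simp] lemma mem_ballPoints {x : 𝔼 d} {L : ℝ} {j : Fin d → ℤ} :
    j ∈ ballPoints x L ↔ ‖latticePoint j + x‖ ≤ L := by simp [ballPoints]

/-- The finite sum defining the local mass of a ball; `localMass` is a `finsum`, whose support is
finite here. -/
lemma localMass_closedBall {Ω : Type*} (X : (Fin d → ℤ) → Ω → ℝ) (L : ℝ) :
    localMass X (Metric.closedBall 0 L) = fun ω => ∑ j ∈ ballPoints 0 L, X j ω := by
  funext ω
  rw [localMass, ← finsum_mem_coe_finset]
  refine finsum_congr fun i => ?_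
  simp

@[fun_prop] lemma continuous_latticeSum (B : Finset (Fin d → ℤ)) : Continuous (latticeSum B) := by
  unfold latticeSum; fun_prop

lemma norm_sq_latticeSum (B : Finset (Fin d → ℤ)) (θ : 𝔼 d) :
    ((‖latticeSum B θ‖ ^ 2 : ℝ) : ℂ)
      = ∑ i ∈ B, ∑ j ∈ B, chi θ (latticePoint (i - j)) := by
  rw [← Complex.normSq_eq_norm_sq, ← Complex.mul_conj, latticeSum, map_sum, Finset.sum_mul_sum]
  refine Finset.sum_congr rfl fun i _ => Finset.sum_congr rfl fun j _ => ?_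
  rw [← chi_neg, ← chi_add, latticePoint_sub, sub_eq_add_neg]

/-- Parseval's identity for exponential sums. -/
lemma integral_norm_sq_sum (B : Finset (Fin d → ℤ)) (a : (Fin d → ℤ) → ℝ) :
    ∫ θ in freqCube d, ‖∑ j ∈ B, (a j : ℂ) * chi θ (latticePoint j)‖ ^ 2
      = (2 * Real.pi) ^ d * ∑ j ∈ B, a j ^ 2 := by
  have h : ∀ θ : 𝔼 d, ((‖∑ j ∈ B, (a j : ℂ) * chi θ (latticePoint j)‖ ^ 2 : ℝ) : ℂ)
      = ∑ i ∈ B, ∑ j ∈ B, (a i * a j : ℂ) * chi θ (latticePoint (i - j)) := fun θ => by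
    rw [← Complex.normSq_eq_norm_sq, ← Complex.mul_conj, map_sum, Finset.sum_mul_sum]
    refine Finset.sum_congr rfl fun i _ => Finset.sum_congr rfl fun j _ => ?_
    rw [map_mul, ← chi_neg, latticePoint_sub, sub_eq_add_neg, chi_add, Complex.conj_ofReal]
    ring
  have hi : ∀ y : 𝔼 d, IntegrableOn (fun θ => chi θ y) (freqCube d) := fun y =>
    integrable_of_continuous_of_isBounded (by fun_prop) isBounded_freqCube
  apply Complex.ofReal_injective
  rw [← integral_complex_ofReal]
  simp_rw [h]
  rw [integral_finsetSum _ fun i _ => integrable_finsetSum _ fun j _ => (hi _).const_mul _]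
  simp_rw [integral_finsetSum B fun j _ => (hi _).const_mul _, integral_const_mul,
    integral_chi_latticePoint, sub_eq_zero]
  push_cast
  rw [Finset.mul_sum]
  refine Finset.sum_congr rfl fun i hi => ?_
  simp [hi]; ring

/-- The partial sums of the Fourier series of `S` converge to `S` in `L¹` on the frequency cube. -/
lemma tendsto_eLpNorm_one {S : 𝔼 d → ℝ} {K : (Fin d → ℤ) → ℝ}
    (hS : IsFourierTransformOf S K) :
    Tendsto (fun F : Finset (Fin d → ℤ) =>
      eLpNorm (fun θ => (∑ j ∈ F, chi θ (latticePoint j) * (K j : ℂ)) - (S θ : ℂ)) 1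
        (volume.restrict (freqCube d))) atTop (𝓝 0) := by
  have h2 := hS.2
  simp_rw [← chi_latticePoint] at h2
  have hc : (volume.restrict (freqCube d)) Set.univ ^ (1 / (1 : ENNReal).toReal - 1 / (2 : ENNReal).toReal)
      ≠ ⊤ := ENNReal.rpow_ne_top_of_nonneg (by norm_num) (measure_ne_top _ _)
  have h3 := ENNReal.Tendsto.mul_const h2 (Or.inr hc)
  rw [zero_mul] at h3
  refine tendsto_of_tendsto_of_tendsto_of_le_of_le tendsto_const_nhds h3 (fun _ => zero_le)
    fun F => ?_
  apply eLpNorm_le_eLpNorm_mul_rpow_measure_univ (by norm_num)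
  have hm := hS.1
  refine AEStronglyMeasurable.sub ?_ (Complex.continuous_ofReal.comp_aestronglyMeasurable hm)
  exact (by fun_prop : Continuous fun θ : 𝔼 d =>
    ∑ j ∈ F, chi θ (latticePoint j) * (K j : ℂ)).aestronglyMeasurable

lemma integrable_of_bdd {S : 𝔼 d → ℝ}
    (hS : AEStronglyMeasurable S (volume.restrict (freqCube d)))
    (hbdd : ∃ M : ℝ, ∀ ξ ∈ freqCube d, |S ξ| ≤ M) : IntegrableOn S (freqCube d) := by
  obtain ⟨M, hM⟩ := hbdd
  refine Integrable.of_bound hS M ?_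
  filter_upwards [ae_restrict_mem measurableSet_freqCube] with ξ hξ using hM ξ hξ

/-- Fourier series of `S` may be integrated termwise against bounded functions. -/
lemma hasSum_integral_mul {S : 𝔼 d → ℝ} {K : (Fin d → ℤ) → ℝ}
    (hS : IsFourierTransformOf S K) (hSi : IntegrableOn S (freqCube d))
    {g : 𝔼 d → ℂ} (hg : AEStronglyMeasurable g (volume.restrict (freqCube d)))
    (hg1 : ∀ θ, ‖g θ‖ ≤ 1) :
    HasSum (fun j => (∫ θ in freqCube d, g θ * chi θ (latticePoint j)) * (K j : ℂ))
      (∫ θ in freqCube d, g θ * (S θ : ℂ)) := by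
  have hi : ∀ y : 𝔼 d, IntegrableOn (fun θ => g θ * chi θ y) (freqCube d) := fun y => by
    refine Integrable.of_bound (hg.mul (by fun_prop : Continuous fun θ : 𝔼 d => chi θ y).aestronglyMeasurable) 1 ?_
    filter_upwards with θ
    rw [norm_mul, norm_chi, mul_one]; exact hg1 θ
  have hgS : IntegrableOn (fun θ => g θ * (S θ : ℂ)) (freqCube d) :=
    hSi.ofReal.bdd_mul hg (ae_of_all _ hg1)
  have key := tendsto_integral_of_L1' (fun θ => g θ * (S θ : ℂ)) hgS.aestronglyMeasurable
    (F := fun (F : Finset (Fin d → ℤ)) θ => ∑ j ∈ F, g θ * chi θ (latticePoint j) * (K j : ℂ))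
    (l := atTop) (μ := volume.restrict (freqCube d))
    (Eventually.of_forall fun F => integrable_finsetSum _ fun j _ => (hi _).mul_const _) ?_
  · unfold HasSum
    refine key.congr fun F => ?_
    rw [integral_finsetSum _ fun j _ => (hi _).mul_const _]
    simp_rw [integral_mul_const]
  · refine tendsto_of_tendsto_of_tendsto_of_le_of_le tendsto_const_nhds (tendsto_eLpNorm_one hS)
      (fun _ => zero_le) fun F => ?_
    refine eLpNorm_mono fun θ => ?_
    have : (fun θ => ∑ j ∈ F, g θ * chi θ (latticePoint j) * (K j : ℂ)) θ - g θ * (S θ : ℂ)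
      = g θ * ((∑ j ∈ F, chi θ (latticePoint j) * (K j : ℂ)) - (S θ : ℂ)) := by
      simp only [mul_sub, Finset.mul_sum, mul_assoc]
    rw [Pi.sub_apply, this, norm_mul]
    exact mul_le_of_le_one_left (norm_nonneg _) (hg1 θ)

/-- The Fourier coefficients of the structure function are the covariances. -/
lemma integral_mul_chi {S : 𝔼 d → ℝ} {K : (Fin d → ℤ) → ℝ}
    (hS : IsFourierTransformOf S K) (hSi : IntegrableOn S (freqCube d)) (j : Fin d → ℤ) :
    ∫ θ in freqCube d, chi θ (latticePoint j) * (S θ : ℂ) = (2 * Real.pi) ^ d * K (-j) := by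
  have h := hasSum_integral_mul hS hSi (g := fun θ => chi θ (latticePoint j))
    (by fun_prop : Continuous fun θ : 𝔼 d => chi θ (latticePoint j)).aestronglyMeasurable
    (fun θ => (norm_chi _ _).le)
  simp_rw [← chi_add, ← latticePoint_add, integral_chi_latticePoint] at h
  refine h.unique ?_
  convert hasSum_ite_eq (-j) ((2 * Real.pi) ^ d * K (-j) : ℂ) using 2 with i
  by_cases hi : i = -j
  · subst hi; simp
  · have : j + i ≠ 0 := fun h => hi (eq_neg_of_add_eq_zero_right h)
    simp [hi, this]

/-- The Fejér weights: the fraction of a large box which remains in the box after a shift by `v`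
tends to one. -/
lemma boxCount_div_tendsto (v : Fin d → ℤ) :
    Tendsto (fun N : ℕ => ((((Fintype.piFinset fun _ : Fin d => Finset.Ico (0 : ℤ) N).filter
      fun i => i - v ∈ Fintype.piFinset fun _ : Fin d => Finset.Ico (0 : ℤ) N).card : ℝ)) / (N : ℝ) ^ d)
      atTop (𝓝 1) := by
  have h1 : ∀ N : ℕ, ((Fintype.piFinset fun _ : Fin d => Finset.Ico (0 : ℤ) N).filter
      fun i => i - v ∈ Fintype.piFinset fun _ : Fin d => Finset.Ico (0 : ℤ) N)
      = Fintype.piFinset fun k : Fin d => Finset.Ico (max 0 (v k)) (min N (N + v k)) := fun N => by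
    ext i
    simp only [Finset.mem_filter, Fintype.mem_piFinset, Finset.mem_Ico, Pi.sub_apply]
    constructor
    · rintro ⟨ha, hb⟩ k
      have := ha k; have := hb k; omega
    · intro ha
      exact ⟨fun k => by have := ha k; omega, fun k => by have := ha k; omega⟩
  have h2 : ∀ k : Fin d, Tendsto (fun N : ℕ =>
      ((min (N : ℤ) (N + v k) - max 0 (v k)).toNat : ℝ) / (N : ℝ)) atTop (𝓝 1) := fun k => by
    have h3 : Tendsto (fun N : ℕ => 1 - (|v k| : ℝ) * (1 / (N : ℝ))) atTop (𝓝 1) := by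
      simpa using (tendsto_const_nhds (x := (1 : ℝ))).sub
        ((tendsto_one_div_atTop_nhds_zero_nat (𝕜 := ℝ)).const_mul (|v k| : ℝ))
    refine h3.congr' ?_
    filter_upwards [eventually_gt_atTop (v k).natAbs] with N hN
    have hN0 : (N : ℝ) ≠ 0 := by
      have : 0 < N := by omega
      positivity
    have h4 : ((min (N : ℤ) (N + v k) - max 0 (v k)).toNat : ℤ) = N - |v k| := by
      rcases abs_cases (v k) with h | h <;> omega
    have h5 : ((min (N : ℤ) (N + v k) - max 0 (v k)).toNat : ℝ) = N - |(v k : ℝ)| := by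
      exact_mod_cast h4
    rw [h5]; field_simp
  simp_rw [h1, Fintype.card_piFinset, Int.card_Ico]
  have h6 := tendsto_finsetProd Finset.univ fun k _ => h2 k
  simp only [Finset.prod_const_one] at h6
  refine h6.congr fun N => ?_
  push_cast
  rw [Finset.prod_div_distrib]; simp

/-- The structure function is nonnegative: it is a Fejér-type limit of the functions
`N⁻ᵈ E|∑_{i ∈ [0,N)^d} X_i e^{iθ·i}|²`. -/
lemma ae_nonneg_of_posSemidef {S : 𝔼 d → ℝ} {K : (Fin d → ℤ) → ℝ}
    (hS : IsFourierTransformOf S K) (hSi : IntegrableOn S (freqCube d))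
    (hpos : ∀ (B : Finset (Fin d → ℤ)) (θ : 𝔼 d),
      0 ≤ (∑ i ∈ B, ∑ j ∈ B, chi θ (latticePoint (i - j)) * (K (i - j) : ℂ)).re) :
    0 ≤ᵐ[volume.restrict (freqCube d)] S := by
  -- It suffices that the integral over any set `A` is nonnegative. By termwise integration it is
  -- `∑ c`, hence, by dominated convergence, the limit of the Fejér means of that series.
  refine ae_nonneg_of_forall_setIntegral_nonneg hSi fun A hA _ => ?_
  set g : 𝔼 d → ℂ := A.indicator fun _ => 1 with hgdef
  have hgm : AEStronglyMeasurable g (volume.restrict (freqCube d)) :=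
    (stronglyMeasurable_const.indicator hA).aestronglyMeasurable
  have hg1 : ∀ θ, ‖g θ‖ ≤ 1 := fun θ => by
    by_cases h : θ ∈ A <;> simp [hgdef, h]
  have hsum := hasSum_integral_mul hS hSi hgm hg1
  set c : (Fin d → ℤ) → ℂ :=
    fun j => (∫ θ in freqCube d, g θ * chi θ (latticePoint j)) * (K j : ℂ) with hc
  have hlim : ∫ θ in freqCube d, g θ * (S θ : ℂ)
      = ((∫ θ in A, S θ ∂(volume.restrict (freqCube d)) : ℝ) : ℂ) := by
    rw [← integral_complex_ofReal, ← integral_indicator hA]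
    refine integral_congr_ae (ae_of_all _ fun θ => ?_)
    by_cases h : θ ∈ A <;> simp [hgdef, h]
  let box : ℕ → Finset (Fin d → ℤ) := fun N => Fintype.piFinset fun _ : Fin d => Finset.Ico (0 : ℤ) N
  let w : ℕ → (Fin d → ℤ) → ℝ := fun N v =>
    (((box N).filter fun i => i - v ∈ box N).card : ℝ) / (N : ℝ) ^ d
  have hboxcard : ∀ N, ((box N).card : ℝ) = (N : ℝ) ^ d := fun N => by simp [box]
  have hw1 : ∀ N v, |w N v| ≤ 1 := fun N v => by
    rw [abs_of_nonneg (by positivity)]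
    refine div_le_one_of_le₀ ?_ (by positivity)
    rw [← hboxcard]
    exact_mod_cast Finset.card_filter_le _ _
  have hT : Tendsto (fun N => ∑' v, (w N v : ℂ) * c v) atTop (𝓝 (∑' v, c v)) := by
    refine tendsto_tsum_of_dominated_convergence (bound := fun v => ‖c v‖) hsum.summable.norm
      (fun v => ?_) (Eventually.of_forall fun N v => ?_)
    · have := (Complex.continuous_ofReal.tendsto _).comp (boxCount_div_tendsto v)
      have h := this.mul_const (c v)
      rw [Complex.ofReal_one, one_mul] at h
      exact h
    · rw [norm_mul, Complex.norm_real]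
      exact mul_le_of_le_one_left (norm_nonneg _) (hw1 N v)
  rw [hsum.tsum_eq, hlim] at hT
  have hT' := (Complex.continuous_re.tendsto _).comp hT
  rw [Complex.ofReal_re] at hT'
  refine ge_of_tendsto' hT' fun N => ?_
  -- The Fejér mean is `N⁻ᵈ` times a double sum over the box, to which positivity applies.
  have hfin : ∑' v, (w N v : ℂ) * c v
      = ((1 / (N : ℝ) ^ d : ℝ) : ℂ) * ∑ i ∈ box N, ∑ j ∈ box N, c (i - j) := by
    have h1 : ∀ i ∈ box N, ∑ j ∈ box N, c (i - j) = ∑' v, if i - v ∈ box N then c v else 0 := by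
      intro i _
      rw [tsum_eq_sum (s := (box N).image fun j => i - j)]
      · rw [Finset.sum_image fun a _ b _ h => sub_right_injective h]
        exact Finset.sum_congr rfl fun j hj => by simp [hj]
      · intro v hv
        rw [if_neg]
        intro h
        exact hv (Finset.mem_image.2 ⟨i - v, h, by simp⟩)
    have h2 : ∀ i ∈ box N, Summable fun v => if i - v ∈ box N then c v else 0 := by
      intro i _
      refine summable_of_hasFiniteSupport (((box N).image fun j => i - j).finite_toSet.subset ?_)
      intro v hv
      have : i - v ∈ box N := by
        by_contra h; simp [h] at hv
      exact Finset.mem_coe.2 (Finset.mem_image.2 ⟨i - v, this, by simp⟩)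
    rw [Finset.sum_congr rfl h1, ← Summable.tsum_finsetSum h2, ← tsum_mul_left]
    refine tsum_congr fun v => ?_
    rw [← Finset.sum_filter, Finset.sum_const, nsmul_eq_mul]
    simp only [w]
    push_cast
    ring
  simp only [Function.comp_apply, hfin, Complex.re_ofReal_mul]
  refine mul_nonneg (by positivity) ?_
  have hi : ∀ y : 𝔼 d, IntegrableOn (fun θ => g θ * chi θ y) (freqCube d) := fun y => by
    refine Integrable.of_bound (hgm.mul (by fun_prop : Continuous fun θ : 𝔼 d => chi θ y).aestronglyMeasurable) 1 ?_
    filter_upwards with θ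
    rw [norm_mul, norm_chi, mul_one]; exact hg1 θ
  have hint : ∑ i ∈ box N, ∑ j ∈ box N, c (i - j) = ∫ θ in freqCube d,
      g θ * ∑ i ∈ box N, ∑ j ∈ box N, chi θ (latticePoint (i - j)) * (K (i - j) : ℂ) := by
    simp_rw [Finset.mul_sum, ← mul_assoc]
    rw [integral_finsetSum _ fun i _ => integrable_finsetSum _ fun j _ => (hi _).mul_const _]
    refine Finset.sum_congr rfl fun i _ => ?_
    rw [integral_finsetSum _ fun j _ => (hi _).mul_const _]
    simp_rw [integral_mul_const, hc]
  have hint2 : Integrable (fun θ => g θ * ∑ i ∈ box N, ∑ j ∈ box N,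
      chi θ (latticePoint (i - j)) * (K (i - j) : ℂ)) (volume.restrict (freqCube d)) := by
    simp_rw [Finset.mul_sum, ← mul_assoc]
    exact integrable_finsetSum _ fun i _ => integrable_finsetSum _ fun j _ => (hi _).mul_const _
  rw [hint, ← RCLike.re_eq_complex_re, ← integral_re hint2]
  refine integral_nonneg fun θ => ?_
  by_cases h : θ ∈ A
  · simpa [hgdef, h] using hpos (box N) θ
  · simp [hgdef, h]

section Field
variable {Ω : Type*} [MeasurableSpace Ω] {μ : Measure Ω}
  {X : (Fin d → ℤ) → Ω → ℝ} {K : (Fin d → ℤ) → ℝ}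

lemma integral_sum_sq (hL2 : ∀ i, MemLp (X i) 2 μ)
    (hcov : ∀ i j, ∫ ω, X i ω * X j ω ∂μ = K (i - j)) (B : Finset (Fin d → ℤ))
    (a : (Fin d → ℤ) → ℝ) :
    ∫ ω, (∑ i ∈ B, a i * X i ω) ^ 2 ∂μ = ∑ i ∈ B, ∑ j ∈ B, a i * a j * K (i - j) := by
  have hi : ∀ i j, Integrable (fun ω => X i ω * X j ω) μ := fun i j => (hL2 i).integrable_mul (hL2 j)
  have h : ∀ ω, (∑ i ∈ B, a i * X i ω) ^ 2
      = ∑ i ∈ B, ∑ j ∈ B, (a i * a j) * (X i ω * X j ω) := fun ω => by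
    rw [sq, Finset.sum_mul_sum]
    exact Finset.sum_congr rfl fun i _ => Finset.sum_congr rfl fun j _ => by ring
  simp_rw [h]
  rw [integral_finsetSum _ fun i _ => integrable_finsetSum _ fun j _ => (hi i j).const_mul _]
  refine Finset.sum_congr rfl fun i _ => ?_
  rw [integral_finsetSum _ fun j _ => (hi i j).const_mul _]
  exact Finset.sum_congr rfl fun j _ => by rw [integral_const_mul, hcov]

/-- The double sum is the expectation of `|∑ X_i e^{iθ·i}|²`. -/
lemma covariance_posSemidef (hL2 : ∀ i, MemLp (X i) 2 μ)
    (hcov : ∀ i j, ∫ ω, X i ω * X j ω ∂μ = K (i - j)) (B : Finset (Fin d → ℤ)) (θ : 𝔼 d) :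
    0 ≤ (∑ i ∈ B, ∑ j ∈ B, chi θ (latticePoint (i - j)) * (K (i - j) : ℂ)).re := by
  have h : (∑ i ∈ B, ∑ j ∈ B, chi θ (latticePoint (i - j)) * (K (i - j) : ℂ)).re
      = ∫ ω, (∑ i ∈ B, (chi θ (latticePoint i)).re * X i ω) ^ 2 ∂μ
        + ∫ ω, (∑ i ∈ B, (chi θ (latticePoint i)).im * X i ω) ^ 2 ∂μ := by
    rw [integral_sum_sq hL2 hcov, integral_sum_sq hL2 hcov, ← Finset.sum_add_distrib,
      Complex.re_sum]
    refine Finset.sum_congr rfl fun i _ => ?_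
    rw [← Finset.sum_add_distrib, Complex.re_sum]
    refine Finset.sum_congr rfl fun j _ => ?_
    rw [Complex.re_mul_ofReal, latticePoint_sub, sub_eq_add_neg, chi_add, chi_neg]
    simp; ring
  rw [h]
  exact add_nonneg (integral_nonneg fun _ => sq_nonneg _) (integral_nonneg fun _ => sq_nonneg _)

/-- The variance of the local mass of a ball as a weighted mean square of an exponential sum. -/
lemma variance_localMass [IsProbabilityMeasure μ] {S : 𝔼 d → ℝ}
    (hS : IsFourierTransformOf S K) (hSi : IntegrableOn S (freqCube d))
    (hL2 : ∀ i, MemLp (X i) 2 μ) (hmean : ∀ i, ∫ ω, X i ω ∂μ = 0)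
    (hcov : ∀ i j, ∫ ω, X i ω * X j ω ∂μ = K (i - j)) (L : ℝ) :
    (2 * Real.pi) ^ d * ProbabilityTheory.variance (localMass X (Metric.closedBall 0 L)) μ
      = ∫ θ in freqCube d, S θ * ‖latticeSum (ballPoints 0 L) θ‖ ^ 2 := by
  rw [localMass_closedBall]
  set B := ballPoints (0 : 𝔼 d) L
  have hXi : ∀ i, Integrable (X i) μ := fun i => (hL2 i).integrable (by norm_num)
  have hm : ∫ ω, ∑ j ∈ B, X j ω ∂μ = 0 := by
    rw [integral_finsetSum _ fun i _ => hXi i]; simp [hmean]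
  rw [ProbabilityTheory.variance_of_integral_eq_zero
    (Finset.aemeasurable_fun_sum _ fun i _ => (hXi i).aemeasurable) hm]
  have h1 := integral_sum_sq hL2 hcov B fun _ => 1
  simp only [one_mul] at h1
  rw [h1]
  apply Complex.ofReal_injective
  rw [← integral_complex_ofReal]
  have h2 : ∀ θ : 𝔼 d, ((S θ * ‖latticeSum B θ‖ ^ 2 : ℝ) : ℂ)
      = ∑ i ∈ B, ∑ j ∈ B, chi θ (latticePoint (j - i)) * (S θ : ℂ) := fun θ => by
    rw [Complex.ofReal_mul, norm_sq_latticeSum, Finset.sum_comm, mul_comm, Finset.sum_mul]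
    exact Finset.sum_congr rfl fun i _ => by rw [Finset.sum_mul]
  have hi : ∀ y : 𝔼 d, IntegrableOn (fun θ => chi θ y * (S θ : ℂ)) (freqCube d) := fun y =>
    hSi.ofReal.bdd_mul (c := 1) (by fun_prop : Continuous fun θ : 𝔼 d => chi θ y).aestronglyMeasurable
      (ae_of_all _ fun θ => (norm_chi _ _).le)
  simp_rw [h2]
  rw [integral_finsetSum _ fun i _ => integrable_finsetSum _ fun j _ => hi _]
  simp_rw [integral_finsetSum B fun j _ => hi _, integral_mul_chi hS hSi, neg_sub]
  push_cast
  simp_rw [Finset.mul_sum]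

end Field

/-! ### Solutions of `h'' = -h + q h / s²` -/

/-- A solution of `h'' = -h + q h / s²` on `(0, ∞)`; `h₁` is the derivative of `h`. -/
structure IsPerturbedOscillation (q : ℝ) (h h₁ : ℝ → ℝ) : Prop where
  nonneg : 0 ≤ q
  deriv : ∀ s > 0, HasDerivAt h (h₁ s) s
  deriv' : ∀ s > 0, HasDerivAt h₁ (-h s + q / s ^ 2 * h s) s

namespace IsPerturbedOscillation
variable {q : ℝ} {h h₁ : ℝ → ℝ} (H : IsPerturbedOscillation q h h₁)
include H

/-- The energy `h² + h'²` is constant up to the integrable perturbation `2 q h h' / s²`, and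
`2 |h h'|` is at most the energy. -/
lemma hasDerivAt_energy {s : ℝ} (hs : 0 < s) :
    HasDerivAt (fun s => h s ^ 2 + h₁ s ^ 2) (2 * q / s ^ 2 * (h s * h₁ s)) s := by
  have := ((H.deriv s hs).pow 2).add ((H.deriv' s hs).pow 2)
  refine this.congr_deriv ?_
  simp; ring

/-- Up to the factor `e^{-q/s}` the energy is nondecreasing. -/
lemma monotoneOn_energy :
    MonotoneOn (fun s => (h s ^ 2 + h₁ s ^ 2) * Real.exp (-q / s)) (Set.Ioi 0) := by
  have hd : ∀ s > 0, HasDerivAt (fun s => (h s ^ 2 + h₁ s ^ 2) * Real.exp (-q / s))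
      (q / s ^ 2 * (h s + h₁ s) ^ 2 * Real.exp (-q / s)) s := fun s hs => by
    have h2 : HasDerivAt (fun s : ℝ => -q / s) (q / s ^ 2) s := by
      have := (hasDerivAt_inv hs.ne').const_mul (-q)
      refine this.congr_deriv ?_
      field_simp
    refine ((H.hasDerivAt_energy hs).mul h2.exp).congr_deriv ?_
    ring
  refine monotoneOn_of_deriv_nonneg (convex_Ioi 0)
    (fun s hs => (hd s hs).continuousAt.continuousWithinAt) (fun s hs => ?_) fun s hs => ?_
  · rw [interior_Ioi] at hs; exact (hd s hs).differentiableAt.differentiableWithinAt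
  · rw [interior_Ioi] at hs; rw [(hd s hs).deriv]
    have := H.nonneg; positivity

/-- Up to the factor `e^{q/s}` the energy is nonincreasing. -/
lemma antitoneOn_energy :
    AntitoneOn (fun s => (h s ^ 2 + h₁ s ^ 2) * Real.exp (q / s)) (Set.Ioi 0) := by
  have hd : ∀ s > 0, HasDerivAt (fun s => (h s ^ 2 + h₁ s ^ 2) * Real.exp (q / s))
      (-(q / s ^ 2 * (h s - h₁ s) ^ 2 * Real.exp (q / s))) s := fun s hs => by
    have h2 : HasDerivAt (fun s : ℝ => q / s) (-(q / s ^ 2)) s := by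
      have := (hasDerivAt_inv hs.ne').const_mul q
      refine this.congr_deriv ?_
      field_simp
    refine ((H.hasDerivAt_energy hs).mul h2.exp).congr_deriv ?_
    ring
  refine antitoneOn_of_deriv_nonpos (convex_Ioi 0)
    (fun s hs => (hd s hs).continuousAt.continuousWithinAt) (fun s hs => ?_) fun s hs => ?_
  · rw [interior_Ioi] at hs; exact (hd s hs).differentiableAt.differentiableWithinAt
  · rw [interior_Ioi] at hs; rw [(hd s hs).deriv]
    have := H.nonneg
    rw [neg_nonpos]; positivity

lemma exists_bound : ∃ B : ℝ, 0 < B ∧ ∀ s ≥ 1, |h s| ≤ B := by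
  refine ⟨√((h 1 ^ 2 + h₁ 1 ^ 2) * Real.exp (q / 1)) + 1, by positivity, fun s hs => ?_⟩
  have h1 := H.antitoneOn_energy (Set.mem_Ioi.2 zero_lt_one)
    (Set.mem_Ioi.2 (zero_lt_one.trans_le hs)) hs
  have h2 : 1 ≤ Real.exp (q / s) := by
    rw [← Real.exp_zero]; apply Real.exp_le_exp.2
    have := H.nonneg; positivity
  simp only at h1
  have h3 : |h s| ≤ √((h 1 ^ 2 + h₁ 1 ^ 2) * Real.exp (q / 1)) := by
    rw [← Real.sqrt_sq_eq_abs]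
    apply Real.sqrt_le_sqrt
    nlinarith [sq_nonneg (h s), sq_nonneg (h₁ s)]
  linarith

/-- A nonzero solution is asymptotic to a nonzero solution `Re (z e^{is})` of `h'' = -h`. -/
lemma exists_asymptotic {s₀ : ℝ} (hs₀ : 0 < s₀) (hne : h s₀ ≠ 0) :
    ∃ (z : ℂ) (C : ℝ), z ≠ 0 ∧ 0 < C ∧
      ∀ s ≥ 1, |h s - (z * Complex.exp (s * Complex.I)).re| ≤ C / s := by
  obtain ⟨B, hB0, hB⟩ := H.exists_bound
  have hq := H.nonneg
  -- The solution in the rotating frame, whose derivative is `O(s⁻²)`.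
  set ζ : ℝ → ℂ := fun s => ((h s : ℂ) - Complex.I * (h₁ s : ℂ)) * Complex.exp (-s * Complex.I)
    with hζ
  have hζd : ∀ s > 0, HasDerivAt ζ (-Complex.I * (q / s ^ 2 * h s : ℝ) * Complex.exp (-s * Complex.I)) s := by
    intro s hs
    have h1 := (H.deriv s hs).ofReal_comp.sub ((H.deriv' s hs).ofReal_comp.const_mul Complex.I)
    have h2 : HasDerivAt (fun s : ℝ => Complex.exp (-s * Complex.I))
        (Complex.exp (-s * Complex.I) * (-1 * Complex.I)) s :=
      (((hasDerivAt_id s).ofReal_comp.neg).mul_const Complex.I).cexp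
    refine (h1.mul h2).congr_deriv ?_
    push_cast
    simp only [Pi.sub_apply]
    linear_combination ((h₁ s : ℂ) * Complex.exp (-s * Complex.I)) * Complex.I_mul_I
  have hexp : ∀ s : ℝ, ‖Complex.exp (-s * Complex.I)‖ = 1 := fun s => by
    simpa using Complex.norm_exp_ofReal_mul_I (-s)
  -- `q B (1 / s - 1 / t)` is the integral of the bound `q B / x²` of the derivative.
  have hcauchy : ∀ s ≥ 1, ∀ t ≥ s, ‖ζ t - ζ s‖ ≤ q * B * (1 / s - 1 / t) := by
    intro s hs t hst
    have hder : ∀ x ∈ Set.Icc s t, HasDerivAt (fun x => ζ x - ζ s)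
        (-Complex.I * (q / x ^ 2 * h x : ℝ) * Complex.exp (-x * Complex.I)) x := fun x hx =>
      (hζd x (by linarith [hx.1])).sub_const _
    have hder2 : ∀ x ∈ Set.Icc s t, HasDerivAt (fun x => q * B * (1 / s - 1 / x))
        (q * B * (1 / x ^ 2)) x := fun x hx => by
      have hx0 : x ≠ 0 := by linarith [hx.1]
      have := ((hasDerivAt_inv hx0).const_sub (1 / s)).const_mul (q * B)
      simp only [one_div]
      simp only [one_div] at this
      refine this.congr_deriv ?_
      field_simp
    refine image_norm_le_of_norm_deriv_right_le_deriv_boundary' (f := fun x => ζ x - ζ s)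
      (B := fun x => q * B * (1 / s - 1 / x)) (a := s) (b := t)
      (fun x hx => (hder x hx).continuousAt.continuousWithinAt)
      (fun x hx => (hder x ⟨hx.1, hx.2.le⟩).hasDerivWithinAt) (by simp)
      (fun x hx => (hder2 x hx).continuousAt.continuousWithinAt)
      (fun x hx => (hder2 x ⟨hx.1, hx.2.le⟩).hasDerivWithinAt) (fun x hx => ?_)
      (Set.right_mem_Icc.2 hst)
    rw [norm_mul, norm_mul, hexp, norm_neg, Complex.norm_I, Complex.norm_real, Real.norm_eq_abs,
      abs_mul, abs_of_nonneg (by positivity : 0 ≤ q / x ^ 2)]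
    have := hB x (by linarith [hx.1])
    calc 1 * (q / x ^ 2 * |h x|) * 1 = q / x ^ 2 * |h x| := by ring
      _ ≤ q / x ^ 2 * B := by gcongr
      _ = q * B * (1 / x ^ 2) := by ring
  have hcauchy' : ∀ s ≥ 1, ∀ t ≥ s, ‖ζ t - ζ s‖ ≤ q * B / s := fun s hs t hst => by
    refine (hcauchy s hs t hst).trans ?_
    have ht : 0 < t := by linarith
    have : 0 ≤ 1 / t := by positivity
    have h3 : 0 ≤ q * B := by positivity
    rw [div_eq_mul_one_div (q * B)]
    exact mul_le_mul_of_nonneg_left (by linarith) h3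
  obtain ⟨z, hz⟩ : ∃ z, Tendsto ζ atTop (𝓝 z) := by
    apply cauchySeq_tendsto_of_complete
    rw [Metric.cauchySeq_iff']
    intro ε hε
    refine ⟨max 1 (2 * (q * B) / ε + 1), fun t ht => ?_⟩
    have h1 : (1 : ℝ) ≤ max 1 (2 * (q * B) / ε + 1) := le_max_left _ _
    rw [dist_eq_norm]
    refine (hcauchy' _ h1 t ht).trans_lt ?_
    rw [div_lt_iff₀ (by linarith)]
    have h2 : 2 * (q * B) / ε + 1 ≤ max 1 (2 * (q * B) / ε + 1) := le_max_right _ _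
    have h3 : ε * (2 * (q * B) / ε + 1) ≤ ε * max 1 (2 * (q * B) / ε + 1) := by gcongr
    have h4 : ε * (2 * (q * B) / ε + 1) = 2 * (q * B) + ε := by field_simp
    have h5 : 0 ≤ q * B := by positivity
    linarith
  have hnorm : ∀ s, ‖ζ s‖ ^ 2 = h s ^ 2 + h₁ s ^ 2 := fun s => by
    simp only [hζ, norm_mul, hexp, mul_one]
    rw [← Complex.normSq_eq_norm_sq, Complex.normSq_apply]
    simp; ring
  refine ⟨z, q * B + 1, ?_, by positivity, fun s hs => ?_⟩
  -- `‖ζ‖²` is the energy, which its value at `s₀` bounds from below: the limit cannot vanish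
  · intro hz0
    subst hz0
    have h1 : Tendsto (fun s => ‖ζ s‖ ^ 2) atTop (𝓝 0) := by simpa using hz.norm.pow 2
    have h2 : ∀ᶠ s in atTop, (h s₀ ^ 2 + h₁ s₀ ^ 2) * Real.exp (-q / s₀) ≤ ‖ζ s‖ ^ 2 := by
      filter_upwards [eventually_ge_atTop s₀] with s hs
      have h3 := H.monotoneOn_energy (Set.mem_Ioi.2 hs₀) (Set.mem_Ioi.2 (hs₀.trans_le hs)) hs
      simp only at h3
      rw [hnorm]
      refine h3.trans (mul_le_of_le_one_right (by positivity) ?_)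
      rw [Real.exp_le_one_iff, neg_div]
      have : 0 < s := hs₀.trans_le hs
      rw [neg_nonpos]; positivity
    have h4 := ge_of_tendsto h1 h2
    have h5 : 0 < (h s₀ ^ 2 + h₁ s₀ ^ 2) * Real.exp (-q / s₀) := by positivity
    linarith
  · have hs0 : 0 < s := by linarith
    have h1 : ‖z - ζ s‖ ≤ q * B / s :=
      le_of_tendsto ((hz.sub_const _).norm) ((eventually_ge_atTop s).mono fun t ht => hcauchy' s hs t ht)
    have h2 : h s = (ζ s * Complex.exp (s * Complex.I)).re := by
      simp only [hζ]
      rw [mul_assoc, ← Complex.exp_add]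
      simp
    rw [h2, ← Complex.sub_re, ← sub_mul]
    refine (Complex.abs_re_le_norm _).trans ?_
    rw [norm_mul, Complex.norm_exp_ofReal_mul_I, mul_one, norm_sub_rev]
    refine h1.trans ?_
    gcongr
    linarith

end IsPerturbedOscillation

/-! ### The radial profile of the Fourier transform of a ball -/

/-- `∫_{-1}^{1} (1 - t²)^{n/2} cos(s t) dt`: up to a constant, the Fourier transform of the unit
ball of dimension `n + 1` at a frequency of norm `s`. -/
noncomputable def ballProfile (n : ℕ) (s : ℝ) : ℝ :=
  ∫ t in (-1 : ℝ)..1, √(1 - t ^ 2) ^ n * Real.cos (s * t)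

lemma sqrt_one_sub_sq_le_one (t : ℝ) : √(1 - t ^ 2) ≤ 1 := by
  rw [Real.sqrt_le_one]; nlinarith [sq_nonneg t]

lemma hasDerivAt_ballProfile (s : ℝ) :
    HasDerivAt (ballProfile n)
      (∫ t in (-1 : ℝ)..1, -(√(1 - t ^ 2) ^ n * t * Real.sin (s * t))) s := by
  refine (intervalIntegral.hasDerivAt_integral_of_dominated_loc_of_deriv_le
    (F := fun s t => √(1 - t ^ 2) ^ n * Real.cos (s * t))
    (F' := fun s t => -(√(1 - t ^ 2) ^ n * t * Real.sin (s * t)))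
    (bound := fun t => |√(1 - t ^ 2) ^ n * t|) Filter.univ_mem
    (Eventually.of_forall fun x => (by fun_prop : Continuous _).aestronglyMeasurable)
    ((by fun_prop : Continuous _).intervalIntegrable _ _)
    (by fun_prop : Continuous _).aestronglyMeasurable
    (ae_of_all _ fun t _ x _ => ?_) ((by fun_prop : Continuous _).intervalIntegrable _ _)
    (ae_of_all _ fun t _ x _ => ?_)).2
  · rw [norm_neg, norm_mul, Real.norm_eq_abs, Real.norm_eq_abs]
    exact mul_le_of_le_one_right (abs_nonneg _) (Real.abs_sin_le_one _)
  · have := ((Real.hasDerivAt_cos (x * t)).comp x ((hasDerivAt_id x).mul_const t)).const_mul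
      (√(1 - t ^ 2) ^ n)
    refine this.congr_deriv ?_
    simp; ring

lemma hasDerivAt_ballProfile' (s : ℝ) :
    HasDerivAt (fun s => ∫ t in (-1 : ℝ)..1, -(√(1 - t ^ 2) ^ n * t * Real.sin (s * t)))
      (∫ t in (-1 : ℝ)..1, -(√(1 - t ^ 2) ^ n * t ^ 2 * Real.cos (s * t))) s := by
  refine (intervalIntegral.hasDerivAt_integral_of_dominated_loc_of_deriv_le
    (F := fun s t => -(√(1 - t ^ 2) ^ n * t * Real.sin (s * t)))
    (F' := fun s t => -(√(1 - t ^ 2) ^ n * t ^ 2 * Real.cos (s * t)))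
    (bound := fun t => |√(1 - t ^ 2) ^ n * t ^ 2|) Filter.univ_mem
    (Eventually.of_forall fun x => (by fun_prop : Continuous _).aestronglyMeasurable)
    ((by fun_prop : Continuous _).intervalIntegrable _ _)
    (by fun_prop : Continuous _).aestronglyMeasurable
    (ae_of_all _ fun t _ x _ => ?_) ((by fun_prop : Continuous _).intervalIntegrable _ _)
    (ae_of_all _ fun t _ x _ => ?_)).2
  · rw [norm_neg, norm_mul, Real.norm_eq_abs, Real.norm_eq_abs]
    exact mul_le_of_le_one_right (abs_nonneg _) (Real.abs_cos_le_one _)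
  · have := (((Real.hasDerivAt_sin (x * t)).comp x ((hasDerivAt_id x).mul_const t)).const_mul
      (√(1 - t ^ 2) ^ n * t)).neg
    refine this.congr_deriv ?_
    simp; ring

/-- Integration by parts, the source of Bessel's equation for `ballProfile`. -/
lemma ballProfile_integral_by_parts (s : ℝ) :
    s * ∫ t in (-1 : ℝ)..1, √(1 - t ^ 2) ^ (n + 2) * Real.cos (s * t)
      = (n + 2) * ∫ t in (-1 : ℝ)..1, √(1 - t ^ 2) ^ n * t * Real.sin (s * t) := by
  have h1 : ∫ t in (-1 : ℝ)..1, (s * (√(1 - t ^ 2) ^ (n + 2) * Real.cos (s * t))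
      - (n + 2) * (√(1 - t ^ 2) ^ n * t * Real.sin (s * t))) = 0 := by
    rw [intervalIntegral.integral_eq_sub_of_hasDerivAt_of_le (by norm_num)
      (f := fun t => √(1 - t ^ 2) ^ (n + 2) * Real.sin (s * t))
      (by fun_prop : Continuous fun t : ℝ => √(1 - t ^ 2) ^ (n + 2) * Real.sin (s * t)).continuousOn
      (fun t ht => ?_) ((by fun_prop : Continuous _).intervalIntegrable _ _)]
    · simp
    · have hpos : 0 < 1 - t ^ 2 := by nlinarith [ht.1, ht.2]
      have h2 : HasDerivAt (fun t : ℝ => 1 - t ^ 2) (-(2 * t)) t := by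
        simpa using (hasDerivAt_pow 2 t).const_sub 1
      have h3 := (h2.sqrt hpos.ne').pow (n + 2)
      have h4 := (Real.hasDerivAt_sin (s * t)).comp t ((hasDerivAt_id t).const_mul s)
      refine (h3.mul h4).congr_deriv ?_
      have hw : √(1 - t ^ 2) ≠ 0 := (Real.sqrt_pos.2 hpos).ne'
      simp only [Function.comp_apply, show n + 2 - 1 = n + 1 from rfl, Pi.pow_apply]
      push_cast
      field_simp
      ring
  rw [intervalIntegral.integral_sub ((by fun_prop : Continuous _).intervalIntegrable _ _)
    ((by fun_prop : Continuous _).intervalIntegrable _ _),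
    intervalIntegral.integral_const_mul, intervalIntegral.integral_const_mul] at h1
  linarith

/-- `s^{(n+2)/2}` times `ballProfile n s`; the power is chosen to remove the first order term from
Bessel's equation. -/
noncomputable def normalizedProfile (n : ℕ) (s : ℝ) : ℝ :=
  s ^ (((n : ℝ) + 2) / 2) * ballProfile n s

lemma exists_isPerturbedOscillation (n : ℕ) :
    ∃ (q : ℝ) (h₁ : ℝ → ℝ), IsPerturbedOscillation q (normalizedProfile n) h₁ := by
  set α : ℝ := ((n : ℝ) + 2) / 2 with hα
  have hα1 : 1 ≤ α := by
    rw [hα]; have : (0 : ℝ) ≤ n := n.cast_nonneg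
    linarith
  set β₁ : ℝ → ℝ := fun s => ∫ t in (-1 : ℝ)..1, -(√(1 - t ^ 2) ^ n * t * Real.sin (s * t))
  set β₂ : ℝ → ℝ := fun s => ∫ t in (-1 : ℝ)..1, -(√(1 - t ^ 2) ^ n * t ^ 2 * Real.cos (s * t))
  have hrp : ∀ s > 0, ∀ a : ℝ, HasDerivAt (fun s : ℝ => s ^ a) (a * s ^ (a - 1)) s := fun s hs a =>
    Real.hasDerivAt_rpow_const (Or.inl hs.ne')
  have hode : ∀ s > 0, β₂ s = -ballProfile n s - 2 * α / s * β₁ s := by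
    intro s hs
    have h1 := ballProfile_integral_by_parts (n := n) s
    have h2 : β₁ s = -∫ t in (-1 : ℝ)..1, √(1 - t ^ 2) ^ n * t * Real.sin (s * t) :=
      intervalIntegral.integral_neg
    have h3 : ∫ t in (-1 : ℝ)..1, √(1 - t ^ 2) ^ (n + 2) * Real.cos (s * t)
        = ballProfile n s + β₂ s := by
      rw [ballProfile, ← intervalIntegral.integral_add
        ((by fun_prop : Continuous _).intervalIntegrable _ _)
        ((by fun_prop : Continuous _).intervalIntegrable _ _)]
      refine intervalIntegral.integral_congr fun t ht => ?_
      rw [Set.uIcc_of_le (by norm_num)] at ht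
      have hpos : 0 ≤ 1 - t ^ 2 := by nlinarith [ht.1, ht.2]
      simp only [pow_add, Real.sq_sqrt hpos]
      ring
    have h4 : ∫ t in (-1 : ℝ)..1, √(1 - t ^ 2) ^ n * t * Real.sin (s * t) = -β₁ s := by
      rw [h2, neg_neg]
    rw [h3, h4] at h1
    have : 2 * α = n + 2 := by rw [hα]; ring
    rw [this]
    field_simp
    linarith
  refine ⟨α * (α - 1), fun s => s ^ α * β₁ s + α * s ^ (α - 1) * ballProfile n s,
    mul_nonneg (by linarith) (by linarith), fun s hs => ?_, fun s hs => ?_⟩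
  · refine ((hrp s hs α).mul (hasDerivAt_ballProfile s)).congr_deriv ?_
    simp only [β₁]; ring
  · have h1 := ((hrp s hs α).mul (hasDerivAt_ballProfile' (n := n) s)).add
      (((hrp s hs (α - 1)).const_mul α).mul (hasDerivAt_ballProfile (n := n) s))
    refine h1.congr_deriv ?_
    have e0 : (∫ t in (-1 : ℝ)..1, -(√(1 - t ^ 2) ^ n * t * Real.sin (s * t))) = β₁ s := rfl
    have e1 : (∫ t in (-1 : ℝ)..1, -(√(1 - t ^ 2) ^ n * t ^ 2 * Real.cos (s * t))) = β₂ s := rfl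
    rw [e0, e1, hode s hs, normalizedProfile, ← hα, Real.rpow_sub_one hs.ne' (α - 1),
      Real.rpow_sub_one hs.ne' α]
    field_simp
    ring

lemma continuous_ballProfile : Continuous (ballProfile n) :=
  continuous_iff_continuousAt.2 fun s => (hasDerivAt_ballProfile s).continuousAt

lemma abs_ballProfile_le (s : ℝ) : |ballProfile n s| ≤ 2 := by
  have := intervalIntegral.norm_integral_le_of_norm_le_const (a := (-1 : ℝ)) (b := 1) (C := 1)
    (f := fun t => √(1 - t ^ 2) ^ n * Real.cos (s * t)) fun t _ => by
      rw [norm_mul, norm_pow, Real.norm_eq_abs, Real.norm_eq_abs, abs_of_nonneg (Real.sqrt_nonneg _)]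
      exact mul_le_one₀ (pow_le_one₀ (Real.sqrt_nonneg _) (sqrt_one_sub_sq_le_one t)) (abs_nonneg _)
        (Real.abs_cos_le_one _)
  rw [ballProfile, ← Real.norm_eq_abs]
  refine this.trans_eq ?_
  norm_num

lemma ballProfile_zero_pos : 0 < ballProfile n 0 := by
  rw [ballProfile]
  refine intervalIntegral.intervalIntegral_pos_of_pos_on
    ((by fun_prop : Continuous _).intervalIntegrable _ _) (fun t ht => ?_) (by norm_num)
  have hpos : 0 < 1 - t ^ 2 := by nlinarith [ht.1, ht.2]
  have := Real.sqrt_pos.2 hpos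
  simp; positivity

/-- Near the origin the profile is bounded below. -/
lemma exists_ballProfile_lower (n : ℕ) : ∃ s₀ a : ℝ, 0 < s₀ ∧ 0 < a ∧
    ∀ s, 0 ≤ s → s ≤ s₀ → a ≤ ballProfile n s := by
  have h0 := ballProfile_zero_pos (n := n)
  have h1 := continuous_ballProfile (n := n) |>.tendsto 0 |>.eventually (lt_mem_nhds (half_lt_self h0))
  obtain ⟨ε, hε, h2⟩ := Metric.eventually_nhds_iff.1 h1
  refine ⟨ε / 2, ballProfile n 0 / 2, by positivity, by positivity, fun s hs hs' => (h2 ?_).le⟩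
  rw [Real.dist_eq, sub_zero, abs_of_nonneg hs]; linarith

lemma normalizedProfile_sq {s : ℝ} (hs : 0 ≤ s) :
    normalizedProfile n s ^ 2 = s ^ (n + 2) * ballProfile n s ^ 2 := by
  rw [normalizedProfile, mul_pow, ← Real.rpow_natCast (s ^ _) 2, ← Real.rpow_mul hs]
  congr 1
  rw [← Real.rpow_natCast s]
  congr 1
  push_cast; ring

/-- The decay of the Fourier transform of the ball: `normalizedProfile` is bounded. -/
lemma exists_normalizedProfile_bound (n : ℕ) : ∃ H : ℝ, 0 < H ∧ ∀ s ≥ 0, |normalizedProfile n s| ≤ H := by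
  obtain ⟨q, h₁, hO⟩ := exists_isPerturbedOscillation n
  obtain ⟨B, hB, h⟩ := hO.exists_bound
  refine ⟨B + 2, by positivity, fun s hs => ?_⟩
  rcases le_total 1 s with h1 | h1
  · linarith [h s h1]
  · rw [normalizedProfile, abs_mul, abs_of_nonneg (Real.rpow_nonneg hs _)]
    have h2 : s ^ (((n : ℝ) + 2) / 2) ≤ 1 := Real.rpow_le_one hs h1 (by positivity)
    have h3 := abs_ballProfile_le (n := n) s
    nlinarith [abs_nonneg (ballProfile n s)]

/-- The profile really oscillates: its amplitude does not tend to zero. -/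
lemma exists_normalizedProfile_asymptotic (n : ℕ) : ∃ (z : ℂ) (C : ℝ), z ≠ 0 ∧ 0 < C ∧
    ∀ s ≥ 1, |normalizedProfile n s - (z * Complex.exp (s * Complex.I)).re| ≤ C / s := by
  obtain ⟨q, h₁, hO⟩ := exists_isPerturbedOscillation n
  obtain ⟨s₀, a, hs₀, ha, h⟩ := exists_ballProfile_lower n
  refine hO.exists_asymptotic hs₀ ?_
  have := h s₀ hs₀.le le_rfl
  exact mul_ne_zero (Real.rpow_pos_of_pos hs₀ _).ne' (by linarith)

lemma continuous_normalizedProfile : Continuous (normalizedProfile n) := by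
  refine Continuous.mul ?_ continuous_ballProfile
  exact Real.continuous_rpow_const (by positivity)

/-! ### The Fourier transform of a ball -/

/-- The Fourier transform `∫_{‖y‖ ≤ L} e^{iξ·y} dy` of the indicator function of a ball. -/
noncomputable def ballFT (L : ℝ) (ξ : 𝔼 d) : ℂ := ∫ y in Metric.closedBall (0 : 𝔼 d) L, chi ξ y

/-- The volume of the unit ball of dimension `n`. -/
noncomputable def unitBallVolume (n : ℕ) : ℝ := volume.real (Metric.ball (0 : 𝔼 n) 1)

lemma unitBallVolume_pos (n : ℕ) : 0 < unitBallVolume n :=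
  ENNReal.toReal_pos (Metric.measure_ball_pos _ _ one_pos).ne' measure_ball_lt_top.ne

lemma volume_real_closedBall {r : ℝ} (hr : 0 ≤ r) (x : 𝔼 n) :
    volume.real (Metric.closedBall x r) = r ^ n * unitBallVolume n := by
  rw [Measure.addHaar_real_closedBall _ _ hr, finrank_euclideanSpace_fin, unitBallVolume]

/-- Slicing the unit ball by hyperplanes orthogonal to the first axis. -/
lemma setIntegral_unitBall_coord {g : ℝ → ℂ} (hg : Continuous g) :
    ∫ y in Metric.closedBall (0 : 𝔼 (n + 1)) 1, g (y 0)
      = ∫ t in (-1 : ℝ)..1, ((unitBallVolume n * √(1 - t ^ 2) ^ n : ℝ) : ℂ) * g t := by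
  set F : 𝔼 (n + 1) → ℂ := (Metric.closedBall (0 : 𝔼 (n + 1)) 1).indicator fun y => g (y 0) with hF
  have hFi : Integrable F := (integrable_of_continuous_of_isBounded (by fun_prop)
    Metric.isBounded_closedBall).integrable_indicator Metric.isClosed_closedBall.measurableSet
  set e := (MeasurableEquiv.piFinSuccAbove (fun _ : Fin (n + 1) => ℝ) 0).symm with he
  have hmp : MeasurePreserving (fun p : ℝ × (Fin n → ℝ) => WithLp.toLp 2 (e p)) volume
      (volume : Measure (𝔼 (n + 1))) :=
    (PiLp.volume_preserving_toLp (Fin (n + 1))).comp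
      ((volume_preserving_piFinSuccAbove (fun _ : Fin (n + 1) => ℝ) 0).symm _)
  have hemb : MeasurableEmbedding fun p : ℝ × (Fin n → ℝ) => (WithLp.toLp 2 (e p) : 𝔼 (n + 1)) :=
    (MeasurableEquiv.toLp 2 (Fin (n + 1) → ℝ)).measurableEmbedding.comp e.measurableEmbedding
  have hFi' : Integrable (fun p : ℝ × (Fin n → ℝ) => F (WithLp.toLp 2 (e p))) volume :=
    (hmp.integrable_comp_emb hemb).2 hFi
  rw [← integral_indicator Metric.isClosed_closedBall.measurableSet, ← hF,
    ← hmp.integral_comp hemb, Measure.volume_eq_prod, integral_prod _ hFi']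
  have hval : ∀ t : ℝ, ∀ y : Fin n → ℝ, F (WithLp.toLp 2 (e (t, y)))
      = {y : Fin n → ℝ | t ^ 2 + ∑ k, y k ^ 2 ≤ 1}.indicator (fun _ => g t) y := by
    intro t y
    have h0 : (WithLp.toLp 2 (e (t, y)) : 𝔼 (n + 1)) 0 = t := by simp [he]
    have h1 : ‖(WithLp.toLp 2 (e (t, y)) : 𝔼 (n + 1))‖ ^ 2 = t ^ 2 + ∑ k, y k ^ 2 := by
      rw [EuclideanSpace.real_norm_sq_eq, Fin.sum_univ_succ, h0]
      simp [he]
    have h2 : (WithLp.toLp 2 (e (t, y)) : 𝔼 (n + 1)) ∈ Metric.closedBall (0 : 𝔼 (n + 1)) 1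
        ↔ y ∈ {y : Fin n → ℝ | t ^ 2 + ∑ k, y k ^ 2 ≤ 1} := by
      rw [mem_closedBall_zero_iff, ← sq_le_one_iff₀ (norm_nonneg _), h1]; rfl
    by_cases h : y ∈ {y : Fin n → ℝ | t ^ 2 + ∑ k, y k ^ 2 ≤ 1}
    · rw [Set.indicator_of_mem h, hF, Set.indicator_of_mem (h2.2 h), h0]
    · rw [Set.indicator_of_notMem h, hF, Set.indicator_of_notMem (fun h' => h (h2.1 h'))]
  simp_rw [hval]
  have hslice : ∀ t : ℝ, ∫ y : Fin n → ℝ,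
      {y : Fin n → ℝ | t ^ 2 + ∑ k, y k ^ 2 ≤ 1}.indicator (fun _ => g t) y
      = (Set.Icc (-1 : ℝ) 1).indicator
        (fun t => ((unitBallVolume n * √(1 - t ^ 2) ^ n : ℝ) : ℂ) * g t) t := by
    intro t
    have hm : MeasurableSet {y : Fin n → ℝ | t ^ 2 + ∑ k, y k ^ 2 ≤ 1} :=
      measurableSet_le (by fun_prop) (by fun_prop)
    rw [integral_indicator_const _ hm]
    by_cases ht : t ∈ Set.Icc (-1 : ℝ) 1
    · rw [Set.indicator_of_mem ht, Complex.real_smul]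
      have hpos : 0 ≤ 1 - t ^ 2 := by nlinarith [ht.1, ht.2]
      congr 2
      have hpre : {y : Fin n → ℝ | t ^ 2 + ∑ k, y k ^ 2 ≤ 1}
          = (WithLp.toLp 2 : (Fin n → ℝ) → 𝔼 n) ⁻¹' Metric.closedBall 0 (√(1 - t ^ 2)) := by
        ext y
        rw [Set.mem_preimage, mem_closedBall_zero_iff, Real.le_sqrt (norm_nonneg _) hpos,
          EuclideanSpace.real_norm_sq_eq, Set.mem_ofPred_eq]
        constructor <;> intro h <;> linarith
      rw [hpre, (PiLp.volume_preserving_toLp (Fin n)).measureReal_preimage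
        Metric.isClosed_closedBall.nullMeasurableSet,
        volume_real_closedBall (Real.sqrt_nonneg _), mul_comm]
    · rw [Set.indicator_of_notMem ht]
      have : {y : Fin n → ℝ | t ^ 2 + ∑ k, y k ^ 2 ≤ 1} = ∅ := by
        refine Set.eq_empty_of_forall_notMem fun y hy => ht ?_
        have h1 : 0 ≤ ∑ k, y k ^ 2 := Finset.sum_nonneg fun k _ => sq_nonneg _
        rw [Set.mem_ofPred_eq] at hy
        exact abs_le.1 (abs_le_one_iff_mul_self_le_one.2 (by nlinarith))
      rw [this]; simp
  simp_rw [hslice]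
  rw [integral_indicator measurableSet_Icc, integral_Icc_eq_integral_Ioc,
    intervalIntegral.integral_of_le (by norm_num)]

/-- The sine part of the exponential integral vanishes by symmetry. -/
lemma integral_profile_exp (s : ℝ) :
    ∫ t in (-1 : ℝ)..1, ((unitBallVolume n * √(1 - t ^ 2) ^ n : ℝ) : ℂ)
      * Complex.exp (Complex.I * ((s * t : ℝ) : ℂ))
      = ((unitBallVolume n * ballProfile n s : ℝ) : ℂ) := by
  have hodd : ∫ t in (-1 : ℝ)..1, √(1 - t ^ 2) ^ n * Real.sin (s * t) = 0 := by
    have h := intervalIntegral.integral_comp_neg (a := -1) (b := 1)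
      (fun t : ℝ => √(1 - t ^ 2) ^ n * Real.sin (s * t))
    simp only [neg_neg, mul_neg, Real.sin_neg, even_two.neg_pow] at h
    rw [intervalIntegral.integral_neg] at h
    linarith
  have h1 : ∀ t : ℝ, ((unitBallVolume n * √(1 - t ^ 2) ^ n : ℝ) : ℂ)
      * Complex.exp (Complex.I * ((s * t : ℝ) : ℂ))
      = (unitBallVolume n : ℂ) * (((√(1 - t ^ 2) ^ n * Real.cos (s * t) : ℝ) : ℂ)
        + ((√(1 - t ^ 2) ^ n * Real.sin (s * t) : ℝ) : ℂ) * Complex.I) := fun t => by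
    rw [mul_comm Complex.I, Complex.exp_mul_I, ← Complex.ofReal_cos, ← Complex.ofReal_sin]
    push_cast; ring
  simp_rw [h1]
  rw [intervalIntegral.integral_const_mul, intervalIntegral.integral_add
    ((by fun_prop : Continuous _).intervalIntegrable _ _)
    ((by fun_prop : Continuous _).intervalIntegrable _ _), intervalIntegral.integral_mul_const,
    intervalIntegral.integral_ofReal, intervalIntegral.integral_ofReal, hodd, ballProfile]
  push_cast; ring

/-- The Fourier transform of a ball is radial; after rotating the frequency to the first axis it is
computed by slicing. -/
lemma ballFT_eq {L : ℝ} (hL : 0 < L) (ξ : 𝔼 (n + 1)) :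
    ballFT L ξ = ((L ^ (n + 1) * (unitBallVolume n * ballProfile n (L * ‖ξ‖)) : ℝ) : ℂ) := by
  have h1 : ballFT L ξ = L ^ (n + 1) • ∫ y in Metric.closedBall (0 : 𝔼 (n + 1)) 1, chi ξ (L • y) := by
    have h := Measure.setIntegral_comp_smul_of_pos (volume : Measure (𝔼 (n + 1))) (chi ξ)
      (Metric.closedBall (0 : 𝔼 (n + 1)) 1) hL
    rw [smul_unitClosedBall_of_nonneg hL.le, finrank_euclideanSpace_fin] at h
    rw [h, ballFT, smul_inv_smul₀ (by positivity)]
  set e0 : 𝔼 (n + 1) := EuclideanSpace.single 0 ‖ξ‖ with he0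
  have hnorm : ‖e0‖ = ‖ξ‖ := by simp [he0]
  set R := (ℝ ∙ (e0 - ξ))ᗮ.reflection with hR
  have hRe : R e0 = ξ := Submodule.reflection_sub hnorm
  have h2 : ∫ y in Metric.closedBall (0 : 𝔼 (n + 1)) 1, chi ξ (L • y)
      = ∫ y in Metric.closedBall (0 : 𝔼 (n + 1)) 1,
        Complex.exp (Complex.I * ((L * ‖ξ‖ * y 0 : ℝ) : ℂ)) := by
    have h := R.measurePreserving.setIntegral_preimage_emb
      R.toMeasurableEquiv.measurableEmbedding (fun y => chi ξ (L • y))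
      (Metric.closedBall (0 : 𝔼 (n + 1)) 1)
    rw [← h]
    have hpre : R ⁻¹' Metric.closedBall (0 : 𝔼 (n + 1)) 1 = Metric.closedBall (0 : 𝔼 (n + 1)) 1 := by
      ext y; simp
    rw [hpre]
    congr 1
    ext y
    have : inner ℝ ξ (L • R y) = L * ‖ξ‖ * y 0 := by
      rw [inner_smul_right]
      nth_rewrite 1 [← hRe]
      rw [LinearIsometryEquiv.inner_map_map, he0, EuclideanSpace.inner_single_left]
      simp; ring
    rw [chi, this]
  rw [h1, h2, setIntegral_unitBall_coord
    (g := fun t => Complex.exp (Complex.I * ((L * ‖ξ‖ * t : ℝ) : ℂ))) (by fun_prop),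
    integral_profile_exp, Complex.real_smul]
  push_cast; ring

/-- The real-valued form of `ballFT`. -/
noncomputable def ballFTReal (n : ℕ) (L r : ℝ) : ℝ :=
  L ^ (n + 1) * (unitBallVolume n * ballProfile n (L * r))

lemma ballFT_eq_real {L : ℝ} (hL : 0 < L) (ξ : 𝔼 (n + 1)) :
    ballFT L ξ = (ballFTReal n L ‖ξ‖ : ℂ) := ballFT_eq hL ξ

lemma continuous_ballFTReal (L : ℝ) : Continuous (ballFTReal n L) := by
  have := continuous_ballProfile (n := n)
  unfold ballFTReal; fun_prop

lemma ballFTReal_sq {L r : ℝ} (hL : 0 < L) (hr : 0 < r) :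
    ballFTReal n L r ^ 2
      = L ^ n / r ^ (n + 2) * (unitBallVolume n * normalizedProfile n (L * r)) ^ 2 := by
  rw [ballFTReal, mul_pow, mul_pow _ (normalizedProfile _ _), normalizedProfile_sq (by positivity)]
  field_simp
  ring

lemma ballFTReal_eq {L r : ℝ} (hL : 0 < L) (hr : 0 < r) :
    ballFTReal n L r = unitBallVolume n * (L ^ ((n : ℝ) / 2) * r ^ (-(((n : ℝ) + 2) / 2)))
      * normalizedProfile n (L * r) := by
  rw [ballFTReal, normalizedProfile, Real.mul_rpow hL.le hr.le, Real.rpow_neg hr.le,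
    ← Real.rpow_natCast L]
  have h1 : L ^ (((n + 1 : ℕ) : ℝ)) = L ^ ((n : ℝ) / 2) * L ^ (((n : ℝ) + 2) / 2) := by
    rw [← Real.rpow_add hL]; congr 1; push_cast; ring
  have h2 : r ^ (((n : ℝ) + 2) / 2) ≠ 0 := (Real.rpow_pos_of_pos hr _).ne'
  rw [h1]; field_simp

/-- The two bounds on the Fourier transform of a ball. -/
lemma exists_ballFTReal_bound (n : ℕ) : ∃ A : ℝ, 0 < A ∧ ∀ L > 0,
    (∀ r, ballFTReal n L r ^ 2 ≤ A * L ^ (2 * (n + 1))) ∧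
    ∀ r > 0, ballFTReal n L r ^ 2 ≤ A * (L ^ n / r ^ (n + 2)) := by
  obtain ⟨H, hH, h⟩ := exists_normalizedProfile_bound n
  have hV := unitBallVolume_pos n
  refine ⟨(unitBallVolume n * 2) ^ 2 + (unitBallVolume n * H) ^ 2, by positivity,
    fun L hL => ⟨fun r => ?_, fun r hr => ?_⟩⟩
  · have h1 : (unitBallVolume n * ballProfile n (L * r)) ^ 2 ≤ (unitBallVolume n * 2) ^ 2 := by
      rw [sq_le_sq, abs_mul, abs_mul, abs_two]
      gcongr; exact abs_ballProfile_le _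
    rw [ballFTReal, mul_pow, ← pow_mul, mul_comm (n + 1) 2, mul_comm]
    gcongr
    have := sq_nonneg (unitBallVolume n * H)
    linarith
  · have h1 : (unitBallVolume n * normalizedProfile n (L * r)) ^ 2 ≤ (unitBallVolume n * H) ^ 2 := by
      rw [sq_le_sq, abs_mul, abs_mul, abs_of_pos hH]
      gcongr; exact h _ (by positivity)
    rw [ballFTReal_sq hL hr, mul_comm]
    gcongr
    have := sq_nonneg (unitBallVolume n * 2)
    linarith

/-! ### Unfolding over the lattice and points near a sphere -/

/-- `ℝ^d` is tiled by the translates of the unit cell. -/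
lemma hasSum_integral_cell {F : Type*} [NormedAddCommGroup F] [NormedSpace ℝ F] {f : 𝔼 d → F}
    (hf : Integrable f) :
    HasSum (fun j : Fin d → ℤ => ∫ x in cell d, f (x + latticePoint j)) (∫ x, f x) := by
  set s : (Fin d → ℤ) → Set (𝔼 d) := fun j => (fun y => y - latticePoint j) ⁻¹' cell d with hs
  have hsm : ∀ j, MeasurableSet (s j) := fun j => (by fun_prop : Measurable _) measurableSet_cell
  have hmem : ∀ j y, y ∈ s j ↔ ∀ k, ⌊y k + 1 / 2⌋ = j k := fun j y => by
    refine forall_congr' fun k => ?_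
    rw [Int.floor_eq_iff]
    simp only [PiLp.sub_apply, latticePoint_apply, Set.mem_Ico]
    constructor <;> rintro ⟨h1, h2⟩ <;> constructor <;> linarith
  have hd : Pairwise (Function.onFun Disjoint s) := fun i j hij => by
    refine Set.disjoint_left.2 fun y hi hj => hij (funext fun k => ?_)
    rw [← (hmem i y).1 hi k, (hmem j y).1 hj k]
  have hU : ⋃ j, s j = Set.univ := by
    refine Set.eq_univ_of_forall fun y => Set.mem_iUnion.2 ⟨fun k => ⌊y k + 1 / 2⌋, ?_⟩
    exact (hmem _ y).2 fun k => rfl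
  have h := hasSum_integral_iUnion (f := f) hsm hd (by rw [hU]; exact hf.integrableOn)
  rw [hU, setIntegral_univ] at h
  convert h using 2 with j
  have := (measurePreserving_sub_right (volume : Measure (𝔼 d)) (latticePoint j)).setIntegral_preimage_emb
    (MeasurableEquiv.subRight (latticePoint j)).measurableEmbedding (fun x => f (x + latticePoint j)) (cell d)
  rw [← this]
  simp [hs]

/-- The lattice points at distance at most `a` from the sphere of radius `L`. -/
noncomputable def shellPoints (d : ℕ) (L a : ℝ) : Finset (Fin d → ℤ) :=
  (ballPoints (0 : 𝔼 d) (L + a)).filter fun j => |‖latticePoint j‖ - L| ≤ a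

lemma mem_shellPoints {L a : ℝ} {j : Fin d → ℤ} :
    j ∈ shellPoints d L a ↔ |‖latticePoint j‖ - L| ≤ a := by
  rw [shellPoints, Finset.mem_filter, and_iff_right_iff_imp, mem_ballPoints, add_zero]
  intro h
  linarith [(abs_le.1 h).2]

lemma shellPoints_mono {L a b : ℝ} (h : a ≤ b) : shellPoints d L a ⊆ shellPoints d L b :=
  fun _ hj => mem_shellPoints.2 ((mem_shellPoints.1 hj).trans h)

/-- The spherical shell `{y | |‖y‖ - L| ≤ b}`. -/
def shell (d : ℕ) (L b : ℝ) : Set (𝔼 d) := {y | |‖y‖ - L| ≤ b}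

lemma mem_shell {L b : ℝ} {y : 𝔼 d} : y ∈ shell d L b ↔ |‖y‖ - L| ≤ b := Iff.rfl

lemma measurableSet_shell (L b : ℝ) : MeasurableSet (shell d L b) :=
  measurableSet_le (by fun_prop) (by fun_prop)

lemma shell_subset (L b : ℝ) : shell d L b ⊆ Metric.closedBall 0 (L + b) := fun y hy => by
  rw [mem_closedBall_zero_iff]; linarith [(abs_le.1 (mem_shell.1 hy)).2]

lemma isBounded_shell (L b : ℝ) : Bornology.IsBounded (shell d L b) :=
  Metric.isBounded_closedBall.subset (shell_subset L b)

lemma pow_succ_sub_pow_succ_le {x y : ℝ} (hy : 0 ≤ y) (hyx : y ≤ x) (n : ℕ) :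
    x ^ (n + 1) - y ^ (n + 1) ≤ (n + 1) * x ^ n * (x - y) := by
  induction n with
  | zero => simp
  | succ k ih =>
    have hx : 0 ≤ x := hy.trans hyx
    have h1 : y ^ (k + 1) ≤ x ^ (k + 1) := pow_le_pow_left₀ hy hyx _
    have h2 := mul_le_mul_of_nonneg_left ih hx
    have h3 := mul_le_mul_of_nonneg_right h1 (sub_nonneg.2 hyx)
    push_cast
    calc x ^ (k + 1 + 1) - y ^ (k + 1 + 1)
        = x * (x ^ (k + 1) - y ^ (k + 1)) + y ^ (k + 1) * (x - y) := by ring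
      _ ≤ x * ((k + 1) * x ^ k * (x - y)) + x ^ (k + 1) * (x - y) := add_le_add h2 h3
      _ = (k + 1 + 1) * x ^ (k + 1) * (x - y) := by ring

lemma volume_real_shell_le {L b : ℝ} (hb : 0 ≤ b) (hbL : b ≤ L) :
    volume.real (shell (n + 1) L b)
      ≤ (2 * (n + 1) * 2 ^ n * unitBallVolume (n + 1)) * b * L ^ n := by
  have hL : 0 ≤ L := hb.trans hbL
  have hV := unitBallVolume_pos (n + 1)
  have h1 : shell (n + 1) L b ⊆ Metric.closedBall (0 : 𝔼 (n + 1)) (L + b) \ Metric.ball 0 (L - b) := by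
    intro y hy
    refine ⟨shell_subset L b hy, fun h => ?_⟩
    rw [mem_ball_zero_iff] at h
    linarith [(abs_le.1 (mem_shell.1 hy)).1]
  have hsub : Metric.ball (0 : 𝔼 (n + 1)) (L - b) ⊆ Metric.closedBall 0 (L + b) :=
    Metric.ball_subset_closedBall.trans (Metric.closedBall_subset_closedBall (by linarith))
  have h2 : volume.real (Metric.closedBall (0 : 𝔼 (n + 1)) (L + b) \ Metric.ball 0 (L - b))
      = ((L + b) ^ (n + 1) - (L - b) ^ (n + 1)) * unitBallVolume (n + 1) := by
    rw [measureReal_sdiff hsub measurableSet_ball measure_closedBall_lt_top.ne,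
      ← Measure.addHaar_real_closedBall_eq_addHaar_real_ball,
      volume_real_closedBall (by linarith), volume_real_closedBall (by linarith)]
    ring
  have h3 := pow_succ_sub_pow_succ_le (x := L + b) (y := L - b) (by linarith) (by linarith) n
  have h4 : (L + b) ^ n ≤ (2 * L) ^ n := pow_le_pow_left₀ (by linarith) (by linarith) n
  calc volume.real (shell (n + 1) L b) ≤ _ :=
        measureReal_mono h1 ((measure_mono Set.sdiff_subset).trans_lt measure_closedBall_lt_top).ne
    _ = ((L + b) ^ (n + 1) - (L - b) ^ (n + 1)) * unitBallVolume (n + 1) := h2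
    _ ≤ ((n + 1) * (2 * L) ^ n * (L + b - (L - b))) * unitBallVolume (n + 1) := by
        refine mul_le_mul_of_nonneg_right (h3.trans ?_) hV.le
        have : 0 ≤ L + b - (L - b) := by linarith
        gcongr
    _ = _ := by rw [mul_pow]; ring

/-- The shell of fixed thickness contains `O(L^{d-1})` lattice points. -/
lemma card_shellPoints_le (n : ℕ) {a : ℝ} (ha : 0 ≤ a) : ∃ C : ℝ, 0 < C ∧
    ∀ L ≥ a + √(n + 1 : ℕ), ((shellPoints (n + 1) L a).card : ℝ) ≤ C * L ^ n := by
  have hV := unitBallVolume_pos (n + 1)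
  have hsq : 0 < √(n + 1 : ℕ) := Real.sqrt_pos.2 (by positivity)
  refine ⟨(2 * (n + 1) * 2 ^ n * unitBallVolume (n + 1)) * (a + √(n + 1 : ℕ)), by positivity,
    fun L hL => ?_⟩
  refine le_trans ?_ (volume_real_shell_le (by positivity) hL)
  have hfin : volume (shell (n + 1) L (a + √(n + 1 : ℕ))) ≠ ⊤ := (isBounded_shell _ _).measure_lt_top.ne
  have h := hasSum_integral_cell (d := n + 1)
    (f := (shell (n + 1) L (a + √(n + 1 : ℕ))).indicator fun _ => (1 : ℝ))
    ((integrableOn_const hfin).integrable_indicator (measurableSet_shell _ _))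
  rw [integral_indicator_const _ (measurableSet_shell _ _), smul_eq_mul, mul_one] at h
  have h2 := sum_le_hasSum (shellPoints (n + 1) L a)
    (fun j _ => setIntegral_nonneg measurableSet_cell fun x _ =>
      Set.indicator_nonneg (fun _ _ => zero_le_one) _) h
  refine le_trans (le_of_eq ?_) h2
  rw [Finset.card_eq_sum_ones, Nat.cast_sum]
  refine Finset.sum_congr rfl fun j hj => ?_
  have h3 : ∀ x ∈ cell (n + 1), (shell (n + 1) L (a + √(n + 1 : ℕ))).indicator (fun _ => (1 : ℝ))
      (x + latticePoint j) = 1 := fun x hx => by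
    refine Set.indicator_of_mem ?_ _
    have h4 := abs_norm_sub_norm_le (x + latticePoint j) (latticePoint j)
    rw [add_sub_cancel_right] at h4
    have h5 := norm_le_of_mem_cell hx
    have h6 := mem_shellPoints.1 hj
    calc |‖x + latticePoint j‖ - L| ≤ |‖x + latticePoint j‖ - ‖latticePoint j‖| + |‖latticePoint j‖ - L| :=
          abs_sub_le _ _ _
      _ ≤ _ := by linarith
  rw [setIntegral_congr_fun measurableSet_cell h3]
  simp

/-- Moving the lattice by `x` changes only the points at distance at most `‖x‖` from the sphere. -/
lemma symmDiff_ballPoints_subset (x : 𝔼 d) (L : ℝ) :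
    symmDiff (ballPoints x L) (ballPoints 0 L) ⊆ shellPoints d L ‖x‖ := by
  intro j hj
  have h1 := abs_norm_sub_norm_le (latticePoint j + x) (latticePoint j)
  rw [add_sub_cancel_left] at h1
  have h2 := abs_le.1 h1
  rw [Finset.mem_symmDiff, mem_ballPoints, mem_ballPoints, add_zero] at hj
  rw [mem_shellPoints, abs_le]
  rcases hj with ⟨ha, hb⟩ | ⟨ha, hb⟩ <;> push Not at hb <;> constructor <;> linarith

/-- Parseval for a difference of two exponential sums, whose coefficients are `±1` on the symmetric
difference. -/
lemma integral_norm_sq_latticeSum_sub (B B' : Finset (Fin d → ℤ)) :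
    ∫ θ in freqCube d, ‖latticeSum B θ - latticeSum B' θ‖ ^ 2
      = (2 * Real.pi) ^ d * (symmDiff B B').card := by
  have h := integral_norm_sq_sum (symmDiff B B') fun j => if j ∈ B then 1 else -1
  have h1 : ∀ θ : 𝔼 d, latticeSum B θ - latticeSum B' θ = ∑ j ∈ symmDiff B B',
      (((if j ∈ B then 1 else -1 : ℝ)) : ℂ) * chi θ (latticePoint j) := fun θ => by
    have hBB : symmDiff B B' = (B \ B') ∪ (B' \ B) := rfl
    have hdisj : Disjoint (B \ B') (B' \ B) :=
      Finset.disjoint_left.2 fun j h1 h2 => (Finset.mem_sdiff.1 h1).2 (Finset.mem_sdiff.1 h2).1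
    rw [hBB, Finset.sum_union hdisj, latticeSum, latticeSum, ← Finset.sum_sdiff_sub_sum_sdiff,
      sub_eq_add_neg, ← Finset.sum_neg_distrib]
    congr 1
    · exact Finset.sum_congr rfl fun j hj => by simp [(Finset.mem_sdiff.1 hj).1]
    · exact Finset.sum_congr rfl fun j hj => by simp [(Finset.mem_sdiff.1 hj).2]
  simp_rw [h1]
  rw [h]
  congr 1
  rw [Finset.card_eq_sum_ones, Nat.cast_sum]
  exact Finset.sum_congr rfl fun j _ => by split_ifs <;> simp

/-! ### Comparison of the exponential sum with the Fourier transform of the ball -/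

/-- Cauchy-Schwarz for real functions. -/
lemma sq_integral_mul_le {α : Type*} [MeasurableSpace α] {ν : Measure α} {f g : α → ℝ}
    (hf : Integrable (fun x => f x ^ 2) ν) (hg : Integrable (fun x => g x ^ 2) ν)
    (hfg : Integrable (fun x => f x * g x) ν) :
    (∫ x, f x * g x ∂ν) ^ 2 ≤ (∫ x, f x ^ 2 ∂ν) * ∫ x, g x ^ 2 ∂ν := by
  have h : ∀ t : ℝ, 0 ≤ (∫ x, f x ^ 2 ∂ν) * (t * t) + (-(2 * ∫ x, f x * g x ∂ν)) * t
      + ∫ x, g x ^ 2 ∂ν := fun t => by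
    have h1 : ∫ x, (t * f x - g x) ^ 2 ∂ν = (∫ x, f x ^ 2 ∂ν) * (t * t)
        + (-(2 * ∫ x, f x * g x ∂ν)) * t + ∫ x, g x ^ 2 ∂ν := by
      have h2 : ∀ x, (t * f x - g x) ^ 2 = t ^ 2 * f x ^ 2 - 2 * t * (f x * g x) + g x ^ 2 :=
        fun x => by ring
      simp_rw [h2]
      refine (integral_add ((hf.const_mul (t ^ 2)).sub (hfg.const_mul (2 * t))) hg).trans ?_
      refine (congrArg (· + _) (integral_sub (hf.const_mul (t ^ 2)) (hfg.const_mul (2 * t)))).trans ?_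
      simp only [integral_const_mul]
      ring
    rw [← h1]
    exact integral_nonneg fun _ => sq_nonneg _
  have := discrim_le_zero h
  rw [discrim] at this
  nlinarith

/-- The Fourier transform of the unit cell, a product of cardinal sines. -/
noncomputable def cellFT (θ : 𝔼 d) : ℂ := ∫ x in cell d, chi θ x

lemma norm_cellFT_le (θ : 𝔼 d) : ‖cellFT θ‖ ≤ 1 := by
  refine (norm_integral_le_integral_norm _).trans_eq ?_
  simp [norm_chi]

/-- Each factor `∫_{-1/2}^{1/2} cos (θ t) dt` is at least `1 - θ² / 24 ≥ 1 - π² / 24 > 1 / 2`. -/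
lemma le_norm_cellFT {θ : 𝔼 d} (hθ : θ ∈ freqCube d) : (1 / 2) ^ d ≤ ‖cellFT θ‖ := by
  have h1 : cellFT θ = ∏ k, ∫ t in Set.Ico (-(1 / 2) : ℝ) (1 / 2),
      Complex.exp (Complex.I * ((θ k * t : ℝ) : ℂ)) := by
    simp_rw [cellFT, chi_eq_prod]
    exact setIntegral_prod_coord measurableSet_Ico fun k t => Complex.exp (Complex.I * ((θ k * t : ℝ) : ℂ))
  rw [h1, norm_prod]
  have h2 : ∀ k : Fin d, (1 / 2 : ℝ) ≤ ‖∫ t in Set.Ico (-(1 / 2) : ℝ) (1 / 2),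
      Complex.exp (Complex.I * ((θ k * t : ℝ) : ℂ))‖ := by
    intro k
    refine le_trans ?_ (Complex.re_le_norm _)
    rw [integral_Ico_eq_integral_Ioc, ← intervalIntegral.integral_of_le (by norm_num)]
    have hre : (∫ t in (-(1 / 2) : ℝ)..(1 / 2), Complex.exp (Complex.I * ((θ k * t : ℝ) : ℂ))).re
        = ∫ t in (-(1 / 2) : ℝ)..(1 / 2), Real.cos (θ k * t) := by
      have := intervalIntegral.intervalIntegral_re (μ := volume) (a := -(1 / 2)) (b := 1 / 2) (f := fun t : ℝ =>
        Complex.exp (Complex.I * ((θ k * t : ℝ) : ℂ)))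
        ((by fun_prop : Continuous _).intervalIntegrable _ _)
      rw [← RCLike.re_eq_complex_re, ← this]
      refine intervalIntegral.integral_congr fun t _ => ?_
      simp only [RCLike.re_eq_complex_re]
      rw [mul_comm, Complex.exp_ofReal_mul_I_re]
    rw [hre]
    have hlow : ∫ t in (-(1 / 2) : ℝ)..(1 / 2), (1 - θ k ^ 2 / 2 * t ^ 2)
        ≤ ∫ t in (-(1 / 2) : ℝ)..(1 / 2), Real.cos (θ k * t) := by
      refine intervalIntegral.integral_mono_on (by norm_num)
        ((by fun_prop : Continuous _).intervalIntegrable _ _)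
        ((by fun_prop : Continuous _).intervalIntegrable _ _) fun t _ => ?_
      have := Real.one_sub_sq_div_two_le_cos (x := θ k * t)
      refine le_trans (le_of_eq ?_) this
      ring
    refine le_trans ?_ hlow
    rw [intervalIntegral.integral_sub ((by fun_prop : Continuous _).intervalIntegrable _ _)
      ((by fun_prop : Continuous _).intervalIntegrable _ _),
      intervalIntegral.integral_const_mul, integral_pow]
    have h3 : θ k ^ 2 ≤ Real.pi ^ 2 := sq_le_sq' (hθ k).1 (hθ k).2
    have h4 := Real.pi_lt_d2
    have h5 := Real.pi_pos
    norm_num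
    nlinarith
  calc (1 / 2 : ℝ) ^ d = ∏ _k : Fin d, (1 / 2 : ℝ) := by simp
    _ ≤ _ := Finset.prod_le_prod (fun _ _ => by norm_num) fun k _ => h2 k

/-- The exponential sum over the lattice points of the ball centred at `-x`, written as a sum over
an index set independent of `x ∈ cell d`. -/
noncomputable def shiftedSum (L : ℝ) (x θ : 𝔼 d) : ℂ :=
  ∑ j ∈ ballPoints (0 : 𝔼 d) (L + √d), if ‖latticePoint j + x‖ ≤ L then chi θ (latticePoint j) else 0

lemma shiftedSum_eq {L : ℝ} {x : 𝔼 d} (hx : ‖x‖ ≤ √d) (θ : 𝔼 d) :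
    shiftedSum L x θ = latticeSum (ballPoints x L) θ := by
  rw [shiftedSum, ← Finset.sum_filter, latticeSum]
  refine Finset.sum_congr ?_ fun _ _ => rfl
  ext j
  rw [Finset.mem_filter, mem_ballPoints, mem_ballPoints, and_iff_right_iff_imp, add_zero]
  intro h
  have := norm_sub_le (latticePoint j + x) x
  rw [add_sub_cancel_right] at this
  linarith

lemma measurable_shiftedSum (L : ℝ) :
    Measurable fun p : (𝔼 d) × (𝔼 d) => shiftedSum L p.1 p.2 := by
  unfold shiftedSum
  refine Finset.measurable_sum _ fun j _ => Measurable.ite (measurableSet_le ?_ ?_) ?_ ?_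
  · fun_prop
  · fun_prop
  · exact (by fun_prop : Continuous fun p : (𝔼 d) × (𝔼 d) => chi p.2 (latticePoint j)).measurable
  · fun_prop

lemma norm_shiftedSum_le (L : ℝ) (x θ : 𝔼 d) :
    ‖shiftedSum L x θ‖ ≤ (ballPoints (0 : 𝔼 d) (L + √d)).card := by
  refine (norm_sum_le _ _).trans ?_
  rw [Finset.card_eq_sum_ones, Nat.cast_sum]
  refine Finset.sum_le_sum fun j _ => ?_
  split_ifs
  · rw [norm_chi]; simp
  · simp

/-- The integral of a continuous function over the ball is the integral over the unit cell of its
sums over shifted lattices. -/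
lemma setIntegral_closedBall_eq_integral_cell {L : ℝ} {g : 𝔼 d → ℂ} (hg : Continuous g) :
    ∫ y in Metric.closedBall (0 : 𝔼 d) L, g y
      = ∫ x in cell d, ∑ j ∈ ballPoints (0 : 𝔼 d) (L + √d),
          if ‖latticePoint j + x‖ ≤ L then g (latticePoint j + x) else 0 := by
  have hgi : IntegrableOn g (Metric.closedBall (0 : 𝔼 d) L) :=
    integrable_of_continuous_of_isBounded hg Metric.isBounded_closedBall
  have hint := hgi.integrable_indicator Metric.isClosed_closedBall.measurableSet
  have h := hasSum_integral_cell hint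
  rw [integral_indicator Metric.isClosed_closedBall.measurableSet] at h
  have hterm : ∀ (j : Fin d → ℤ) (x : 𝔼 d), (Metric.closedBall (0 : 𝔼 d) L).indicator g (x + latticePoint j)
      = if ‖latticePoint j + x‖ ≤ L then g (latticePoint j + x) else 0 := fun j x => by
    classical
    rw [add_comm x, Set.indicator_apply]; simp only [mem_closedBall_zero_iff]
  simp_rw [hterm] at h
  have hzero : ∀ j ∉ ballPoints (0 : 𝔼 d) (L + √d), ∫ x in cell d,
      (if ‖latticePoint j + x‖ ≤ L then g (latticePoint j + x) else 0) = 0 := by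
    intro j hj
    rw [mem_ballPoints, add_zero, not_le] at hj
    rw [setIntegral_congr_fun (g := fun _ => (0 : ℂ)) measurableSet_cell, integral_zero]
    intro x hx
    refine if_neg fun h => ?_
    have h1 := norm_sub_le (latticePoint j + x) x
    rw [add_sub_cancel_right] at h1
    linarith [norm_le_of_mem_cell hx]
  rw [h.unique (hasSum_sum_of_ne_finset_zero hzero), integral_finsetSum]
  intro j _
  simp_rw [← hterm]
  exact (hint.comp_add_right (latticePoint j)).integrableOn

lemma ballFT_eq_integral_cell (L : ℝ) (θ : 𝔼 d) :
    ballFT L θ = ∫ x in cell d, chi θ x * shiftedSum L x θ := by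
  rw [ballFT, setIntegral_closedBall_eq_integral_cell (by fun_prop)]
  congr 1
  ext x
  rw [shiftedSum, Finset.mul_sum]
  refine Finset.sum_congr rfl fun j _ => ?_
  split_ifs
  · rw [chi_add, mul_comm]
  · rw [mul_zero]

lemma norm_latticeSum_le (B : Finset (Fin d → ℤ)) (θ : 𝔼 d) : ‖latticeSum B θ‖ ≤ B.card := by
  refine (norm_sum_le _ _).trans ?_
  simp [norm_chi]

lemma ballFT_sub_eq (L : ℝ) (θ : 𝔼 d) :
    ballFT L θ - cellFT θ * latticeSum (ballPoints 0 L) θ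
      = ∫ x in cell d, chi θ x * (shiftedSum L x θ - latticeSum (ballPoints 0 L) θ) := by
  have hch : AEStronglyMeasurable (fun x => chi θ x) (volume.restrict (cell d)) :=
    (by fun_prop : Continuous fun x => chi θ x).aestronglyMeasurable
  rw [ballFT_eq_integral_cell, cellFT, ← integral_mul_const, ← integral_sub]
  · simp_rw [mul_sub]
  · refine Integrable.of_bound (hch.mul ((measurable_shiftedSum L).comp
      (by fun_prop : Measurable fun x => (x, θ))).aestronglyMeasurable)
      (ballPoints (0 : 𝔼 d) (L + √d)).card (ae_of_all _ fun x => ?_)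
    rw [norm_mul, norm_chi, one_mul]; exact norm_shiftedSum_le L x θ
  · refine Integrable.of_bound (hch.mul aestronglyMeasurable_const)
      (ballPoints (0 : 𝔼 d) L).card (ae_of_all _ fun x => ?_)
    rw [norm_mul, norm_chi, one_mul]; exact norm_latticeSum_le _ θ

lemma norm_sq_integral_cell_le {G : 𝔼 d → ℂ} (hG : Measurable G) {N : ℝ} (hN : ∀ x, ‖G x‖ ≤ N)
    (θ : 𝔼 d) : ‖∫ x in cell d, chi θ x * G x‖ ^ 2 ≤ ∫ x in cell d, ‖G x‖ ^ 2 := by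
  have hb1 : Integrable (fun x => ‖G x‖ ^ 2) (volume.restrict (cell d)) :=
    Integrable.of_bound (hG.norm.pow_const 2).aestronglyMeasurable (N ^ 2)
      (ae_of_all _ fun x => by
        rw [norm_pow, norm_norm]; exact pow_le_pow_left₀ (norm_nonneg _) (hN x) 2)
  have hb2 : Integrable (fun x => ‖G x‖ * 1) (volume.restrict (cell d)) :=
    Integrable.of_bound (hG.norm.mul_const 1).aestronglyMeasurable N
      (ae_of_all _ fun x => by simpa using hN x)
  have h2 := sq_integral_mul_le hb1 (g := fun _ => 1) (integrable_const _) hb2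
  simp only [one_pow, integral_const, measureReal_restrict_apply_univ, volume_real_cell,
    smul_eq_mul, mul_one] at h2
  refine le_trans (pow_le_pow_left₀ (norm_nonneg _) (norm_integral_le_integral_norm _) 2) ?_
  simp_rw [norm_mul, norm_chi, one_mul]
  exact h2

lemma integral_norm_sq_ballFT_sub_le (L : ℝ) :
    ∫ θ in freqCube d, ‖ballFT L θ - cellFT θ * latticeSum (ballPoints 0 L) θ‖ ^ 2
      ≤ (2 * Real.pi) ^ d * (shellPoints d L (√d)).card := by
  obtain ⟨G, hG⟩ : ∃ G : 𝔼 d → 𝔼 d → ℂ, ∀ x θ,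
    G x θ = shiftedSum L x θ - latticeSum (ballPoints 0 L) θ := ⟨_, fun _ _ => rfl⟩
  obtain ⟨N, hGn⟩ : ∃ N : ℝ, ∀ x θ, ‖G x θ‖ ≤ N :=
    ⟨(ballPoints (0 : 𝔼 d) (L + √d)).card + (ballPoints (0 : 𝔼 d) L).card, fun x θ => by
      rw [hG]
      exact (norm_sub_le _ _).trans (add_le_add (norm_shiftedSum_le L x θ) (norm_latticeSum_le _ θ))⟩
  have hGm : Measurable fun p : (𝔼 d) × (𝔼 d) => G p.1 p.2 := by
    simp_rw [hG]
    exact (measurable_shiftedSum L).sub ((continuous_latticeSum _).measurable.comp measurable_snd)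
  have hpt : ∀ θ, ‖ballFT L θ - cellFT θ * latticeSum (ballPoints 0 L) θ‖ ^ 2
      ≤ ∫ x in cell d, ‖G x θ‖ ^ 2 := fun θ => by
    rw [ballFT_sub_eq]
    simp_rw [← hG]
    exact norm_sq_integral_cell_le (hGm.comp (by fun_prop : Measurable fun x => (x, θ)))
      (fun x => hGn x θ) θ
  have hprod : Integrable (fun p : (𝔼 d) × (𝔼 d) => ‖G p.2 p.1‖ ^ 2)
      ((volume.restrict (freqCube d)).prod (volume.restrict (cell d))) :=
    Integrable.of_bound ((hGm.comp measurable_swap).norm.pow_const 2).aestronglyMeasurable (N ^ 2)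
      (ae_of_all _ fun p => by
        rw [norm_pow, norm_norm]; exact pow_le_pow_left₀ (norm_nonneg _) (hGn _ _) 2)
  calc ∫ θ in freqCube d, ‖ballFT L θ - cellFT θ * latticeSum (ballPoints 0 L) θ‖ ^ 2
      ≤ ∫ θ in freqCube d, ∫ x in cell d, ‖G x θ‖ ^ 2 :=
        integral_mono_of_nonneg (ae_of_all _ fun θ => by positivity) hprod.integral_prod_left
          (ae_of_all _ hpt)
    _ = ∫ x in cell d, ∫ θ in freqCube d, ‖G x θ‖ ^ 2 := integral_integral_swap hprod
    _ ≤ ∫ x in cell d, (2 * Real.pi) ^ d * ((shellPoints d L (√d)).card : ℝ) := by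
        refine setIntegral_mono_on hprod.integral_prod_right (integrable_const _) measurableSet_cell
          fun x hx => ?_
        have hx' := norm_le_of_mem_cell hx
        simp_rw [hG, shiftedSum_eq hx']
        rw [integral_norm_sq_latticeSum_sub]
        have hpi := Real.pi_pos
        refine mul_le_mul_of_nonneg_left ?_ (by positivity)
        exact_mod_cast Finset.card_le_card
          ((symmDiff_ballPoints_subset x L).trans (shellPoints_mono hx'))
    _ = _ := by simp

/-- The error in replacing the exponential sum by the Fourier transform of the ball has `L²` norm
`O(L^{(d-1)/2})`. -/
lemma exists_ballFT_sub_bound (n : ℕ) : ∃ C : ℝ, 0 < C ∧ ∀ L ≥ 2 * √(n + 1 : ℕ),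
    ∫ θ in freqCube (n + 1),
      ‖ballFT L θ - cellFT θ * latticeSum (ballPoints 0 L) θ‖ ^ 2 ≤ C * L ^ n := by
  obtain ⟨C, hC, hcard⟩ := card_shellPoints_le n (Real.sqrt_nonneg (n + 1 : ℕ))
  have hpi : 0 < (2 * Real.pi) ^ (n + 1) := by have := Real.pi_pos; positivity
  refine ⟨(2 * Real.pi) ^ (n + 1) * C, mul_pos hpi hC, fun L hL => ?_⟩
  refine (integral_norm_sq_ballFT_sub_le L).trans ?_
  rw [mul_assoc]
  exact mul_le_mul_of_nonneg_left (hcard L (by linarith)) hpi.le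

/-- A bounded nonnegative measurable function: the spectral densities to which the estimates below
apply. -/
structure IsWeight (f : 𝔼 d → ℝ) (M : ℝ) : Prop where
  measurable : Measurable f
  nonneg : ∀ θ, 0 ≤ f θ
  le : ∀ θ, f θ ≤ M

lemma IsWeight.bound_nonneg {f : 𝔼 d → ℝ} {M : ℝ} (hf : IsWeight f M) : 0 ≤ M :=
  (hf.nonneg 0).trans (hf.le 0)

lemma IsWeight.integrableOn_mul {f : 𝔼 d → ℝ} {M : ℝ} (hf : IsWeight f M) {F : Type*}
    [NormedAddCommGroup F] [NormedSpace ℝ F] {s : Set (𝔼 d)} {g : 𝔼 d → F} (hg : IntegrableOn g s) :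
    IntegrableOn (fun θ => f θ • g θ) s :=
  hg.bdd_smul M hf.measurable.aestronglyMeasurable (ae_of_all _ fun θ => by
    rw [Real.norm_eq_abs, abs_of_nonneg (hf.nonneg θ)]; exact hf.le θ)

lemma IsWeight.integrableOn {f : 𝔼 d → ℝ} {M : ℝ} (hf : IsWeight f M) {s : Set (𝔼 d)}
    (hs : Bornology.IsBounded s) : IntegrableOn f s := by
  have := hf.integrableOn_mul (integrable_of_continuous_of_isBounded
    (continuous_const (y := (1 : ℝ))) hs)
  simpa using this

lemma continuous_cellFT : Continuous (cellFT : 𝔼 d → ℂ) := by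
  refine continuous_of_dominated (bound := fun _ => 1)
    (fun θ => (by fun_prop : Continuous fun x => chi θ x).aestronglyMeasurable)
    (fun θ => ae_of_all _ fun x => (norm_chi _ _).le) (integrable_const _)
    (ae_of_all _ fun x => by fun_prop)

/-- Up to an error `O(L^{d-1})`, the weighted mean square of the exponential sum over the lattice
ball is comparable to that of the Fourier transform of the ball. -/
lemma exists_comparison (n : ℕ) : ∃ C : ℝ, 0 < C ∧ ∀ (f : 𝔼 (n + 1) → ℝ) (M : ℝ), IsWeight f M →
    ∀ L ≥ 2 * √(n + 1 : ℕ),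
    (∫ θ in freqCube (n + 1), f θ * ‖latticeSum (ballPoints 0 L) θ‖ ^ 2
      ≤ C * (∫ θ in freqCube (n + 1), f θ * ballFTReal n L ‖θ‖ ^ 2) + C * M * L ^ n) ∧
    (∫ θ in freqCube (n + 1), f θ * ballFTReal n L ‖θ‖ ^ 2
      ≤ 2 * (∫ θ in freqCube (n + 1), f θ * ‖latticeSum (ballPoints 0 L) θ‖ ^ 2)
        + C * M * L ^ n) := by
  obtain ⟨C, hC, herr⟩ := exists_ballFT_sub_bound n
  refine ⟨2 * 4 ^ (n + 1) * (1 + C), by positivity, fun f M hf L hL => ?_⟩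
  have hL0 : 0 < L := lt_of_lt_of_le (by positivity) hL
  have hM := hf.bound_nonneg
  set e : 𝔼 (n + 1) → ℂ := fun θ =>
    (ballFTReal n L ‖θ‖ : ℂ) - cellFT θ * latticeSum (ballPoints 0 L) θ with he
  have he_eq : ∀ θ, ballFT L θ - cellFT θ * latticeSum (ballPoints 0 L) θ = e θ := fun θ => by
    rw [ballFT_eq_real hL0]
  have hbc : Continuous fun θ : 𝔼 (n + 1) => ballFTReal n L ‖θ‖ :=
    (continuous_ballFTReal L).comp continuous_norm
  have hcell := continuous_cellFT (d := n + 1)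
  have hec : Continuous e := by fun_prop
  have hE := herr L hL
  simp_rw [he_eq] at hE
  have hint : ∀ {g : 𝔼 (n + 1) → ℝ}, Continuous g →
      IntegrableOn (fun θ => f θ * g θ) (freqCube (n + 1)) := fun hg =>
    hf.integrableOn_mul (integrable_of_continuous_of_isBounded hg isBounded_freqCube)
  have hiD := hint (g := fun θ => ‖latticeSum (ballPoints 0 L) θ‖ ^ 2) (by fun_prop)
  have hib := hint (g := fun θ => ballFTReal n L ‖θ‖ ^ 2) (by fun_prop)
  have hie := hint (g := fun θ => ‖e θ‖ ^ 2) (by fun_prop)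
  have hfe : ∫ θ in freqCube (n + 1), f θ * ‖e θ‖ ^ 2 ≤ C * M * L ^ n := by
    calc ∫ θ in freqCube (n + 1), f θ * ‖e θ‖ ^ 2 ≤ ∫ θ in freqCube (n + 1), M * ‖e θ‖ ^ 2 := by
          refine integral_mono hie ((integrable_of_continuous_of_isBounded
            (by fun_prop : Continuous fun θ => ‖e θ‖ ^ 2) isBounded_freqCube).const_mul M)
            fun θ => ?_
          exact mul_le_mul_of_nonneg_right (hf.le θ) (by positivity)
      _ = M * ∫ θ in freqCube (n + 1), ‖e θ‖ ^ 2 := integral_const_mul _ _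
      _ ≤ M * (C * L ^ n) := mul_le_mul_of_nonneg_left hE hM
      _ = _ := by ring
  have h4 : (1 : ℝ) ≤ 4 ^ (n + 1) := one_le_pow₀ (by norm_num)
  have hLn : 0 < L ^ n := by positivity
  have hib0 : 0 ≤ ∫ θ in freqCube (n + 1), f θ * ballFTReal n L ‖θ‖ ^ 2 :=
    integral_nonneg fun θ => mul_nonneg (hf.nonneg θ) (by positivity)
  constructor
  · have h1 : ∫ θ in freqCube (n + 1), f θ * ‖latticeSum (ballPoints 0 L) θ‖ ^ 2
        ≤ ∫ θ in freqCube (n + 1), (2 * 4 ^ (n + 1) * (f θ * ballFTReal n L ‖θ‖ ^ 2)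
          + 2 * 4 ^ (n + 1) * (f θ * ‖e θ‖ ^ 2)) := by
      refine setIntegral_mono_on hiD ((hib.const_mul _).add (hie.const_mul _))
        measurableSet_freqCube fun θ hθ => ?_
      have h2 : ‖cellFT θ * latticeSum (ballPoints 0 L) θ‖ ≤ |ballFTReal n L ‖θ‖| + ‖e θ‖ := by
        have : cellFT θ * latticeSum (ballPoints 0 L) θ = (ballFTReal n L ‖θ‖ : ℂ) - e θ := by
          simp [he]
        rw [this]
        refine (norm_sub_le _ _).trans_eq ?_
        rw [Complex.norm_real, Real.norm_eq_abs]
      rw [norm_mul] at h2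
      have h3 := le_norm_cellFT hθ
      have h5 : (1 / 2) ^ (n + 1) * ‖latticeSum (ballPoints 0 L) θ‖
          ≤ |ballFTReal n L ‖θ‖| + ‖e θ‖ :=
        (mul_le_mul_of_nonneg_right h3 (norm_nonneg _)).trans h2
      have h6 := pow_le_pow_left₀ (by positivity) h5 2
      have h7 : ((1 / 2 : ℝ) ^ (n + 1) * ‖latticeSum (ballPoints 0 L) θ‖) ^ 2 * 4 ^ (n + 1)
          = ‖latticeSum (ballPoints 0 L) θ‖ ^ 2 := by
        rw [mul_pow, ← pow_mul, mul_comm (n + 1) 2, pow_mul, mul_right_comm, ← mul_pow]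
        norm_num
      have h8 : (|ballFTReal n L ‖θ‖| + ‖e θ‖) ^ 2
          ≤ 2 * ballFTReal n L ‖θ‖ ^ 2 + 2 * ‖e θ‖ ^ 2 := by
        rw [← sq_abs (ballFTReal n L ‖θ‖)]
        nlinarith [sq_nonneg (|ballFTReal n L ‖θ‖| - ‖e θ‖)]
      have h9 : ‖latticeSum (ballPoints 0 L) θ‖ ^ 2
          ≤ (2 * ballFTReal n L ‖θ‖ ^ 2 + 2 * ‖e θ‖ ^ 2) * 4 ^ (n + 1) := by
        rw [← h7]
        exact mul_le_mul_of_nonneg_right (h6.trans h8) (by positivity)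
      calc f θ * ‖latticeSum (ballPoints 0 L) θ‖ ^ 2
          ≤ f θ * ((2 * ballFTReal n L ‖θ‖ ^ 2 + 2 * ‖e θ‖ ^ 2) * 4 ^ (n + 1)) :=
            mul_le_mul_of_nonneg_left h9 (hf.nonneg θ)
        _ = _ := by ring
    rw [integral_add (hib.const_mul _) (hie.const_mul _), integral_const_mul,
      integral_const_mul] at h1
    refine h1.trans ?_
    have h10 : 0 ≤ C * M * L ^ n := by positivity
    have h11 : 2 * 4 ^ (n + 1) * (∫ θ in freqCube (n + 1), f θ * ‖e θ‖ ^ 2)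
        ≤ 2 * 4 ^ (n + 1) * (C * M * L ^ n) := mul_le_mul_of_nonneg_left hfe (by positivity)
    have h12 : 0 ≤ 2 * 4 ^ (n + 1) * C * (∫ θ in freqCube (n + 1), f θ * ballFTReal n L ‖θ‖ ^ 2) := by
      positivity
    have h13 : 0 ≤ 2 * 4 ^ (n + 1) * (M * L ^ n) := by positivity
    nlinarith
  · have h1 : ∫ θ in freqCube (n + 1), f θ * ballFTReal n L ‖θ‖ ^ 2
        ≤ ∫ θ in freqCube (n + 1), (2 * (f θ * ‖latticeSum (ballPoints 0 L) θ‖ ^ 2)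
          + 2 * (f θ * ‖e θ‖ ^ 2)) := by
      refine integral_mono hib ((hiD.const_mul _).add (hie.const_mul _)) fun θ => ?_
      have h2 : |ballFTReal n L ‖θ‖| ≤ ‖latticeSum (ballPoints 0 L) θ‖ + ‖e θ‖ := by
        have : (ballFTReal n L ‖θ‖ : ℂ) = cellFT θ * latticeSum (ballPoints 0 L) θ + e θ := by
          simp [he]
        rw [← Real.norm_eq_abs, ← Complex.norm_real, this]
        refine (norm_add_le _ _).trans (add_le_add_left ?_ _)
        rw [norm_mul]
        exact mul_le_of_le_one_left (norm_nonneg _) (norm_cellFT_le θ)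
      have h3 := pow_le_pow_left₀ (abs_nonneg _) h2 2
      rw [sq_abs] at h3
      have h4 : ballFTReal n L ‖θ‖ ^ 2 ≤ 2 * ‖latticeSum (ballPoints 0 L) θ‖ ^ 2 + 2 * ‖e θ‖ ^ 2 := by
        nlinarith [sq_nonneg (‖latticeSum (ballPoints 0 L) θ‖ - ‖e θ‖)]
      calc f θ * ballFTReal n L ‖θ‖ ^ 2
          ≤ f θ * (2 * ‖latticeSum (ballPoints 0 L) θ‖ ^ 2 + 2 * ‖e θ‖ ^ 2) :=
            mul_le_mul_of_nonneg_left h4 (hf.nonneg θ)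
        _ = _ := by ring
    rw [integral_add (hiD.const_mul _) (hie.const_mul _), integral_const_mul,
      integral_const_mul] at h1
    have h10 : 0 ≤ C * M * L ^ n := by positivity
    have h11 : 0 ≤ M * L ^ n := by positivity
    have h12 : 2 * (C * M * L ^ n) ≤ 2 * 4 ^ (n + 1) * (1 + C) * M * L ^ n := by
      calc 2 * (C * M * L ^ n) ≤ 2 * 4 ^ (n + 1) * (C * M * L ^ n) := by
            exact mul_le_mul_of_nonneg_right (by linarith) h10
        _ ≤ 2 * 4 ^ (n + 1) * (C * M * L ^ n) + 2 * 4 ^ (n + 1) * (M * L ^ n) :=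
            le_add_of_nonneg_right (by positivity)
        _ = _ := by ring
    linarith

/-! ### The upper bound -/

lemma measurableSet_norm_le (a : ℝ) : MeasurableSet {ξ : 𝔼 d | ‖ξ‖ ≤ a} :=
  measurableSet_le (by fun_prop) (by fun_prop)

lemma measurableSet_lt_norm (a : ℝ) : MeasurableSet {ξ : 𝔼 d | a < ‖ξ‖} :=
  measurableSet_lt (by fun_prop) (by fun_prop)

lemma setIntegral_split {F : 𝔼 d → ℝ} {s : Set (𝔼 d)} (hF : IntegrableOn F s) (a : ℝ) :
    ∫ ξ in s, F ξ = (∫ ξ in s ∩ {ξ | ‖ξ‖ ≤ a}, F ξ) + ∫ ξ in s ∩ {ξ | a < ‖ξ‖}, F ξ := by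
  have h : s ∩ {ξ | a < ‖ξ‖} = s \ {ξ | ‖ξ‖ ≤ a} := by
    ext ξ; simp
  rw [h, integral_inter_add_sdiff (measurableSet_norm_le a) hF]

/-- `f(ξ) / ‖ξ‖^m` is integrable away from the origin. -/
lemma IsWeight.integrableOn_div {f : 𝔼 d → ℝ} {M : ℝ} (hf : IsWeight f M) {s : Set (𝔼 d)}
    (hs : Bornology.IsBounded s) (hsm : MeasurableSet s) {a : ℝ} (ha : 0 < a) (m : ℕ) :
    IntegrableOn (fun ξ => f ξ / ‖ξ‖ ^ m) (s ∩ {ξ | a < ‖ξ‖}) := by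
  have hm : MeasurableSet (s ∩ {ξ : 𝔼 d | a < ‖ξ‖}) := hsm.inter (measurableSet_lt_norm a)
  have hfin : volume (s ∩ {ξ : 𝔼 d | a < ‖ξ‖}) ≠ ⊤ :=
    (hs.subset Set.inter_subset_left).measure_lt_top.ne
  refine Measure.integrableOn_of_bounded (M := M / a ^ m) hfin
    (hf.measurable.div (by fun_prop)).aestronglyMeasurable ?_
  filter_upwards [ae_restrict_mem hm] with ξ hξ
  have h2 : a < ‖ξ‖ := hξ.2
  rw [Real.norm_eq_abs, abs_of_nonneg (div_nonneg (hf.nonneg ξ) (by positivity))]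
  have := hf.bound_nonneg
  have := hf.le ξ
  gcongr

lemma ballFluctuation_succ (f : 𝔼 (n + 1) → ℝ) (c L : ℝ) :
    ballFluctuation f c L = L ^ (2 * (n + 1)) * (∫ ξ in freqCube (n + 1) ∩ {ξ | ‖ξ‖ ≤ c / L}, f ξ) +
      L ^ n * (∫ ξ in freqCube (n + 1) ∩ {ξ | c / L < ‖ξ‖}, f ξ / ‖ξ‖ ^ (n + 2)) := rfl

/-- The two pointwise bounds on the Fourier transform of a ball give the upper bound by
`ballFluctuation`. -/
lemma exists_integral_ballFTReal_sq_le (n : ℕ) : ∃ A : ℝ, 0 < A ∧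
    ∀ (f : 𝔼 (n + 1) → ℝ) (M : ℝ), IsWeight f M → ∀ c > 0, ∀ L > 0,
    ∫ θ in freqCube (n + 1), f θ * ballFTReal n L ‖θ‖ ^ 2 ≤ A * ballFluctuation f c L := by
  obtain ⟨A, hA, hb⟩ := exists_ballFTReal_bound n
  refine ⟨A, hA, fun f M hf c hc L hL => ?_⟩
  have hbc : Continuous fun θ : 𝔼 (n + 1) => ballFTReal n L ‖θ‖ ^ 2 :=
    ((continuous_ballFTReal L).comp continuous_norm).pow 2
  have hi : IntegrableOn (fun θ => f θ * ballFTReal n L ‖θ‖ ^ 2) (freqCube (n + 1)) :=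
    hf.integrableOn_mul (integrable_of_continuous_of_isBounded hbc isBounded_freqCube)
  have hm1 := measurableSet_freqCube.inter (measurableSet_norm_le (d := n + 1) (c / L))
  have hm2 := measurableSet_freqCube.inter (measurableSet_lt_norm (d := n + 1) (c / L))
  have hcL : 0 < c / L := by positivity
  rw [setIntegral_split hi (c / L), ballFluctuation_succ, mul_add, ← mul_assoc, ← mul_assoc,
    ← integral_const_mul, ← integral_const_mul]
  refine add_le_add (setIntegral_mono_on (hi.mono_set Set.inter_subset_left)
    ((hf.integrableOn (isBounded_freqCube.subset Set.inter_subset_left)).const_mul _) hm1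
    fun θ _ => ?_) (setIntegral_mono_on (hi.mono_set Set.inter_subset_left)
    ((hf.integrableOn_div isBounded_freqCube measurableSet_freqCube hcL _).const_mul _) hm2
    fun θ hθ => ?_)
  · rw [mul_comm]
    exact mul_le_mul_of_nonneg_right ((hb L hL).1 _) (hf.nonneg θ)
  · have h := (hb L hL).2 ‖θ‖ (hcL.trans hθ.2)
    calc f θ * ballFTReal n L ‖θ‖ ^ 2 ≤ f θ * (A * (L ^ n / ‖θ‖ ^ (n + 2))) :=
          mul_le_mul_of_nonneg_left h (hf.nonneg θ)
      _ = _ := by ring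

/-- `ballFluctuation` grows at least like the surface area of the ball. -/
lemma exists_le_ballFluctuation {f : 𝔼 (n + 1) → ℝ} {M : ℝ} (hf : IsWeight f M)
    (hpos : 0 < ∫ θ in freqCube (n + 1), f θ) {c : ℝ} (hc : 0 < c) :
    ∃ a L₀ : ℝ, 0 < a ∧ 0 < L₀ ∧ ∀ L > L₀, a * L ^ n ≤ ballFluctuation f c L := by
  set I := ∫ θ in freqCube (n + 1), f θ with hI
  have hV := unitBallVolume_pos (n + 1)
  have hM := hf.bound_nonneg
  set R : ℝ := √(n + 1 : ℕ) * Real.pi + 1 with hR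
  have hR0 : 0 < R := by have := Real.pi_pos; positivity
  have hnorm : ∀ ξ ∈ freqCube (n + 1), ‖ξ‖ ≤ R := fun ξ hξ =>
    (norm_le_of_coord_le Real.pi_pos.le fun k => abs_le.2 (hξ k)).trans (by rw [hR]; linarith)
  refine ⟨I / 2 / R ^ (n + 2), max c (2 * M * unitBallVolume (n + 1) * c / I), by positivity,
    lt_max_of_lt_left hc, fun L hL => ?_⟩
  have hLc : c < L := (le_max_left _ _).trans_lt hL
  have hL0 : 0 < L := hc.trans hLc
  have hL2 : 2 * M * unitBallVolume (n + 1) * c / I < L := (le_max_right _ _).trans_lt hL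
  have hcL : 0 < c / L := by positivity
  have hcL1 : c / L ≤ 1 := (div_le_one hL0).2 hLc.le
  have hi := hf.integrableOn (isBounded_freqCube (d := n + 1))
  have hsplit := setIntegral_split hi (c / L)
  rw [← hI] at hsplit
  -- For large `L` at least half of the mass of `f` lies outside the ball of radius `c / L`.
  have h1 : ∫ ξ in freqCube (n + 1) ∩ {ξ | ‖ξ‖ ≤ c / L}, f ξ ≤ I / 2 := by
    have hsub : freqCube (n + 1) ∩ {ξ | ‖ξ‖ ≤ c / L} ⊆ Metric.closedBall (0 : 𝔼 (n + 1)) (c / L) :=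
      fun ξ hξ => mem_closedBall_zero_iff.2 hξ.2
    calc ∫ ξ in freqCube (n + 1) ∩ {ξ | ‖ξ‖ ≤ c / L}, f ξ
        ≤ ∫ ξ in Metric.closedBall (0 : 𝔼 (n + 1)) (c / L), f ξ :=
          setIntegral_mono_set (hf.integrableOn Metric.isBounded_closedBall)
            (ae_of_all _ hf.nonneg) hsub.eventuallyLE
      _ ≤ ∫ _ξ in Metric.closedBall (0 : 𝔼 (n + 1)) (c / L), M :=
          integral_mono (hf.integrableOn Metric.isBounded_closedBall)
            (integrableOn_const measure_closedBall_lt_top.ne) hf.le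
      _ = (c / L) ^ (n + 1) * unitBallVolume (n + 1) * M := by
          rw [setIntegral_const, volume_real_closedBall hcL.le, smul_eq_mul]
      _ ≤ (c / L) * unitBallVolume (n + 1) * M := by
          gcongr
          rw [pow_succ]
          exact mul_le_of_le_one_left hcL.le (pow_le_one₀ hcL.le hcL1)
      _ ≤ I / 2 := by
          rw [div_lt_iff₀ hpos] at hL2
          rw [div_mul_eq_mul_div, div_mul_eq_mul_div, div_le_div_iff₀ hL0 two_pos]
          nlinarith
  have h2 : I / 2 ≤ ∫ ξ in freqCube (n + 1) ∩ {ξ | c / L < ‖ξ‖}, f ξ := by linarith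
  have h3 : (∫ ξ in freqCube (n + 1) ∩ {ξ | c / L < ‖ξ‖}, f ξ) / R ^ (n + 2)
      ≤ ∫ ξ in freqCube (n + 1) ∩ {ξ | c / L < ‖ξ‖}, f ξ / ‖ξ‖ ^ (n + 2) := by
    rw [← integral_div]
    refine setIntegral_mono_on ((hi.mono_set Set.inter_subset_left).div_const _)
      (hf.integrableOn_div isBounded_freqCube measurableSet_freqCube hcL _)
      (measurableSet_freqCube.inter (measurableSet_lt_norm _)) fun ξ hξ => ?_
    have h4 : 0 < ‖ξ‖ := hcL.trans hξ.2
    exact div_le_div_of_nonneg_left (hf.nonneg ξ) (by positivity)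
      (pow_le_pow_left₀ h4.le (hnorm ξ hξ.1) _)
  have h5 : 0 ≤ ∫ ξ in freqCube (n + 1) ∩ {ξ | ‖ξ‖ ≤ c / L}, f ξ :=
    integral_nonneg hf.nonneg
  rw [ballFluctuation_succ]
  have h6 : I / 2 / R ^ (n + 2) ≤ ∫ ξ in freqCube (n + 1) ∩ {ξ | c / L < ‖ξ‖}, f ξ / ‖ξ‖ ^ (n + 2) :=
    le_trans (by gcongr) h3
  have h7 := mul_le_mul_of_nonneg_left h6 (by positivity : 0 ≤ L ^ n)
  have h8 : 0 ≤ L ^ (2 * (n + 1)) * ∫ ξ in freqCube (n + 1) ∩ {ξ | ‖ξ‖ ≤ c / L}, f ξ := by positivity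
  linarith

/-! ### Polar coordinates -/

/-- Polar coordinates as an integral over the product of the unit sphere and the half-line. -/
lemma integral_polar_prod {E : Type*} [NormedAddCommGroup E] [NormedSpace ℝ E]
    {F : 𝔼 (n + 1) → E} (hF : Integrable F) :
    Integrable (fun p : Metric.sphere (0 : 𝔼 (n + 1)) 1 × Set.Ioi (0 : ℝ) =>
        F ((p.2 : ℝ) • (p.1 : 𝔼 (n + 1))))
      ((volume : Measure (𝔼 (n + 1))).toSphere.prod (Measure.volumeIoiPow n)) ∧
    ∫ x, F x = ∫ p : Metric.sphere (0 : 𝔼 (n + 1)) 1 × Set.Ioi (0 : ℝ),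
      F ((p.2 : ℝ) • (p.1 : 𝔼 (n + 1)))
      ∂((volume : Measure (𝔼 (n + 1))).toSphere.prod (Measure.volumeIoiPow n)) := by
  set σ := (volume : Measure (𝔼 (n + 1))).toSphere with hσ
  have hdim : Module.finrank ℝ (𝔼 (n + 1)) - 1 = n := by simp
  have hmp := (volume : Measure (𝔼 (n + 1))).measurePreserving_homeomorphUnitSphereProd
  rw [hdim] at hmp
  set H : Metric.sphere (0 : 𝔼 (n + 1)) 1 × Set.Ioi (0 : ℝ) → E := fun p => F ((p.2 : ℝ) • (p.1 : 𝔼 (n + 1))) with hH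
  have hHF : ∀ x : ({(0)}ᶜ : Set (𝔼 (n + 1))), H (homeomorphUnitSphereProd (𝔼 (n + 1)) x) = F x := by
    intro x
    have h1 := (homeomorphUnitSphereProd (𝔼 (n + 1))).symm_apply_apply x
    conv_rhs => rw [← h1]
    rfl
  have hemb := (homeomorphUnitSphereProd (𝔼 (n + 1))).measurableEmbedding
  have hsub : Integrable (fun x : ({(0)}ᶜ : Set (𝔼 (n + 1))) => F x) ((volume : Measure (𝔼 (n + 1))).comap (↑)) := by
    have : IntegrableOn F ({(0)}ᶜ : Set (𝔼 (n + 1))) := hF.integrableOn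
    rwa [integrableOn_iff_comap_subtypeVal (measurableSet_singleton _).compl] at this
  constructor
  · rw [← hmp.integrable_comp_emb hemb]
    exact hsub.congr (ae_of_all _ fun x => (hHF x).symm)
  · rw [← hmp.integral_comp hemb]
    refine Eq.trans ?_ (integral_congr_ae (ae_of_all _ fun x => (hHF x).symm))
    rw [integral_subtype_comap (measurableSet_singleton _).compl F, restrict_compl_singleton]

lemma measurable_toNNReal_pow : Measurable fun r : Set.Ioi (0 : ℝ) => Real.toNNReal ((r : ℝ) ^ n) :=
  (measurable_subtype_coe.pow_const _).real_toNNReal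

lemma toNNReal_pow_smul {E : Type*} [NormedAddCommGroup E] [NormedSpace ℝ E] {r : ℝ}
    (hr : r ∈ Set.Ioi (0 : ℝ)) (v : E) : Real.toNNReal (r ^ n) • v = r ^ n • v := by
  rw [NNReal.smul_def, Real.coe_toNNReal _ (pow_nonneg (le_of_lt hr) _)]

lemma integrableOn_of_integrable_volumeIoiPow {E : Type*} [NormedAddCommGroup E] [NormedSpace ℝ E]
    {m : ℝ → E} (h : Integrable (fun r : Set.Ioi (0 : ℝ) => m r) (Measure.volumeIoiPow n)) :
    IntegrableOn (fun r : ℝ => r ^ n • m r) (Set.Ioi 0) := by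
  rw [Measure.volumeIoiPow] at h
  have h3 := (integrable_withDensity_iff_integrable_smul measurable_toNNReal_pow).1 h
  have h4 : IntegrableOn (fun r : ℝ => Real.toNNReal (r ^ n) • m r) (Set.Ioi 0) := by
    rw [integrableOn_iff_comap_subtypeVal measurableSet_Ioi]
    exact h3
  exact h4.congr_fun (fun r hr => toNNReal_pow_smul hr _) measurableSet_Ioi

lemma integral_volumeIoiPow {E : Type*} [NormedAddCommGroup E] [NormedSpace ℝ E] (m : ℝ → E) :
    ∫ r : Set.Ioi (0 : ℝ), m r ∂(Measure.volumeIoiPow n) = ∫ r in Set.Ioi (0 : ℝ), r ^ n • m r := by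
  rw [Measure.volumeIoiPow]
  simp only [ENNReal.ofReal]
  rw [integral_withDensity_eq_integral_smul measurable_toNNReal_pow]
  have h5 := integral_subtype_comap (μ := (volume : Measure ℝ)) (measurableSet_Ioi (a := (0 : ℝ)))
    fun r : ℝ => Real.toNNReal (r ^ n) • m r
  exact h5.trans (setIntegral_congr_fun measurableSet_Ioi fun r hr => toNNReal_pow_smul hr _)

lemma integral_polar {F : 𝔼 (n + 1) → ℝ} (hF : Integrable F) :
    IntegrableOn (fun r : ℝ => r ^ n * ∫ ω : Metric.sphere (0 : 𝔼 (n + 1)) 1,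
      F (r • (ω : 𝔼 (n + 1))) ∂(volume : Measure (𝔼 (n + 1))).toSphere) (Set.Ioi 0) ∧
    ∫ x, F x = ∫ r in Set.Ioi (0 : ℝ), r ^ n * ∫ ω : Metric.sphere (0 : 𝔼 (n + 1)) 1,
      F (r • (ω : 𝔼 (n + 1))) ∂(volume : Measure (𝔼 (n + 1))).toSphere := by
  obtain ⟨hHi, h1⟩ := integral_polar_prod hF
  refine ⟨integrableOn_of_integrable_volumeIoiPow
    (m := fun r => ∫ ω : Metric.sphere (0 : 𝔼 (n + 1)) 1,
      F (r • (ω : 𝔼 (n + 1))) ∂(volume : Measure (𝔼 (n + 1))).toSphere) hHi.integral_prod_right, ?_⟩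
  rw [h1, integral_prod_symm _ hHi]
  exact integral_volumeIoiPow fun r => ∫ ω : Metric.sphere (0 : 𝔼 (n + 1)) 1,
      F (r • (ω : 𝔼 (n + 1))) ∂(volume : Measure (𝔼 (n + 1))).toSphere

/-- Almost every sphere about the origin meets a null set in a null set. -/
lemma ae_sphere_of_null {N : Set (𝔼 (n + 1))} (hN : MeasurableSet N) (h0 : volume N = 0) :
    ∀ᵐ r ∂(volume.restrict (Set.Ioi (0 : ℝ))),
      ∀ᵐ ω : Metric.sphere (0 : 𝔼 (n + 1)) 1 ∂(volume : Measure (𝔼 (n + 1))).toSphere, r • (ω : 𝔼 (n + 1)) ∉ N := by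
  have hi : Integrable (N.indicator fun _ => (1 : ℝ)) :=
    (integrableOn_const (by simp [h0])).integrable_indicator hN
  obtain ⟨h1, h2⟩ := integral_polar hi
  rw [integral_indicator_const _ hN, measureReal_def, h0] at h2
  simp only [ENNReal.toReal_zero, zero_smul] at h2
  have hnn : ∀ r : ℝ, 0 ≤ ∫ ω : Metric.sphere (0 : 𝔼 (n + 1)) 1,
      N.indicator (fun _ => (1 : ℝ)) (r • (ω : 𝔼 (n + 1))) ∂(volume : Measure (𝔼 (n + 1))).toSphere :=
    fun r => integral_nonneg fun ω => Set.indicator_nonneg (fun _ _ => zero_le_one) _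
  have h3 := (integral_eq_zero_iff_of_nonneg_ae (by
    filter_upwards [ae_restrict_mem measurableSet_Ioi] with r hr
    exact mul_nonneg (pow_nonneg (le_of_lt hr) n) (hnn r)) h1).1 h2.symm
  filter_upwards [h3, ae_restrict_mem measurableSet_Ioi] with r hr hr0
  have hr0' : (0 : ℝ) < r := hr0
  have h4 : ∫ ω : Metric.sphere (0 : 𝔼 (n + 1)) 1, N.indicator (fun _ => (1 : ℝ)) (r • (ω : 𝔼 (n + 1)))
      ∂(volume : Measure (𝔼 (n + 1))).toSphere = 0 := by
    rcases mul_eq_zero.1 hr with h | h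
    · exact absurd h (pow_pos hr0' n).ne'
    · exact h
  have hmeas : MeasurableSet {ω : Metric.sphere (0 : 𝔼 (n + 1)) 1 | r • (ω : 𝔼 (n + 1)) ∈ N} :=
    (by fun_prop : Measurable fun ω : Metric.sphere (0 : 𝔼 (n + 1)) 1 => r • (ω : 𝔼 (n + 1))) hN
  have h5 : ∀ ω : Metric.sphere (0 : 𝔼 (n + 1)) 1, N.indicator (fun _ => (1 : ℝ)) (r • (ω : 𝔼 (n + 1)))
      = {ω : Metric.sphere (0 : 𝔼 (n + 1)) 1 | r • (ω : 𝔼 (n + 1)) ∈ N}.indicator (fun _ => 1) ω :=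
    fun ω => rfl
  simp_rw [h5] at h4
  rw [integral_indicator_const _ hmeas, smul_eq_mul, mul_one, measureReal_eq_zero_iff] at h4
  exact measure_eq_zero_iff_ae_notMem.1 h4

/-- Polar coordinates for a radial multiple of a weight on a ball. -/
lemma IsWeight.integral_ball_polar {f : 𝔼 (n + 1) → ℝ} {M : ℝ} (hf : IsWeight f M) {φ : ℝ → ℝ}
    (hφ : Measurable φ) {B : ℝ} (hB : ∀ r, |φ r| ≤ B) {R : ℝ} :
    IntegrableOn (fun r : ℝ => r ^ n * φ r * ∫ ω : Metric.sphere (0 : 𝔼 (n + 1)) 1,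
      f (r • (ω : 𝔼 (n + 1))) ∂(volume : Measure (𝔼 (n + 1))).toSphere) (Set.Ioo 0 R) ∧
    ∫ x in Metric.ball (0 : 𝔼 (n + 1)) R, f x * φ ‖x‖
      = ∫ r in Set.Ioo 0 R, r ^ n * φ r * ∫ ω : Metric.sphere (0 : 𝔼 (n + 1)) 1,
        f (r • (ω : 𝔼 (n + 1))) ∂(volume : Measure (𝔼 (n + 1))).toSphere := by
  have hi : IntegrableOn (fun x => f x * φ ‖x‖) (Metric.ball (0 : 𝔼 (n + 1)) R) := by
    refine hf.integrableOn_mul (g := fun x => φ ‖x‖) ?_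
    refine Measure.integrableOn_of_bounded (M := B) measure_ball_lt_top.ne
      (hφ.comp measurable_norm).aestronglyMeasurable (ae_of_all _ fun x => hB _)
  obtain ⟨h1, h2⟩ := integral_polar (hi.integrable_indicator measurableSet_ball)
  have hval : ∀ r ∈ Set.Ioi (0 : ℝ), (r ^ n * ∫ ω : Metric.sphere (0 : 𝔼 (n + 1)) 1,
      (Metric.ball (0 : 𝔼 (n + 1)) R).indicator (fun x => f x * φ ‖x‖) (r • (ω : 𝔼 (n + 1)))
        ∂(volume : Measure (𝔼 (n + 1))).toSphere)
      = (Set.Iio R).indicator (fun r => r ^ n * φ r * ∫ ω : Metric.sphere (0 : 𝔼 (n + 1)) 1,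
        f (r • (ω : 𝔼 (n + 1))) ∂(volume : Measure (𝔼 (n + 1))).toSphere) r := by
    intro r hr
    have hr' : (0 : ℝ) < r := hr
    have hnorm : ∀ ω : Metric.sphere (0 : 𝔼 (n + 1)) 1, ‖r • (ω : 𝔼 (n + 1))‖ = r := fun ω => by
      rw [norm_smul, norm_eq_of_mem_sphere, mul_one, Real.norm_eq_abs, abs_of_pos hr']
    by_cases hrR : r ∈ Set.Iio R
    · rw [Set.indicator_of_mem hrR]
      have : ∀ ω : Metric.sphere (0 : 𝔼 (n + 1)) 1,
          (Metric.ball (0 : 𝔼 (n + 1)) R).indicator (fun x => f x * φ ‖x‖) (r • (ω : 𝔼 (n + 1)))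
          = f (r • (ω : 𝔼 (n + 1))) * φ r := fun ω => by
        rw [Set.indicator_of_mem (by rw [mem_ball_zero_iff, hnorm]; exact hrR), hnorm]
      simp_rw [this]
      rw [integral_mul_const]; ring
    · rw [Set.indicator_of_notMem hrR]
      have : ∀ ω : Metric.sphere (0 : 𝔼 (n + 1)) 1,
          (Metric.ball (0 : 𝔼 (n + 1)) R).indicator (fun x => f x * φ ‖x‖) (r • (ω : 𝔼 (n + 1))) = 0 :=
        fun ω => Set.indicator_of_notMem (by rw [mem_ball_zero_iff, hnorm]; exact hrR) _
      simp_rw [this]; simp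
  have hIoo : Set.Ioi (0 : ℝ) ∩ Set.Iio R = Set.Ioo 0 R := Set.Ioi_inter_Iio
  constructor
  · have h3 := h1.congr_fun hval measurableSet_Ioi
    rw [IntegrableOn, integrable_indicator_iff measurableSet_Iio, IntegrableOn,
      Measure.restrict_restrict measurableSet_Iio, Set.inter_comm, hIoo] at h3
    exact h3
  · rw [← integral_indicator measurableSet_ball, h2, setIntegral_congr_fun measurableSet_Ioi hval,
      setIntegral_indicator measurableSet_Iio, hIoo]

/-! ### Monotone weights on the half-line -/

/-- Averaging over windows: every point of `(0, T)` lies in windows whose left ends fill a set of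
measure at most `w`. -/
lemma integral_window_le {v : ℝ → ℝ} (hv : Integrable v) (hv0 : ∀ r, 0 ≤ v r) {T w : ℝ}
    (hw : 0 ≤ w) :
    ∫ r in (0 : ℝ)..(T - w), (∫ t in r..(r + w), v t) ≤ w * ∫ t in (0 : ℝ)..T, v t := by
  have hii : ∀ a b, IntervalIntegrable v volume a b := fun a b => hv.intervalIntegrable
  set Φ : ℝ → ℝ := fun s => ∫ t in (0 : ℝ)..s, v t with hΦ
  have hΦc : Continuous Φ := intervalIntegral.continuous_primitive hii 0
  have hΦm : Monotone Φ := fun a b hab => by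
    have := intervalIntegral.integral_interval_sub_left (hii 0 b) (hii 0 a)
    have h2 : 0 ≤ ∫ t in a..b, v t := intervalIntegral.integral_nonneg hab fun t _ => hv0 t
    simp only [hΦ]; linarith
  have hΦ0 : ∀ s ≥ 0, 0 ≤ Φ s := fun s hs => intervalIntegral.integral_nonneg hs fun t _ => hv0 t
  have hci : ∀ a b, IntervalIntegrable Φ volume a b := fun a b => hΦc.intervalIntegrable a b
  have h1 : ∀ r, ∫ t in r..(r + w), v t = Φ (r + w) - Φ r := fun r =>
    (intervalIntegral.integral_interval_sub_left (hii 0 (r + w)) (hii 0 r)).symm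
  simp_rw [h1]
  rw [intervalIntegral.integral_sub
      ((by fun_prop : Continuous fun r => Φ (r + w)).intervalIntegrable _ _) (hci _ _),
    intervalIntegral.integral_comp_add_right Φ w, zero_add, sub_add_cancel]
  have h2 : ∫ r in w..T, Φ r = (∫ r in (0 : ℝ)..T, Φ r) - ∫ r in (0 : ℝ)..w, Φ r :=
    (intervalIntegral.integral_interval_sub_left (hci _ _) (hci _ _)).symm
  have h3 : ∫ r in (T - w)..T, Φ r = (∫ r in (0 : ℝ)..T, Φ r) - ∫ r in (0 : ℝ)..(T - w), Φ r :=
    (intervalIntegral.integral_interval_sub_left (hci _ _) (hci _ _)).symm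
  have h4 : 0 ≤ ∫ r in (0 : ℝ)..w, Φ r := intervalIntegral.integral_nonneg hw fun r hr => hΦ0 r hr.1
  have h5 : ∫ r in (T - w)..T, Φ r ≤ ∫ _r in (T - w)..T, Φ T :=
    intervalIntegral.integral_mono_on (by linarith) (hci _ _) (by simp) fun r hr => hΦm hr.2
  rw [intervalIntegral.integral_const, sub_sub_cancel, smul_eq_mul] at h5
  have : ∫ t in (0 : ℝ)..T, v t = Φ T := rfl
  rw [this]
  linarith

section Window
variable {p G : ℝ → ℝ} {T w a : ℝ}

/-- If the integral of `p` over every window of length `w` is at least `a`, then multiplication by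
`p` does not lose mass of a nondecreasing function, except in the last window. -/
lemma integral_le_of_window_of_monotoneOn (hp : Continuous p) (hp0 : ∀ r, 0 ≤ p r)
    (hw : 0 ≤ w) (hwT : w ≤ T) (hG : MonotoneOn G (Set.Ioc 0 T)) (hG0 : ∀ r ∈ Set.Ioc 0 T, 0 ≤ G r)
    (hGi : IntegrableOn G (Set.Ioc 0 T))
    (hpG : IntegrableOn (fun r => p r * G r) (Set.Ioc 0 T))
    (hwin : ∀ r ≥ 0, a ≤ ∫ t in r..(r + w), p t) :
    a * ∫ r in (0 : ℝ)..(T - w), G r ≤ w * ∫ r in (0 : ℝ)..T, p r * G r := by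
  have hT : 0 ≤ T := hw.trans hwT
  set v : ℝ → ℝ := (Set.Ioc 0 T).indicator fun r => p r * G r with hv
  have hvi : Integrable v := hpG.integrable_indicator measurableSet_Ioc
  have hv0 : ∀ r, 0 ≤ v r := fun r => Set.indicator_nonneg (fun r hr => mul_nonneg (hp0 r) (hG0 r hr)) r
  have h1 : ∫ r in (0 : ℝ)..T, p r * G r = ∫ r in (0 : ℝ)..T, v r := by
    rw [intervalIntegral.integral_of_le hT, intervalIntegral.integral_of_le hT]
    exact setIntegral_congr_fun measurableSet_Ioc fun r hr => by
      simp only [hv]; rw [Set.indicator_of_mem hr]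
  have hGi' : IntervalIntegrable G volume 0 (T - w) := by
    rw [intervalIntegrable_iff_integrableOn_Ioc_of_le (by linarith)]
    exact hGi.mono_set (Set.Ioc_subset_Ioc_right (by linarith))
  have hΦ : Continuous fun s => ∫ t in (0 : ℝ)..s, v t :=
    intervalIntegral.continuous_primitive (fun a b => hvi.intervalIntegrable) 0
  have hwc : Continuous fun r => ∫ t in r..(r + w), v t := by
    have : (fun r => ∫ t in r..(r + w), v t)
        = fun r => (∫ t in (0 : ℝ)..(r + w), v t) - ∫ t in (0 : ℝ)..r, v t := funext fun r =>
      (intervalIntegral.integral_interval_sub_left hvi.intervalIntegrable hvi.intervalIntegrable).symm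
    rw [this]
    exact (hΦ.comp (by fun_prop)).sub hΦ
  rw [h1, ← intervalIntegral.integral_const_mul]
  refine le_trans ?_ (integral_window_le hvi hv0 hw)
  refine intervalIntegral.integral_mono_on_of_le_Ioo (by linarith) (hGi'.const_mul a)
    (hwc.intervalIntegrable _ _) fun r hr => ?_
  have hrT : r ∈ Set.Ioc 0 T := ⟨hr.1, by linarith [hr.2]⟩
  calc a * G r ≤ (∫ t in r..(r + w), p t) * G r :=
        mul_le_mul_of_nonneg_right (hwin r hr.1.le) (hG0 r hrT)
    _ = ∫ t in r..(r + w), p t * G r := (intervalIntegral.integral_mul_const _ _).symm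
    _ ≤ ∫ t in r..(r + w), v t := by
        refine intervalIntegral.integral_mono_on (by linarith)
          ((hp.intervalIntegrable _ _).mul_const _) hvi.intervalIntegrable fun t ht => ?_
        have htT : t ∈ Set.Ioc 0 T := ⟨by linarith [hr.1, ht.1], by linarith [hr.2, ht.2]⟩
        rw [hv, Set.indicator_of_mem htT]
        exact mul_le_mul_of_nonneg_left (hG hrT htT ht.1) (hp0 t)

/-- The same for a nonincreasing function, with the exception of the first window. -/
lemma integral_le_of_window_of_antitoneOn (hp : Continuous p) (hp0 : ∀ r, 0 ≤ p r)
    (hw : 0 < w) (hwT : w ≤ T) (hG : AntitoneOn G (Set.Ioc 0 T)) (hG0 : ∀ r ∈ Set.Ioc 0 T, 0 ≤ G r)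
    (hGi : IntegrableOn G (Set.Ioc w T))
    (hpG : IntegrableOn (fun r => p r * G r) (Set.Ioc 0 T))
    (hwin : ∀ r ≥ 0, a ≤ ∫ t in r..(r + w), p t) :
    a * ∫ r in w..T, G r ≤ w * ∫ r in (0 : ℝ)..T, p r * G r := by
  have hT : 0 ≤ T := hw.le.trans hwT
  set v : ℝ → ℝ := (Set.Ioc 0 T).indicator fun r => p r * G r with hv
  have hvi : Integrable v := hpG.integrable_indicator measurableSet_Ioc
  have hv0 : ∀ r, 0 ≤ v r := fun r => Set.indicator_nonneg (fun r hr => mul_nonneg (hp0 r) (hG0 r hr)) r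
  have h1 : ∫ r in (0 : ℝ)..T, p r * G r = ∫ r in (0 : ℝ)..T, v r := by
    rw [intervalIntegral.integral_of_le hT, intervalIntegral.integral_of_le hT]
    exact setIntegral_congr_fun measurableSet_Ioc fun r hr => by
      simp only [hv]; rw [Set.indicator_of_mem hr]
  have hGi' : IntervalIntegrable (fun r => G (r + w)) volume 0 (T - w) := by
    have : IntervalIntegrable G volume w T := by
      rwa [intervalIntegrable_iff_integrableOn_Ioc_of_le hwT]
    have h := this.comp_add_right w
    rwa [sub_self] at h
  have hΦ : Continuous fun s => ∫ t in (0 : ℝ)..s, v t :=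
    intervalIntegral.continuous_primitive (fun a b => hvi.intervalIntegrable) 0
  have hwc : Continuous fun r => ∫ t in r..(r + w), v t := by
    have : (fun r => ∫ t in r..(r + w), v t)
        = fun r => (∫ t in (0 : ℝ)..(r + w), v t) - ∫ t in (0 : ℝ)..r, v t := funext fun r =>
      (intervalIntegral.integral_interval_sub_left hvi.intervalIntegrable hvi.intervalIntegrable).symm
    rw [this]
    exact (hΦ.comp (by fun_prop)).sub hΦ
  have hshift : ∫ r in w..T, G r = ∫ r in (0 : ℝ)..(T - w), G (r + w) := by
    rw [intervalIntegral.integral_comp_add_right G w, zero_add, sub_add_cancel]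
  rw [h1, hshift, ← intervalIntegral.integral_const_mul]
  refine le_trans ?_ (integral_window_le hvi hv0 hw.le)
  refine intervalIntegral.integral_mono_on_of_le_Ioo (by linarith) (hGi'.const_mul a)
    (hwc.intervalIntegrable _ _) fun r hr => ?_
  have hrT : r + w ∈ Set.Ioc 0 T := ⟨by linarith [hr.1], by linarith [hr.2]⟩
  calc a * G (r + w) ≤ (∫ t in r..(r + w), p t) * G (r + w) :=
        mul_le_mul_of_nonneg_right (hwin r hr.1.le) (hG0 _ hrT)
    _ = ∫ t in r..(r + w), p t * G (r + w) := (intervalIntegral.integral_mul_const _ _).symm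
    _ ≤ ∫ t in r..(r + w), v t := by
        refine intervalIntegral.integral_mono_on (by linarith)
          ((hp.intervalIntegrable _ _).mul_const _) hvi.intervalIntegrable fun t ht => ?_
        have htT : t ∈ Set.Ioc 0 T := ⟨by linarith [hr.1, ht.1], by linarith [hr.2, ht.2]⟩
        rw [hv, Set.indicator_of_mem htT]
        exact mul_le_mul_of_nonneg_left (hG htT hrT ht.2) (hp0 t)

end Window

/-! ### Replacing the oscillating profile by its envelope -/

/-- The profile is bounded below in mean square over all windows of a fixed length. -/
lemma exists_window (n : ℕ) : ∃ ℓ a : ℝ, 0 < ℓ ∧ 0 < a ∧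
    ∀ s ≥ 0, a ≤ ∫ t in s..(s + ℓ), normalizedProfile n t ^ 2 := by
  obtain ⟨z, C, hz, hC, h⟩ := exists_normalizedProfile_asymptotic n
  set g : ℝ → ℝ := fun t => (z * Complex.exp (t * Complex.I)).re ^ 2 with hg
  have hgc : Continuous g := by fun_prop
  have hhc := continuous_normalizedProfile (n := n)
  -- a quarter period turns the squared real part into the squared imaginary part
  have hgg : ∀ t, g t + g (t + Real.pi / 2) = ‖z‖ ^ 2 := fun t => by
    have h1 : Complex.exp ((t + Real.pi / 2 : ℝ) * Complex.I) = Complex.exp (t * Complex.I) * Complex.I := by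
      push_cast
      rw [add_mul, Complex.exp_add, Complex.exp_pi_div_two_mul_I]
    have h2 : ‖z * Complex.exp (t * Complex.I)‖ = ‖z‖ := by
      rw [norm_mul, Complex.norm_exp_ofReal_mul_I, mul_one]
    simp only [hg, h1, ← mul_assoc, Complex.mul_I_re]
    rw [← h2, ← Complex.normSq_eq_norm_sq, Complex.normSq_apply]
    ring
  have hpi := Real.pi_pos
  have hgint : ∀ s, ∫ t in s..(s + Real.pi), g t = Real.pi / 2 * ‖z‖ ^ 2 := fun s => by
    have hii : ∀ a b, IntervalIntegrable g volume a b := fun a b => hgc.intervalIntegrable a b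
    have h1 : ∫ t in (s + Real.pi / 2)..(s + Real.pi), g t = ∫ t in s..(s + Real.pi / 2), g (t + Real.pi / 2) := by
      rw [intervalIntegral.integral_comp_add_right g (Real.pi / 2)]
      congr 1; ring
    rw [← intervalIntegral.integral_add_adjacent_intervals (hii s (s + Real.pi / 2)) (hii _ _), h1,
      ← intervalIntegral.integral_add (hii _ _)
        ((by fun_prop : Continuous fun t => g (t + Real.pi / 2)).intervalIntegrable _ _)]
    simp only [hgg, intervalIntegral.integral_const, smul_eq_mul, add_sub_cancel_left]
  have hz0 : 0 < ‖z‖ := norm_pos_iff.2 hz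
  -- beyond `T` the remainder `C / s` is at most a quarter of the amplitude
  set T : ℝ := max 1 (4 * C / ‖z‖) with hT
  have hT1 : 1 ≤ T := le_max_left _ _
  have hT0 : 0 < T := by linarith
  have hCT : (C / T) ^ 2 ≤ ‖z‖ ^ 2 / 16 := by
    have h1 : 4 * C / ‖z‖ ≤ T := le_max_right _ _
    rw [div_le_iff₀ hz0] at h1
    have h2 : C / T ≤ ‖z‖ / 4 := by
      rw [div_le_div_iff₀ hT0 (by norm_num)]; linarith
    calc (C / T) ^ 2 ≤ (‖z‖ / 4) ^ 2 := by gcongr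
      _ = ‖z‖ ^ 2 / 16 := by ring
  refine ⟨T + Real.pi, Real.pi / 8 * ‖z‖ ^ 2, by positivity, by positivity, fun s hs => ?_⟩
  have hii : ∀ a b, IntervalIntegrable (fun t => normalizedProfile n t ^ 2) volume a b := fun a b =>
    (hhc.pow 2).intervalIntegrable a b
  calc Real.pi / 8 * ‖z‖ ^ 2 ≤ ∫ t in (s + T)..(s + T + Real.pi), (1 / 2 * g t - ‖z‖ ^ 2 / 16) := by
        rw [intervalIntegral.integral_sub ((hgc.intervalIntegrable _ _).const_mul _) (by simp),
          intervalIntegral.integral_const_mul, hgint, intervalIntegral.integral_const, smul_eq_mul]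
        nlinarith
    _ ≤ ∫ t in (s + T)..(s + T + Real.pi), normalizedProfile n t ^ 2 := by
        refine intervalIntegral.integral_mono_on (by linarith)
          (((hgc.intervalIntegrable _ _).const_mul _).sub (by simp)) (hii _ _) fun t ht => ?_
        have htT : T ≤ t := by linarith [ht.1]
        have h1 := h t (by linarith)
        have h2 : C / t ≤ C / T := by gcongr
        have h3 : (normalizedProfile n t - (z * Complex.exp (t * Complex.I)).re) ^ 2 ≤ ‖z‖ ^ 2 / 16 := by
          rw [← sq_abs]
          exact (pow_le_pow_left₀ (abs_nonneg _) (h1.trans h2) 2).trans hCT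
        simp only [hg]
        nlinarith [sq_nonneg (2 * normalizedProfile n t - (z * Complex.exp (t * Complex.I)).re)]
    _ ≤ ∫ t in s..(s + (T + Real.pi)), normalizedProfile n t ^ 2 := by
        refine intervalIntegral.integral_mono_interval (by linarith) (by linarith) (by linarith)
          (ae_of_all _ fun t => sq_nonneg _) (hii _ _)

/-- `s^{n+2}` for `s ≤ c` and `1` for `s > c`: the envelope of `normalizedProfile n s ^ 2` which
enters the definition of `ballFluctuation`. -/
noncomputable def profileEnvelope (n : ℕ) (c s : ℝ) : ℝ := if s ≤ c then s ^ (n + 2) else 1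

lemma measurable_profileEnvelope (c : ℝ) : Measurable (profileEnvelope n c) :=
  Measurable.ite measurableSet_Iic (by fun_prop) (by fun_prop)

lemma profileEnvelope_nonneg {c s : ℝ} (hs : 0 ≤ s) : 0 ≤ profileEnvelope n c s := by
  unfold profileEnvelope; split_ifs <;> positivity

lemma profileEnvelope_le {c s : ℝ} (hc : 0 ≤ c) (hs : 0 ≤ s) :
    profileEnvelope n c s ≤ c ^ (n + 2) + 1 := by
  unfold profileEnvelope; split_ifs with h
  · have := pow_le_pow_left₀ hs h (n + 2); linarith
  · have : 0 ≤ c ^ (n + 2) := by positivity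
    linarith

lemma exists_normalizedProfile_sq_le (n : ℕ) (c : ℝ) : ∃ B : ℝ, 0 < B ∧
    ∀ s ≥ 0, normalizedProfile n s ^ 2 ≤ B * profileEnvelope n c s := by
  obtain ⟨H, hH, h⟩ := exists_normalizedProfile_bound n
  refine ⟨4 + H ^ 2, by positivity, fun s hs => ?_⟩
  unfold profileEnvelope; split_ifs with hsc
  · rw [normalizedProfile_sq hs]
    have h1 : ballProfile n s ^ 2 ≤ 4 := by
      have := pow_le_pow_left₀ (abs_nonneg _) (abs_ballProfile_le (n := n) s) 2
      rw [sq_abs] at this; linarith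
    have h2 : 0 ≤ s ^ (n + 2) := by positivity
    nlinarith [mul_nonneg (sq_nonneg H) h2]
  · have := pow_le_pow_left₀ (abs_nonneg _) (h s hs) 2
    rw [sq_abs] at this; linarith

/-- For a monotone function `G ≥ 0` the oscillating factor `normalizedProfile (L r)²` may be replaced
by its envelope. -/
lemma exists_radial_comparison (n : ℕ) {c R : ℝ} (hc : 0 < c) (hR : 0 < R) {G : ℝ → ℝ}
    (hG0 : ∀ r ∈ Set.Ioc 0 R, 0 ≤ G r)
    (hG : MonotoneOn G (Set.Ioc 0 R) ∨ AntitoneOn G (Set.Ioc 0 R)) :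
    ∃ B D L₀ : ℝ, 0 < B ∧ 0 ≤ D ∧ 0 < L₀ ∧ ∀ L > L₀,
      IntegrableOn (fun r => profileEnvelope n c (L * r) * G r) (Set.Ioc 0 R) →
      IntegrableOn (fun r => normalizedProfile n (L * r) ^ 2 * G r) (Set.Ioc 0 R) ∧
      ∫ r in (0 : ℝ)..R, profileEnvelope n c (L * r) * G r
        ≤ B * (∫ r in (0 : ℝ)..R, normalizedProfile n (L * r) ^ 2 * G r) + D := by
  obtain ⟨ℓ, a, hℓ, ha, hwin⟩ := exists_window n
  obtain ⟨s₀, b, hs₀, hb, hlow⟩ := exists_ballProfile_lower n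
  obtain ⟨B₁, hB₁, hle⟩ := exists_normalizedProfile_sq_le n c
  have hhc := continuous_normalizedProfile (n := n)
  set K : ℝ := c ^ (n + 2) + 1 with hK
  have hK0 : 0 < K := by positivity
  set s₁ : ℝ := min s₀ (min c ℓ) with hs₁
  have hs₁0 : 0 < s₁ := lt_min hs₀ (lt_min hc hℓ)
  have hs₁c : s₁ ≤ c := (min_le_right _ _).trans (min_le_left _ _)
  have hs₁ℓ : s₁ ≤ ℓ := (min_le_right _ _).trans (min_le_right _ _)
  -- near the origin the profile does not vanish and no averaging is needed
  have hsmall : ∀ s, 0 ≤ s → s ≤ s₁ → b ^ 2 * profileEnvelope n c s ≤ normalizedProfile n s ^ 2 := by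
    intro s hs hs'
    rw [normalizedProfile_sq hs, profileEnvelope, if_pos (hs'.trans hs₁c), mul_comm]
    have := hlow s hs (hs'.trans (min_le_left _ _))
    gcongr
  set q : ℝ := ∫ t in (0 : ℝ)..s₁, normalizedProfile n t ^ 2 with hq
  have hq0 : 0 < q := by
    refine intervalIntegral.intervalIntegral_pos_of_pos_on ((hhc.pow 2).intervalIntegrable _ _)
      (fun t ht => ?_) hs₁0
    refine lt_of_lt_of_le ?_ (hsmall t ht.1.le ht.2.le)
    rw [profileEnvelope, if_pos (ht.2.le.trans hs₁c)]
    have := ht.1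
    positivity
  have hGR : 0 ≤ G R := hG0 R (Set.right_mem_Ioc.2 hR)
  refine ⟨K * ℓ / a + 1 / b ^ 2 + K * ℓ / q, K * ℓ * G R, max 1 (ℓ / R), by positivity, by positivity,
    lt_max_of_lt_left one_pos, fun L hL hkG => ?_⟩
  have hL1 : 1 < L := (le_max_left _ _).trans_lt hL
  have hL0 : 0 < L := by linarith
  have hLR : ℓ / R < L := (le_max_right _ _).trans_lt hL
  have hwR : ℓ / L ≤ R := by
    rw [div_lt_iff₀ hR] at hLR
    rw [div_le_iff₀ hL0]; linarith
  set p : ℝ → ℝ := fun r => normalizedProfile n (L * r) ^ 2 with hp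
  set k : ℝ → ℝ := fun r => profileEnvelope n c (L * r) with hk
  have hpc : Continuous p := (hhc.comp (by fun_prop)).pow 2
  have hp0 : ∀ r, 0 ≤ p r := fun r => sq_nonneg _
  have hkK : ∀ r ∈ Set.Ioc 0 R, k r ≤ K := fun r hr =>
    profileEnvelope_le hc.le (mul_nonneg hL0.le hr.1.le)
  have hGm : AEStronglyMeasurable G (volume.restrict (Set.Ioc 0 R)) := by
    rcases hG with hG | hG
    · exact (aemeasurable_restrict_of_monotoneOn measurableSet_Ioc hG).aestronglyMeasurable
    · exact (aemeasurable_restrict_of_antitoneOn measurableSet_Ioc hG).aestronglyMeasurable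
  have hpG : IntegrableOn (fun r => p r * G r) (Set.Ioc 0 R) := by
    refine (hkG.const_mul B₁).mono' (hpc.aestronglyMeasurable.mul hGm) ?_
    filter_upwards [ae_restrict_mem measurableSet_Ioc] with r hr
    rw [Real.norm_eq_abs, abs_of_nonneg (mul_nonneg (hp0 r) (hG0 r hr)), ← mul_assoc]
    exact mul_le_mul_of_nonneg_right (hle _ (mul_nonneg hL0.le hr.1.le)) (hG0 r hr)
  refine ⟨hpG, ?_⟩
  have hwin' : ∀ r ≥ 0, a / L ≤ ∫ t in r..(r + ℓ / L), p t := by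
    intro r hr
    have h1 := intervalIntegral.integral_comp_mul_left (a := r) (b := r + ℓ / L)
      (fun t => normalizedProfile n t ^ 2) hL0.ne'
    have h2 : L * (r + ℓ / L) = L * r + ℓ := by field_simp
    rw [h2] at h1
    simp only [hp]
    rw [h1, smul_eq_mul, div_eq_inv_mul]
    exact mul_le_mul_of_nonneg_left (hwin _ (by positivity)) (by positivity)
  have hII : ∀ {u : ℝ → ℝ}, IntegrableOn u (Set.Ioc 0 R) → ∀ x y, 0 ≤ x → x ≤ y → y ≤ R →
      IntervalIntegrable u volume x y := fun hu x y hx hxy hy => by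
    rw [intervalIntegrable_iff_integrableOn_Ioc_of_le hxy]
    exact hu.mono_set (Set.Ioc_subset_Ioc hx hy)
  set P : ℝ := ∫ r in (0 : ℝ)..R, p r * G r with hP
  have hP0 : ∀ y, 0 ≤ y → y ≤ R → 0 ≤ ∫ r in (0 : ℝ)..y, p r * G r := fun y hy hyR => by
    rw [intervalIntegral.integral_of_le hy]
    exact setIntegral_nonneg measurableSet_Ioc fun r hr => mul_nonneg (hp0 r) (hG0 r ⟨hr.1, hr.2.trans hyR⟩)
  have hPmono : ∀ y, 0 ≤ y → y ≤ R → ∫ r in (0 : ℝ)..y, p r * G r ≤ P := fun y hy hyR => by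
    rw [hP, ← intervalIntegral.integral_add_adjacent_intervals (hII hpG 0 y le_rfl hy hyR)
      (hII hpG y R hy hyR le_rfl)]
    refine le_add_of_nonneg_right ?_
    rw [intervalIntegral.integral_of_le hyR]
    exact setIntegral_nonneg measurableSet_Ioc fun r hr => mul_nonneg (hp0 r) (hG0 r ⟨hy.trans_lt hr.1, hr.2⟩)
  have hPR := hP0 R hR.le le_rfl
  rw [← hP] at hPR
  have hw0 : 0 < ℓ / L := by positivity
  have hwℓ : ℓ / L ≤ ℓ := div_le_self hℓ.le hL1.le
  have hscale : ∀ I : ℝ, a / L * I ≤ ℓ / L * P → K * I ≤ K * ℓ / a * P := fun I hI => by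
    have h1 : a * I ≤ ℓ * P := by
      have := mul_le_mul_of_nonneg_left hI hL0.le
      rw [← mul_assoc, ← mul_assoc, mul_div_cancel₀ _ hL0.ne', mul_div_cancel₀ _ hL0.ne'] at this
      exact this
    have h2 : I ≤ ℓ * P / a := by rw [le_div_iff₀ ha]; linarith
    calc K * I ≤ K * (ℓ * P / a) := mul_le_mul_of_nonneg_left h2 hK0.le
      _ = _ := by ring
  have hpos2 : 0 ≤ 1 / b ^ 2 * P := by positivity
  have hpos3 : 0 ≤ K * ℓ / q * P := by positivity
  have hpos1 : 0 ≤ K * ℓ / a * P := by positivity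
  have hposD : 0 ≤ K * ℓ * G R := by positivity
  rcases hG with hG | hG
  -- `G` nondecreasing: the windows miss only the last one, where `G ≤ G R`
  · have hGi : IntegrableOn G (Set.Ioc 0 R) := by
      refine Integrable.of_bound hGm (G R) ?_
      filter_upwards [ae_restrict_mem measurableSet_Ioc] with r hr
      rw [Real.norm_eq_abs, abs_of_nonneg (hG0 r hr)]
      exact hG hr (Set.right_mem_Ioc.2 hR) hr.2
    have h1 := hscale _ (integral_le_of_window_of_monotoneOn hpc hp0 hw0.le hwR hG hG0 hGi hpG hwin')
    have h2 : ∫ r in (0 : ℝ)..R, k r * G r ≤ ∫ r in (0 : ℝ)..R, K * G r :=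
      intervalIntegral.integral_mono_on_of_le_Ioo hR.le (hII hkG 0 R le_rfl hR.le le_rfl)
        ((hII hGi 0 R le_rfl hR.le le_rfl).const_mul K) fun r hr =>
        mul_le_mul_of_nonneg_right (hkK r ⟨hr.1, hr.2.le⟩) (hG0 r ⟨hr.1, hr.2.le⟩)
    rw [intervalIntegral.integral_const_mul, ← intervalIntegral.integral_add_adjacent_intervals
      (hII hGi 0 (R - ℓ / L) le_rfl (by linarith) (by linarith))
      (hII hGi (R - ℓ / L) R (by linarith) (by linarith) le_rfl)] at h2
    have h3 : ∫ r in (R - ℓ / L)..R, G r ≤ ℓ * G R := by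
      have : ∫ r in (R - ℓ / L)..R, G r ≤ ∫ _r in (R - ℓ / L)..R, G R :=
        intervalIntegral.integral_mono_on_of_le_Ioo (by linarith)
          (hII hGi (R - ℓ / L) R (by linarith) (by linarith) le_rfl) (by simp) fun r hr =>
          hG ⟨by linarith [hr.1], hr.2.le⟩ (Set.right_mem_Ioc.2 hR) hr.2.le
      rw [intervalIntegral.integral_const, sub_sub_cancel, smul_eq_mul] at this
      exact this.trans (mul_le_mul_of_nonneg_right hwℓ hGR)
    have h4 := mul_le_mul_of_nonneg_left h3 hK0.le
    nlinarith
  -- `G` nonincreasing, possibly unbounded at the origin: the range is split at `s₁ / L` and `ℓ / L`,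
  -- and the integral over `(0, s₁ / L)` controls `G (s₁ / L)`, thus the middle range as well
  · have hu0 : 0 < s₁ / L := by positivity
    have huw : s₁ / L ≤ ℓ / L := by gcongr
    have hGi : ∀ x, 0 < x → x ≤ R → IntegrableOn G (Set.Ioc x R) := fun x hx hxR => by
      refine Integrable.of_bound
        (hGm.mono_measure (Measure.restrict_mono (Set.Ioc_subset_Ioc_left hx.le) le_rfl)) (G x) ?_
      filter_upwards [ae_restrict_mem measurableSet_Ioc] with r hr
      rw [Real.norm_eq_abs, abs_of_nonneg (hG0 r ⟨hx.trans hr.1, hr.2⟩)]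
      exact hG ⟨hx, hxR⟩ ⟨hx.trans hr.1, hr.2⟩ hr.1.le
    have h1 := hscale _ (integral_le_of_window_of_antitoneOn hpc hp0 hw0 hwR hG hG0 (hGi _ hw0 hwR) hpG hwin')
    have h2 : ∫ r in (ℓ / L)..R, k r * G r ≤ K * ∫ r in (ℓ / L)..R, G r := by
      rw [← intervalIntegral.integral_const_mul]
      refine intervalIntegral.integral_mono_on_of_le_Ioo hwR (hII hkG _ R hw0.le hwR le_rfl)
        (IntervalIntegrable.const_mul ?_ K) fun r hr =>
        mul_le_mul_of_nonneg_right (hkK r ⟨hw0.trans hr.1, hr.2.le⟩) (hG0 r ⟨hw0.trans hr.1, hr.2.le⟩)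
      rw [intervalIntegrable_iff_integrableOn_Ioc_of_le hwR]
      exact hGi _ hw0 hwR
    have huR : s₁ / L ≤ R := huw.trans hwR
    have h3 : ∫ r in (0 : ℝ)..(s₁ / L), k r * G r ≤ 1 / b ^ 2 * P := by
      refine le_trans ?_ (mul_le_mul_of_nonneg_left (hPmono _ hu0.le huR) (by positivity))
      rw [← intervalIntegral.integral_const_mul]
      refine intervalIntegral.integral_mono_on_of_le_Ioo hu0.le (hII hkG _ _ le_rfl hu0.le huR)
        ((hII hpG _ _ le_rfl hu0.le huR).const_mul _) fun r hr => ?_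
      have hrR : r ∈ Set.Ioc 0 R := ⟨hr.1, hr.2.le.trans huR⟩
      rw [← mul_assoc]
      refine mul_le_mul_of_nonneg_right ?_ (hG0 r hrR)
      rw [div_mul_eq_mul_div, one_mul, le_div_iff₀ (by positivity), mul_comm]
      refine hsmall _ (mul_nonneg hL0.le hr.1.le) ?_
      have := hr.2.le
      rw [le_div_iff₀ hL0] at this
      linarith
    have h4 : G (s₁ / L) * (q / L) ≤ P := by
      refine le_trans ?_ (hPmono _ hu0.le huR)
      have h5 := intervalIntegral.integral_comp_mul_left (a := 0) (b := s₁ / L)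
        (fun t => normalizedProfile n t ^ 2) hL0.ne'
      rw [mul_zero, mul_div_cancel₀ _ hL0.ne', ← hq, smul_eq_mul, ← div_eq_inv_mul] at h5
      rw [← h5, ← intervalIntegral.integral_const_mul]
      refine intervalIntegral.integral_mono_on_of_le_Ioo hu0.le
        ((hpc.intervalIntegrable _ _).const_mul _) (hII hpG _ _ le_rfl hu0.le huR) fun r hr => ?_
      rw [mul_comm]
      exact mul_le_mul_of_nonneg_left (hG ⟨hr.1, hr.2.le.trans huR⟩ ⟨hu0, huR⟩ hr.2.le) (hp0 r)
    have h5 : ∫ r in (s₁ / L)..(ℓ / L), k r * G r ≤ K * ℓ / q * P := by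
      have h6 : ∫ r in (s₁ / L)..(ℓ / L), k r * G r ≤ ∫ _r in (s₁ / L)..(ℓ / L), K * G (s₁ / L) := by
        refine intervalIntegral.integral_mono_on_of_le_Ioo huw (hII hkG _ _ hu0.le huw hwR) (by simp)
          fun r hr => ?_
        have hrR : r ∈ Set.Ioc 0 R := ⟨hu0.trans hr.1, hr.2.le.trans hwR⟩
        exact mul_le_mul (hkK r hrR) (hG ⟨hu0, huR⟩ hrR hr.1.le) (hG0 r hrR) hK0.le
      rw [intervalIntegral.integral_const, smul_eq_mul] at h6
      have h7 : 0 ≤ G (s₁ / L) := hG0 _ ⟨hu0, huR⟩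
      have h8 : (ℓ / L - s₁ / L) * (K * G (s₁ / L)) ≤ ℓ / L * (K * G (s₁ / L)) :=
        mul_le_mul_of_nonneg_right (by linarith) (by positivity)
      have h9 : ℓ / L * (K * G (s₁ / L)) = K * ℓ / q * (G (s₁ / L) * (q / L)) := by
        field_simp
      rw [h9] at h8
      exact h6.trans (h8.trans (mul_le_mul_of_nonneg_left h4 (by positivity)))
    rw [← intervalIntegral.integral_add_adjacent_intervals (hII hkG 0 (ℓ / L) le_rfl hw0.le hwR)
      (hII hkG (ℓ / L) R hw0.le hwR le_rfl),
      ← intervalIntegral.integral_add_adjacent_intervals (hII hkG 0 (s₁ / L) le_rfl hu0.le huR)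
      (hII hkG (s₁ / L) (ℓ / L) hu0.le huw hwR)]
    nlinarith

/-! ### Weights which are regular at the origin -/

/-- The radial kernel of `ballFluctuation`. -/
noncomputable def fluctuationKernel (n : ℕ) (c L r : ℝ) : ℝ :=
  if r ≤ c / L then L ^ (2 * (n + 1)) else L ^ n / r ^ (n + 2)

lemma measurable_fluctuationKernel (c L : ℝ) : Measurable (fluctuationKernel n c L) :=
  Measurable.ite measurableSet_Iic (by fun_prop) (by fun_prop)

lemma fluctuationKernel_nonneg {c L : ℝ} (hc : 0 < c) (hL : 0 < L) (r : ℝ) :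
    0 ≤ fluctuationKernel n c L r := by
  unfold fluctuationKernel
  split_ifs with h
  · positivity
  · have : 0 < r := (by positivity : 0 < c / L).trans (not_le.1 h)
    positivity

lemma fluctuationKernel_le {c L : ℝ} (hc : 0 < c) (hL : 0 < L) (r : ℝ) :
    |fluctuationKernel n c L r| ≤ L ^ (2 * (n + 1)) + L ^ n / (c / L) ^ (n + 2) := by
  rw [abs_of_nonneg (fluctuationKernel_nonneg hc hL r)]
  unfold fluctuationKernel
  have hcL : 0 < c / L := by positivity
  split_ifs with h
  · have : 0 ≤ L ^ n / (c / L) ^ (n + 2) := by positivity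
    linarith
  · have h1 : c / L ≤ r := (not_le.1 h).le
    have : L ^ n / r ^ (n + 2) ≤ L ^ n / (c / L) ^ (n + 2) := by gcongr
    have : 0 ≤ L ^ (2 * (n + 1)) := by positivity
    linarith

/-- In the radial variable the kernel is the envelope of the squared profile. -/
lemma fluctuationKernel_eq {c L r : ℝ} (hL : 0 < L) (hr : 0 < r) :
    r ^ n * fluctuationKernel n c L r * r ^ 2 = L ^ n * profileEnvelope n c (L * r) := by
  unfold fluctuationKernel profileEnvelope
  have h : r ≤ c / L ↔ L * r ≤ c := by rw [le_div_iff₀ hL, mul_comm]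
  simp only [h]
  split_ifs
  · ring
  · field_simp
    ring

lemma ballFluctuation_eq_integral {f : 𝔼 (n + 1) → ℝ} {M : ℝ} (hf : IsWeight f M) {c L : ℝ}
    (hc : 0 < c) (hL : 0 < L) :
    IntegrableOn (fun θ => f θ * fluctuationKernel n c L ‖θ‖) (freqCube (n + 1)) ∧
    ballFluctuation f c L = ∫ θ in freqCube (n + 1), f θ * fluctuationKernel n c L ‖θ‖ := by
  have hi : IntegrableOn (fun θ => f θ * fluctuationKernel n c L ‖θ‖) (freqCube (n + 1)) :=
    hf.integrableOn_mul (g := fun θ => fluctuationKernel n c L ‖θ‖)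
      (Integrable.of_bound
        ((measurable_fluctuationKernel c L).comp measurable_norm).aestronglyMeasurable _
        (ae_of_all _ fun θ => fluctuationKernel_le hc hL _))
  refine ⟨hi, ?_⟩
  have hm1 := measurableSet_freqCube.inter (measurableSet_norm_le (d := n + 1) (c / L))
  have hm2 := measurableSet_freqCube.inter (measurableSet_lt_norm (d := n + 1) (c / L))
  rw [setIntegral_split hi (c / L), ballFluctuation_succ, ← integral_const_mul, ← integral_const_mul]
  congr 1
  · refine setIntegral_congr_fun hm1 fun θ hθ => ?_
    have : ‖θ‖ ≤ c / L := hθ.2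
    simp only [fluctuationKernel, if_pos this]
    ring
  · refine setIntegral_congr_fun hm2 fun θ hθ => ?_
    have : ¬ ‖θ‖ ≤ c / L := not_le.2 hθ.2
    simp only [fluctuationKernel, if_neg this]
    ring

lemma ball_subset_freqCube {R : ℝ} (hR : R ≤ Real.pi) : Metric.ball (0 : 𝔼 d) R ⊆ freqCube d := by
  intro θ hθ k
  rw [mem_ball_zero_iff] at hθ
  have h := PiLp.norm_apply_le θ k
  exact abs_le.1 ((h.trans hθ.le).trans hR)

/-- Regularity at the origin says that, up to constants and null sets, the spherical means of the
weight are `r²` times a monotone nonnegative function. -/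
lemma exists_monotone_spherical_mean {f S : 𝔼 (n + 1) → ℝ} {M : ℝ} (hf : IsWeight f M)
    (hfS : ∀ᵐ θ ∂(volume.restrict (freqCube (n + 1))), f θ = S θ) (hS : IsRegularAtOrigin S) :
    ∃ (G : ℝ → ℝ) (R c₁ C₁ : ℝ), 0 < R ∧ R ≤ Real.pi ∧ 0 < c₁ ∧ 0 < C₁ ∧
      (∀ r ∈ Set.Ioc 0 R, 0 ≤ G r) ∧
      (MonotoneOn G (Set.Ioc 0 R) ∨ AntitoneOn G (Set.Ioc 0 R)) ∧
      ∀ᵐ r ∂(volume.restrict (Set.Ioo 0 R)),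
        c₁ * (r ^ 2 * G r) ≤ (∫ ω : Metric.sphere (0 : 𝔼 (n + 1)) 1,
          f (r • (ω : 𝔼 (n + 1))) ∂(volume : Measure (𝔼 (n + 1))).toSphere) ∧
        (∫ ω : Metric.sphere (0 : 𝔼 (n + 1)) 1,
          f (r • (ω : 𝔼 (n + 1))) ∂(volume : Measure (𝔼 (n + 1))).toSphere) ≤ C₁ * (r ^ 2 * G r) := by
  obtain ⟨A, ε, c₁, C₁, hε, hc₁, hC₁, hA, hAi, hmono⟩ := hS
  have hpi := Real.pi_pos
  set ρ : ℝ := min ε Real.pi with hρ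
  have hρ0 : 0 < ρ := lt_min hε hpi
  have hρε : ρ ≤ ε := min_le_left _ _
  have hρpi : ρ ≤ Real.pi := min_le_right _ _
  rw [ae_restrict_iff' measurableSet_freqCube] at hfS
  obtain ⟨N, hNsub, hNm, hN0⟩ := exists_measurable_superset_of_null hfS
  have hmean : ∀ᵐ r ∂(volume.restrict (Set.Ioo 0 ρ)),
      c₁ * (r ^ 2 * scaledSphericalMean A r) ≤ (∫ ω : Metric.sphere (0 : 𝔼 (n + 1)) 1,
          f (r • (ω : 𝔼 (n + 1))) ∂(volume : Measure (𝔼 (n + 1))).toSphere) ∧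
        (∫ ω : Metric.sphere (0 : 𝔼 (n + 1)) 1,
          f (r • (ω : 𝔼 (n + 1))) ∂(volume : Measure (𝔼 (n + 1))).toSphere)
            ≤ C₁ * (r ^ 2 * scaledSphericalMean A r) := by
    have h := ae_sphere_of_null hNm hN0
    filter_upwards [ae_restrict_of_ae_restrict_of_subset Set.Ioo_subset_Ioi_self h,
      ae_restrict_mem measurableSet_Ioo] with r hr hrρ
    have hr0 : 0 < r := hrρ.1
    have hnorm : ∀ ω : Metric.sphere (0 : 𝔼 (n + 1)) 1, r • (ω : 𝔼 (n + 1)) ∈ Metric.ball 0 ρ :=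
      fun ω => by
        rw [mem_ball_zero_iff, norm_smul, norm_eq_of_mem_sphere, mul_one, Real.norm_eq_abs,
          abs_of_pos hr0]
        exact hrρ.2
    have hfS' : ∀ᵐ ω : Metric.sphere (0 : 𝔼 (n + 1)) 1 ∂(volume : Measure (𝔼 (n + 1))).toSphere,
        f (r • (ω : 𝔼 (n + 1))) = S (r • (ω : 𝔼 (n + 1))) := by
      filter_upwards [hr] with ω hω
      by_contra hne
      exact hω (hNsub fun h => hne (h (ball_subset_freqCube hρpi (hnorm ω))))
    have hfi : Integrable (fun ω : Metric.sphere (0 : 𝔼 (n + 1)) 1 => f (r • (ω : 𝔼 (n + 1))))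
        (volume : Measure (𝔼 (n + 1))).toSphere :=
      Integrable.of_bound (hf.measurable.comp (by fun_prop)).aestronglyMeasurable M
        (ae_of_all _ fun ω => by
          rw [Real.norm_eq_abs, abs_of_nonneg (hf.nonneg _)]; exact hf.le _)
    have hAr := hAi r ⟨hr0, hrρ.2.trans_le hρε⟩
    have hG : r ^ 2 * scaledSphericalMean A r = ∫ ω : Metric.sphere (0 : 𝔼 (n + 1)) 1,
        A (r • (ω : 𝔼 (n + 1))) ∂(volume : Measure (𝔼 (n + 1))).toSphere :=
      mul_div_cancel₀ _ (by positivity)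
    rw [hG, ← integral_const_mul, ← integral_const_mul]
    refine ⟨integral_mono_ae (hAr.const_mul _) hfi ?_, integral_mono_ae hfi (hAr.const_mul _) ?_⟩
    · filter_upwards [hfS'] with ω hω
      rw [hω]
      exact (hA _ (Metric.ball_subset_ball hρε (hnorm ω))).1
    · filter_upwards [hfS'] with ω hω
      rw [hω]
      exact (hA _ (Metric.ball_subset_ball hρε (hnorm ω))).2
  -- almost everywhere nonnegativity is upgraded to all radii by monotonicity
  have hdense : ∀ a b, 0 ≤ a → a < b → b ≤ ρ → ∃ r ∈ Set.Ioo a b, 0 ≤ scaledSphericalMean A r := by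
    intro a b ha hab hb
    have h := ae_restrict_of_ae_restrict_of_subset (Set.Ioo_subset_Ioo ha hb) hmean
    have hne : (ae (volume.restrict (Set.Ioo a b))).NeBot := by
      rw [ae_neBot, Ne, Measure.restrict_eq_zero]
      simp [hab]
    obtain ⟨r, hr, hr'⟩ := (h.and (ae_restrict_mem measurableSet_Ioo)).exists
    refine ⟨r, hr', ?_⟩
    have h0 : 0 ≤ C₁ * (r ^ 2 * scaledSphericalMean A r) :=
      (integral_nonneg fun ω => hf.nonneg _).trans hr.2
    have hr0 : 0 < r := ha.trans_lt hr'.1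
    exact nonneg_of_mul_nonneg_right (nonneg_of_mul_nonneg_right h0 hC₁) (by positivity)
  have hsub : Set.Ioc 0 (ρ / 2) ⊆ Set.Ioo 0 ε := fun r hr => ⟨hr.1, by linarith [hr.2]⟩
  refine ⟨scaledSphericalMean A, ρ / 2, c₁, C₁, by positivity, by linarith, hc₁, hC₁, fun r hr => ?_,
    hmono.imp (fun h => h.mono hsub) (fun h => h.mono hsub),
    ae_restrict_of_ae_restrict_of_subset (Set.Ioo_subset_Ioo le_rfl (by linarith)) hmean⟩
  rcases hmono with hmono | hmono
  · obtain ⟨r', hr', h0⟩ := hdense 0 r le_rfl hr.1 (by linarith [hr.2])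
    exact h0.trans (hmono ⟨hr'.1, by linarith [hr.2, hr'.2]⟩ (hsub hr) hr'.2.le)
  · obtain ⟨r', hr', h0⟩ := hdense r ρ hr.1.le (by linarith [hr.2]) le_rfl
    exact h0.trans (hmono (hsub hr) ⟨hr.1.trans hr'.1, by linarith [hr'.2]⟩ hr'.1.le)

/-- For a weight which is regular at the origin, the oscillations of the Fourier transform of the
ball do not matter. -/
lemma exists_ballFluctuation_le {f S : 𝔼 (n + 1) → ℝ} {M : ℝ} (hf : IsWeight f M)
    (hfS : ∀ᵐ θ ∂(volume.restrict (freqCube (n + 1))), f θ = S θ) (hS : IsRegularAtOrigin S)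
    {c : ℝ} (hc : 0 < c) :
    ∃ a D L₀ : ℝ, 0 < a ∧ 0 ≤ D ∧ 0 < L₀ ∧ ∀ L > L₀,
      ballFluctuation f c L ≤ a * (∫ θ in freqCube (n + 1), f θ * ballFTReal n L ‖θ‖ ^ 2) + D * L ^ n := by
  obtain ⟨G, R, c₁, C₁, hR, hRpi, hc₁, hC₁, hG0, hG, hmean⟩ := exists_monotone_spherical_mean hf hfS hS
  obtain ⟨B, D, L₀, hB, hD, hL₀, hcomp⟩ := exists_radial_comparison n hc hR hG0 hG
  obtain ⟨A, hA, hbd⟩ := exists_ballFTReal_bound n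
  have hV := unitBallVolume_pos n
  set V := unitBallVolume n with hVdef
  have hM := hf.bound_nonneg
  set vol : ℝ := volume.real (freqCube (n + 1)) with hvol
  have hvol0 : 0 ≤ vol := measureReal_nonneg
  refine ⟨C₁ * B / (c₁ * V ^ 2), C₁ * D + M / R ^ (n + 2) * vol, max L₀ (c / R), by positivity,
    by positivity, lt_max_of_lt_left hL₀, fun L hL => ?_⟩
  have hL0 : 0 < L := hL₀.trans ((le_max_left _ _).trans_lt hL)
  have hLn : 0 < L ^ n := by positivity
  have hcR : c / L < R := by
    have := (le_max_right _ _).trans_lt hL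
    rw [div_lt_iff₀ hR] at this
    rw [div_lt_iff₀ hL0]; linarith
  obtain ⟨hFi, hF⟩ := ballFluctuation_eq_integral hf hc hL0
  set m : ℝ → ℝ := fun r => ∫ ω : Metric.sphere (0 : 𝔼 (n + 1)) 1,
    f (r • (ω : 𝔼 (n + 1))) ∂(volume : Measure (𝔼 (n + 1))).toSphere with hm
  obtain ⟨hi2, he2⟩ := hf.integral_ball_polar (measurable_fluctuationKernel (n := n) c L)
    (fluctuationKernel_le hc hL0) (R := R)
  obtain ⟨hi1, he1⟩ := hf.integral_ball_polar (φ := fun r => ballFTReal n L r ^ 2)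
    ((continuous_ballFTReal L).pow 2).measurable
    (fun r => by rw [abs_of_nonneg (sq_nonneg _)]; exact (hbd L hL0).1 r) (R := R)
  have hGm : AEStronglyMeasurable G (volume.restrict (Set.Ioo 0 R)) := by
    refine AEStronglyMeasurable.mono_measure ?_ (Measure.restrict_mono Set.Ioo_subset_Ioc_self le_rfl)
    rcases hG with hG | hG
    · exact (aemeasurable_restrict_of_monotoneOn measurableSet_Ioc hG).aestronglyMeasurable
    · exact (aemeasurable_restrict_of_antitoneOn measurableSet_Ioc hG).aestronglyMeasurable
  have hkG' : IntegrableOn (fun r => profileEnvelope n c (L * r) * G r) (Set.Ioo 0 R) := by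
    refine (hi2.const_mul (1 / (c₁ * L ^ n))).mono'
      (((measurable_profileEnvelope c).comp (measurable_const_mul L)).aestronglyMeasurable.mul hGm) ?_
    filter_upwards [hmean, ae_restrict_mem measurableSet_Ioo] with r hr hrR
    have hr0 : 0 < r := hrR.1
    have hG0r := hG0 r ⟨hrR.1, hrR.2.le⟩
    rw [Real.norm_eq_abs, abs_of_nonneg (mul_nonneg (profileEnvelope_nonneg (by positivity)) hG0r),
      div_mul_eq_mul_div, one_mul, le_div_iff₀ (by positivity)]
    have h1 : 0 ≤ r ^ n * fluctuationKernel n c L r :=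
      mul_nonneg (by positivity) (fluctuationKernel_nonneg hc hL0 r)
    calc profileEnvelope n c (L * r) * G r * (c₁ * L ^ n)
        = (L ^ n * profileEnvelope n c (L * r)) * (c₁ * G r) := by ring
      _ = (r ^ n * fluctuationKernel n c L r) * (c₁ * (r ^ 2 * G r)) := by
          rw [← fluctuationKernel_eq hL0 hr0]; ring
      _ ≤ _ := mul_le_mul_of_nonneg_left hr.1 h1
  have hkG : IntegrableOn (fun r => profileEnvelope n c (L * r) * G r) (Set.Ioc 0 R) :=
    (integrableOn_Ioc_iff_integrableOn_Ioo enorm_ne_top).2 hkG'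
  obtain ⟨hpG, hle⟩ := hcomp L ((le_max_left _ _).trans_lt hL) hkG
  rw [intervalIntegral.integral_of_le hR.le, intervalIntegral.integral_of_le hR.le,
    integral_Ioc_eq_integral_Ioo, integral_Ioc_eq_integral_Ioo] at hle
  have hpG' := (integrableOn_Ioc_iff_integrableOn_Ioo enorm_ne_top).1 hpG
  have hball := ball_subset_freqCube (d := n + 1) hRpi
  -- inside the ball of radius `R`
  have hin : ∫ x in Metric.ball (0 : 𝔼 (n + 1)) R, f x * fluctuationKernel n c L ‖x‖
      ≤ C₁ * L ^ n * ∫ r in Set.Ioo 0 R, profileEnvelope n c (L * r) * G r := by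
    rw [he2, ← integral_const_mul]
    refine integral_mono_ae hi2 (hkG'.const_mul _) ?_
    filter_upwards [hmean, ae_restrict_mem measurableSet_Ioo] with r hr hrR
    have hr0 : 0 < r := hrR.1
    have h1 : 0 ≤ r ^ n * fluctuationKernel n c L r :=
      mul_nonneg (by positivity) (fluctuationKernel_nonneg hc hL0 r)
    calc r ^ n * fluctuationKernel n c L r * m r
        ≤ (r ^ n * fluctuationKernel n c L r) * (C₁ * (r ^ 2 * G r)) :=
          mul_le_mul_of_nonneg_left hr.2 h1
      _ = (r ^ n * fluctuationKernel n c L r * r ^ 2) * (C₁ * G r) := by ring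
      _ = _ := by rw [fluctuationKernel_eq hL0 hr0]; ring
  -- the same ball carries enough of the mean square of the Fourier transform
  have hlow : c₁ * V ^ 2 * L ^ n * (∫ r in Set.Ioo 0 R, normalizedProfile n (L * r) ^ 2 * G r)
      ≤ ∫ θ in freqCube (n + 1), f θ * ballFTReal n L ‖θ‖ ^ 2 := by
    have hbc : Continuous fun θ : 𝔼 (n + 1) => ballFTReal n L ‖θ‖ ^ 2 :=
      ((continuous_ballFTReal L).comp continuous_norm).pow 2
    refine le_trans ?_ (setIntegral_mono_set
      (hf.integrableOn_mul (integrable_of_continuous_of_isBounded hbc isBounded_freqCube))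
      (ae_of_all _ fun θ => mul_nonneg (hf.nonneg θ) (sq_nonneg _)) (LE.le.eventuallyLE hball))
    rw [he1, ← integral_const_mul]
    refine integral_mono_ae (hpG'.const_mul _) hi1 ?_
    filter_upwards [hmean, ae_restrict_mem measurableSet_Ioo] with r hr hrR
    have hr0 : 0 < r := hrR.1
    calc c₁ * V ^ 2 * L ^ n * (normalizedProfile n (L * r) ^ 2 * G r)
        = r ^ n * ballFTReal n L r ^ 2 * (c₁ * (r ^ 2 * G r)) := by
          rw [ballFTReal_sq hL0 hr0, ← hVdef]; field_simp; ring
      _ ≤ _ := mul_le_mul_of_nonneg_left hr.1 (by positivity)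
  -- outside the ball the kernel is of order `L ^ n`
  have hout : ∫ x in freqCube (n + 1) \ Metric.ball (0 : 𝔼 (n + 1)) R,
      f x * fluctuationKernel n c L ‖x‖ ≤ M / R ^ (n + 2) * vol * L ^ n := by
    have hms : MeasurableSet (freqCube (n + 1) \ Metric.ball (0 : 𝔼 (n + 1)) R) :=
      measurableSet_freqCube.diff measurableSet_ball
    have hfin : IntegrableOn (fun _ : 𝔼 (n + 1) => M * (L ^ n / R ^ (n + 2))) (freqCube (n + 1)) :=
      integrable_of_continuous_of_isBounded continuous_const isBounded_freqCube
    refine (setIntegral_mono_on (hFi.mono_set Set.sdiff_subset)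
      (hfin.mono_set Set.sdiff_subset) hms fun θ hθ => ?_).trans ?_
    · have hRθ : R ≤ ‖θ‖ := by
        have := hθ.2
        rwa [mem_ball_zero_iff, not_lt] at this
      rw [fluctuationKernel, if_neg (by linarith)]
      have h1 : L ^ n / ‖θ‖ ^ (n + 2) ≤ L ^ n / R ^ (n + 2) := by gcongr
      exact mul_le_mul (hf.le θ) h1 (by positivity) hM
    · refine (setIntegral_mono_set hfin (ae_of_all _ fun θ => by
        show (0 : ℝ) ≤ _; positivity) (LE.le.eventuallyLE Set.sdiff_subset)).trans (le_of_eq ?_)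
      rw [setIntegral_const, smul_eq_mul]
      ring
  have hsplit := integral_inter_add_sdiff (s := freqCube (n + 1)) (t := Metric.ball (0 : 𝔼 (n + 1)) R)
    measurableSet_ball hFi
  rw [Set.inter_eq_right.2 hball] at hsplit
  rw [hF, ← hsplit]
  set P := ∫ r in Set.Ioo 0 R, normalizedProfile n (L * r) ^ 2 * G r
  set I := ∫ θ in freqCube (n + 1), f θ * ballFTReal n L ‖θ‖ ^ 2
  have h1 : C₁ * L ^ n * (B * P + D) ≤ C₁ * B / (c₁ * V ^ 2) * I + C₁ * D * L ^ n := by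
    have h2 : C₁ * B / (c₁ * V ^ 2) * (c₁ * V ^ 2 * L ^ n * P) ≤ C₁ * B / (c₁ * V ^ 2) * I :=
      mul_le_mul_of_nonneg_left hlow (by positivity)
    have h3 : C₁ * B / (c₁ * V ^ 2) * (c₁ * V ^ 2 * L ^ n * P) = C₁ * L ^ n * (B * P) := by
      field_simp
    rw [h3] at h2
    linarith
  have h4 := mul_le_mul_of_nonneg_left hle (by positivity : 0 ≤ C₁ * L ^ n)
  linarith

/-! ### Oscillatory integrals -/

/-- A Riemann-Lebesgue lemma on the half-line for a phase with positive derivative. -/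
lemma tendsto_integral_exp_of_deriv_pos {G : ℝ → ℂ} {φ φ' : ℝ → ℝ}
    (hφ : ∀ r > 0, HasDerivAt φ (φ' r) r) (hpos : ∀ r > 0, 0 < φ' r) :
    Tendsto (fun L : ℝ => ∫ r in Set.Ioi (0 : ℝ), G r * Complex.exp (L * φ r * Complex.I))
      atTop (𝓝 0) := by
  have hcont : ContinuousOn φ (Set.Ioi 0) := fun r hr => (hφ r hr).continuousAt.continuousWithinAt
  have hmono : StrictMonoOn φ (Set.Ioi 0) := by
    refine strictMonoOn_of_deriv_pos (convex_Ioi 0) hcont fun r hr => ?_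
    rw [interior_Ioi] at hr
    rw [(hφ r hr).deriv]
    exact hpos r hr
  have hinj := hmono.injOn
  have himg : MeasurableSet (φ '' Set.Ioi 0) :=
    (isPreconnected_Ioi.image φ hcont).ordConnected.measurableSet
  set ψ := Function.invFunOn φ (Set.Ioi 0) with hψ
  have hleft : ∀ r ∈ Set.Ioi (0 : ℝ), ψ (φ r) = r := fun r hr => hinj.leftInvOn_invFunOn hr
  -- The substitution `t = φ r` turns the integral into the Fourier transform of `H`. No integrability
  -- is assumed: both sides are zero when it fails.
  set H : ℝ → ℂ := (φ '' Set.Ioi 0).indicator fun t => G (ψ t) / (φ' (ψ t) : ℂ) with hH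
  have hRL := Real.tendsto_integral_exp_smul_cocompact H
  have hsc : Tendsto (fun L : ℝ => -(2 * Real.pi)⁻¹ * L) atTop (cocompact ℝ) := by
    refine Tendsto.mono_right ?_ atBot_le_cocompact
    exact tendsto_id.const_mul_atTop_of_neg (by have := Real.pi_pos; simp [this])
  refine (hRL.comp hsc).congr fun L => ?_
  have h1 : ∀ v : ℝ, Real.fourierChar (-(v * (-(2 * Real.pi)⁻¹ * L))) • H v
      = (φ '' Set.Ioi 0).indicator (fun t => G (ψ t) / (φ' (ψ t) : ℂ) * Complex.exp (L * t * Complex.I)) v := by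
    intro v
    rw [hH]
    by_cases hv : v ∈ φ '' Set.Ioi 0
    · rw [Set.indicator_of_mem hv, Set.indicator_of_mem hv, Circle.smul_def, Real.fourierChar_apply,
        smul_eq_mul, mul_comm]
      congr 3
      have := Real.pi_ne_zero
      push_cast
      have hpi : (Real.pi : ℂ) ≠ 0 := by exact_mod_cast this
      field_simp
    · rw [Set.indicator_of_notMem hv, Set.indicator_of_notMem hv, smul_zero]
  simp only [Function.comp]
  simp_rw [h1]
  rw [integral_indicator himg, integral_image_eq_integral_abs_deriv_smul measurableSet_Ioi
    (fun r hr => (hφ r hr).hasDerivWithinAt) hinj]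
  refine setIntegral_congr_fun measurableSet_Ioi fun r hr => ?_
  have hp := hpos r hr
  have hp' : (φ' r : ℂ) ≠ 0 := by exact_mod_cast hp.ne'
  simp only [hleft r hr, abs_of_pos hp, Complex.real_smul]
  field_simp

/-- A Riemann-Lebesgue lemma for a phase which is strictly increasing along almost every ray. -/
lemma tendsto_integral_exp_of_ray {g : 𝔼 (n + 1) → ℂ} (hg : Integrable g) {ψ : 𝔼 (n + 1) → ℝ}
    (hψ : Continuous ψ) (h : ∀ᵐ ω : Metric.sphere (0 : 𝔼 (n + 1)) 1
      ∂(volume : Measure (𝔼 (n + 1))).toSphere, ∃ φ' : ℝ → ℝ, ∀ r > 0,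
        HasDerivAt (fun r : ℝ => ψ (r • (ω : 𝔼 (n + 1)))) (φ' r) r ∧ 0 < φ' r) :
    Tendsto (fun L : ℝ => ∫ θ, g θ * Complex.exp (L * ψ θ * Complex.I)) atTop (𝓝 0) := by
  have hnorm : ∀ (L : ℝ) θ, ‖g θ * Complex.exp (L * ψ θ * Complex.I)‖ = ‖g θ‖ := fun L θ => by
    rw [norm_mul, ← Complex.ofReal_mul, Complex.norm_exp_ofReal_mul_I, mul_one]
  have hi : ∀ L : ℝ, Integrable fun θ => g θ * Complex.exp (L * ψ θ * Complex.I) := fun L =>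
    hg.mono (hg.aestronglyMeasurable.mul
      (by fun_prop : Continuous fun θ => Complex.exp (L * ψ θ * Complex.I)).aestronglyMeasurable)
      (ae_of_all _ fun θ => (hnorm L θ).le)
  have hnn := (integral_polar_prod hg.norm).1
  have hpol : ∀ L : ℝ, ∫ θ, g θ * Complex.exp (L * ψ θ * Complex.I)
      = ∫ ω : Metric.sphere (0 : 𝔼 (n + 1)) 1, (∫ r in Set.Ioi (0 : ℝ), r ^ n •
        (g (r • (ω : 𝔼 (n + 1))) * Complex.exp (L * ψ (r • (ω : 𝔼 (n + 1))) * Complex.I)))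
        ∂(volume : Measure (𝔼 (n + 1))).toSphere := fun L => by
    obtain ⟨h1, h2⟩ := integral_polar_prod (hi L)
    rw [h2, integral_prod _ h1]
    refine integral_congr_ae (ae_of_all _ fun ω => ?_)
    exact integral_volumeIoiPow fun r : ℝ =>
      g (r • (ω : 𝔼 (n + 1))) * Complex.exp (L * ψ (r • (ω : 𝔼 (n + 1))) * Complex.I)
  simp_rw [hpol]
  have hzero : (0 : ℂ) = ∫ _ω : Metric.sphere (0 : 𝔼 (n + 1)) 1, (0 : ℂ)
      ∂(volume : Measure (𝔼 (n + 1))).toSphere := by simp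
  rw [hzero]
  refine tendsto_integral_filter_of_dominated_convergence
    (fun ω : Metric.sphere (0 : 𝔼 (n + 1)) 1 => ∫ r : Set.Ioi (0 : ℝ), ‖g ((r : ℝ) • (ω : 𝔼 (n + 1)))‖
      ∂(Measure.volumeIoiPow n)) (Eventually.of_forall fun L => ?_)
    (Eventually.of_forall fun L => ?_) hnn.integral_prod_left ?_
  · have h1 := (integral_polar_prod (hi L)).1.integral_prod_left.aestronglyMeasurable
    refine h1.congr (ae_of_all _ fun ω => ?_)
    exact integral_volumeIoiPow fun r : ℝ =>
      g (r • (ω : 𝔼 (n + 1))) * Complex.exp (L * ψ (r • (ω : 𝔼 (n + 1))) * Complex.I)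
  · refine ae_of_all _ fun ω => ?_
    rw [← integral_volumeIoiPow fun r : ℝ =>
      g (r • (ω : 𝔼 (n + 1))) * Complex.exp (L * ψ (r • (ω : 𝔼 (n + 1))) * Complex.I)]
    refine (norm_integral_le_integral_norm _).trans (le_of_eq ?_)
    simp_rw [hnorm]
  · filter_upwards [h] with ω ⟨φ', hφ'⟩
    refine (tendsto_integral_exp_of_deriv_pos (G := fun r => r ^ n • g (r • (ω : 𝔼 (n + 1))))
      (fun r hr => (hφ' r hr).1) fun r hr => (hφ' r hr).2).congr fun L => ?_
    simp only [smul_mul_assoc]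

/-- In dimension at least two almost no direction lies on a given line. -/
lemma ae_sphere_notMem_span (hn : 1 ≤ n) (p : 𝔼 (n + 1)) :
    ∀ᵐ ω : Metric.sphere (0 : 𝔼 (n + 1)) 1 ∂(volume : Measure (𝔼 (n + 1))).toSphere,
      (ω : 𝔼 (n + 1)) ∉ Submodule.span ℝ {p} := by
  have hne : Submodule.span ℝ {p} ≠ ⊤ := fun h => by
    have h1 := finrank_span_le_card (R := ℝ) ({p} : Set (𝔼 (n + 1)))
    rw [h] at h1
    simp at h1
    omega
  have h0 := Measure.addHaar_submodule (volume : Measure (𝔼 (n + 1))) _ hne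
  have h1 := ae_sphere_of_null (Submodule.closed_of_finiteDimensional _).measurableSet h0
  have hneb : (ae ((volume : Measure ℝ).restrict (Set.Ioi 0))).NeBot := by
    rw [ae_neBot, Ne, Measure.restrict_eq_zero]; simp
  obtain ⟨r, hr, hr0⟩ := (h1.and (ae_restrict_mem measurableSet_Ioi)).exists
  filter_upwards [hr] with ω hω h
  exact hω (Submodule.smul_mem _ r h)

/-- The phases `‖θ‖ ± ‖θ + p‖` are strictly increasing along every ray which is not parallel
to `p`. -/
lemma exists_deriv_ray_pos {p ω : 𝔼 d} (hω : ‖ω‖ = 1) (h : ω ∉ Submodule.span ℝ {p}) {σ : ℝ}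
    (hσ : |σ| = 1) (hp : p ≠ 0) : ∃ φ' : ℝ → ℝ, ∀ r > 0,
      HasDerivAt (fun r : ℝ => ‖r • ω‖ + σ * ‖r • ω + p‖) (φ' r) r ∧ 0 < φ' r := by
  refine ⟨fun r => 1 + σ * (inner ℝ (r • ω + p) ω / ‖r • ω + p‖), fun r hr => ?_⟩
  have hnz : r • ω + p ≠ 0 := fun h0 => by
    refine h (Submodule.mem_span_singleton.2 ⟨-r⁻¹, ?_⟩)
    rw [eq_neg_of_add_eq_zero_right h0, smul_neg, neg_smul, neg_neg, smul_smul,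
      inv_mul_cancel₀ hr.ne', one_smul]
  constructor
  · have h1 : HasDerivAt (fun r : ℝ => ‖r • ω‖) 1 r := by
      have : HasDerivAt (fun r : ℝ => r) 1 r := hasDerivAt_id r
      refine this.congr_of_eventuallyEq ?_
      filter_upwards [lt_mem_nhds hr] with s hs
      rw [norm_smul, hω, mul_one, Real.norm_eq_abs, abs_of_pos hs]
    have h2 : HasDerivAt (fun r : ℝ => r • ω + p) ω r := by
      simpa using ((hasDerivAt_id r).smul_const ω).add_const p
    have h3 : HasDerivAt (fun r : ℝ => ‖r • ω + p‖) (inner ℝ (r • ω + p) ω / ‖r • ω + p‖) r := by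
      have h4 := (h2.norm_sq).sqrt (by positivity)
      have h5 : (fun r : ℝ => √(‖r • ω + p‖ ^ 2)) = fun r => ‖r • ω + p‖ :=
        funext fun r => Real.sqrt_sq (norm_nonneg _)
      rw [h5, Real.sqrt_sq (norm_nonneg _)] at h4
      convert h4 using 1
      field_simp
    exact h1.add (h3.const_mul σ)
  · have hlt : |inner ℝ (r • ω + p) ω| < ‖r • ω + p‖ := by
      refine lt_of_le_of_ne ?_ fun heq => ?_
      · simpa [hω] using abs_real_inner_le_norm (r • ω + p) ω
      · have h1 : |inner ℝ (r • ω + p) ω| = ‖r • ω + p‖ * ‖ω‖ := by rw [heq, hω, mul_one]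
        have hω0 : ω ≠ 0 := fun h0 => by simp [h0] at hω
        obtain ⟨-, t, ht, h3⟩ := (abs_real_inner_div_norm_mul_norm_eq_one_iff (r • ω + p) ω).1 (by
          rw [abs_div, h1, abs_of_nonneg (by positivity), div_self (mul_ne_zero (norm_ne_zero_iff.2 hnz) (norm_ne_zero_iff.2 hω0))])
        have h4 : p = (t⁻¹ - r) • ω := by
          have : t⁻¹ • ω = r • ω + p := (congrArg (t⁻¹ • ·) h3).trans (by
            rw [smul_smul, inv_mul_cancel₀ ht, one_smul])
          rw [sub_smul, this]; abel
        have h5 : t⁻¹ - r ≠ 0 := fun h0 => hp (by rw [h4, h0, zero_smul])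
        refine h (Submodule.mem_span_singleton.2 ⟨(t⁻¹ - r)⁻¹, ?_⟩)
        rw [h4, smul_smul, inv_mul_cancel₀ h5, one_smul]
    have h6 : |σ * (inner ℝ (r • ω + p) ω / ‖r • ω + p‖)| < 1 := by
      rw [abs_mul, hσ, one_mul, abs_div, abs_norm, div_lt_one (norm_pos_iff.2 hnz)]
      exact hlt
    linarith [(abs_lt.1 h6).1]

/-! ### Equidistribution modulo the lattice -/

/-- The projection `ℝ^d → (ℝ/ℤ)^d`. -/
def toTorus (x : 𝔼 d) : UnitAddTorus (Fin d) := fun k => (x k : UnitAddCircle)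

lemma continuous_toTorus : Continuous (toTorus (d := d)) :=
  continuous_pi fun k => (AddCircle.continuous_mk' (1 : ℝ)).comp (by fun_prop)

lemma mFourier_toTorus (k : Fin d → ℤ) (x : 𝔼 d) :
    UnitAddTorus.mFourier k (toTorus x) = chi ((2 * Real.pi) • latticePoint k) x := by
  rw [chi_eq_prod]
  change (∏ i, fourier (k i) (toTorus x i)) = _
  refine Finset.prod_congr rfl fun i _ => ?_
  rw [toTorus, fourier_coe_apply, PiLp.smul_apply, latticePoint_apply, smul_eq_mul]
  congr 1
  push_cast
  ring

instance : IsProbabilityMeasure ((volume : Measure (𝔼 d)).restrict (cell d)) := by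
  constructor
  have h := volume_real_cell (d := d)
  rw [Measure.restrict_apply_univ]
  rw [measureReal_def] at h
  rw [← ENNReal.ofReal_toReal (isBounded_cell (d := d)).measure_lt_top.ne, h, ENNReal.ofReal_one]

/-- Weyl's criterion: a bounded family of densities on the unit cell whose nonzero Fourier
coefficients tend to zero is asymptotically constant when tested against continuous functions. -/
lemma tendsto_integral_cell_sub_mean {W : ℝ → 𝔼 d → ℂ} {C : ℝ}
    (hm : ∀ L, AEStronglyMeasurable (W L) (volume.restrict (cell d)))
    (hb : ∀ᶠ L in atTop, ∀ x ∈ cell d, ‖W L x‖ ≤ C)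
    (hk : ∀ k : Fin d → ℤ, k ≠ 0 → Tendsto (fun L =>
      ∫ x in cell d, chi ((2 * Real.pi) • latticePoint k) x * W L x) atTop (𝓝 0))
    (u : C(UnitAddTorus (Fin d), ℂ)) :
    Tendsto (fun L => ∫ x in cell d, (u (toTorus x) - ∫ y in cell d, u (toTorus y)) * W L x)
      atTop (𝓝 0) := by
  have hum : ∀ u : C(UnitAddTorus (Fin d), ℂ), Continuous fun x : 𝔼 d => u (toTorus x) :=
    fun u => u.continuous.comp continuous_toTorus
  have hui : ∀ u : C(UnitAddTorus (Fin d), ℂ), IntegrableOn (fun x : 𝔼 d => u (toTorus x)) (cell d) :=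
    fun u => integrable_of_continuous_of_isBounded (hum u) isBounded_cell
  have hWi : ∀ᶠ L in atTop, IntegrableOn (W L) (cell d) := hb.mono fun L hL =>
    Integrable.of_bound (hm L) C ((ae_restrict_mem measurableSet_cell).mono hL)
  have hnu : ∀ (u : C(UnitAddTorus (Fin d), ℂ)) (x : 𝔼 d),
      ‖u (toTorus x) - ∫ y in cell d, u (toTorus y)‖ ≤ 2 * ‖u‖ := fun u x => by
    have h1 : ‖∫ y in cell d, u (toTorus y)‖ ≤ ‖u‖ := by
      refine (norm_integral_le_of_norm_le_const (C := ‖u‖)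
        (ae_of_all _ fun y => u.norm_coe_le_norm _)).trans ?_
      simp
    have h2 := norm_sub_le (u (toTorus x)) (∫ y in cell d, u (toTorus y))
    have h3 := u.norm_coe_le_norm (toTorus x)
    linarith
  have hpi : ∀ᶠ L in atTop, ∀ u : C(UnitAddTorus (Fin d), ℂ), IntegrableOn (fun x =>
      (u (toTorus x) - ∫ y in cell d, u (toTorus y)) * W L x) (cell d) := by
    filter_upwards [hWi] with L hL u
    exact hL.bdd_mul (c := 2 * ‖u‖) ((hum u).sub continuous_const).aestronglyMeasurable
      (ae_of_all _ (hnu u))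
  set P : C(UnitAddTorus (Fin d), ℂ) → Prop := fun u =>
    Tendsto (fun L => ∫ x in cell d, (u (toTorus x) - ∫ y in cell d, u (toTorus y)) * W L x)
      atTop (𝓝 0) with hP
  -- trigonometric polynomials are treated term by term; the others are uniform limits of these
  have hspan : ∀ u ∈ Submodule.span ℂ (Set.range (UnitAddTorus.mFourier (d := Fin d))), P u := by
    intro u hu
    induction hu using Submodule.span_induction with
    | mem u hu =>
      obtain ⟨k, rfl⟩ := hu
      simp only [hP, mFourier_toTorus]
      by_cases hk0 : k = 0
      · subst hk0
        simp only [latticePoint_zero, smul_zero, chi_zero_left]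
        simp
      · rw [integral_chi_cell hk0]
        simpa using hk k hk0
    | zero => simp [hP]
    | add u v _ _ hu hv =>
      have := hu.add hv
      rw [add_zero] at this
      refine this.congr' ?_
      filter_upwards [hpi] with L hL
      rw [← integral_add (hL u) (hL v)]
      refine integral_congr_ae (ae_of_all _ fun x => ?_)
      simp only [ContinuousMap.add_apply]
      rw [integral_add (hui u) (hui v)]
      ring
    | smul a u _ hu =>
      have := hu.const_mul a
      rw [mul_zero] at this
      refine this.congr fun L => ?_
      rw [← integral_const_mul]
      refine integral_congr_ae (ae_of_all _ fun x => ?_)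
      simp only [ContinuousMap.smul_apply, smul_eq_mul]
      rw [integral_const_mul]
      ring
  have hC : 0 ≤ C := by
    obtain ⟨L, hL⟩ := hb.exists
    exact (norm_nonneg _).trans (hL 0 fun k => by simp)
  rw [Metric.tendsto_nhds]
  intro ε hε
  have hu : u ∈ closure (Submodule.span ℂ (Set.range (UnitAddTorus.mFourier (d := Fin d))) :
      Set C(UnitAddTorus (Fin d), ℂ)) := by
    rw [← Submodule.topologicalClosure_coe, UnitAddTorus.span_mFourier_closure_eq_top]
    trivial
  obtain ⟨v, hv, huv⟩ := Metric.mem_closure_iff.1 hu (ε / (4 * (C + 1))) (by positivity)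
  have hvP := Metric.tendsto_nhds.1 (hspan v hv) (ε / 2) (by positivity)
  filter_upwards [hvP, hpi, hb] with L h1 h2 h3
  rw [dist_zero_right] at h1 ⊢
  have h4 : ∫ x in cell d, (u (toTorus x) - ∫ y in cell d, u (toTorus y)) * W L x
      = (∫ x in cell d, (v (toTorus x) - ∫ y in cell d, v (toTorus y)) * W L x)
        + ∫ x in cell d, ((u - v) (toTorus x) - ∫ y in cell d, (u - v) (toTorus y)) * W L x := by
    rw [← integral_add (h2 v) (h2 (u - v))]
    refine integral_congr_ae (ae_of_all _ fun x => ?_)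
    simp only [ContinuousMap.sub_apply]
    rw [integral_sub (hui u) (hui v)]
    ring
  have h5 : ‖∫ x in cell d, ((u - v) (toTorus x) - ∫ y in cell d, (u - v) (toTorus y)) * W L x‖
      ≤ 2 * ‖u - v‖ * C := by
    refine (norm_integral_le_of_norm_le_const (C := 2 * ‖u - v‖ * C) ?_).trans (by simp)
    filter_upwards [ae_restrict_mem measurableSet_cell] with x hx
    rw [norm_mul]
    exact mul_le_mul (hnu _ x) (h3 x hx) (norm_nonneg _) (by positivity)
  rw [dist_eq_norm, lt_div_iff₀ (by positivity)] at huv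
  rw [h4]
  have h6 := norm_add_le (∫ x in cell d, (v (toTorus x) - ∫ y in cell d, v (toTorus y)) * W L x)
    (∫ x in cell d, ((u - v) (toTorus x) - ∫ y in cell d, (u - v) (toTorus y)) * W L x)
  nlinarith [norm_nonneg (u - v)]

/-- The tent function of height and radius `η` on the torus. -/
noncomputable def tent (d : ℕ) (η : ℝ) : C(UnitAddTorus (Fin d), ℂ) where
  toFun t := ((max 0 (η - ‖t‖) : ℝ) : ℂ)
  continuous_toFun := by fun_prop

lemma norm_le_of_tent_ne_zero {η : ℝ} {x : 𝔼 d} (hx : x ∈ cell d) (hη : 0 < η)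
    (h : max 0 (η - ‖toTorus x‖) ≠ 0) : ‖x‖ ≤ √d * η := by
  have h1 : ‖toTorus x‖ < η := by
    by_contra! h'
    exact h (max_eq_left (by linarith))
  refine norm_le_of_coord_le hη.le fun k => ?_
  have h2 := (norm_le_pi_norm (toTorus x) k).trans h1.le
  have h3 : ‖((x k : ℝ) : AddCircle (1 : ℝ))‖ = |x k| :=
    (AddCircle.norm_coe_eq_abs_iff 1 one_ne_zero).2 (by
      rw [abs_one, abs_le]; exact ⟨(hx k).1, (hx k).2.le⟩)
  rw [← h3]
  exact h2

lemma integral_tent_pos {η : ℝ} (hη : 0 < η) :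
    0 < ∫ x in cell d, max 0 (η - ‖toTorus x‖) := by
  have hc : Continuous fun x : 𝔼 d => max 0 (η - ‖toTorus x‖) := by
    have := continuous_toTorus (d := d)
    fun_prop
  have hi := integrable_of_continuous_of_isBounded hc (isBounded_cell (d := d))
  have hnn : (0 : 𝔼 d → ℝ) ≤ᵐ[volume.restrict (cell d)] fun x => max 0 (η - ‖toTorus x‖) :=
    ae_of_all _ fun x => le_max_left _ _
  rw [setIntegral_pos_iff_support_of_nonneg_ae hnn hi]
  have hopen : IsOpen ({x : 𝔼 d | ‖toTorus x‖ < η} ∩ {x | ∀ k, x k ∈ Set.Ioo (-(1 / 2) : ℝ) (1 / 2)}) := by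
    refine IsOpen.inter (isOpen_lt continuous_toTorus.norm continuous_const) ?_
    simp only [Set.ofPred_forall]
    exact isOpen_iInter_of_finite fun k => isOpen_Ioo.preimage (by fun_prop : Continuous fun x : 𝔼 d => x k)
  refine (hopen.measure_pos volume ⟨0, ?_, fun k => by simp⟩).trans_le (measure_mono ?_)
  · have : toTorus (0 : 𝔼 d) = 0 := by ext k; simp [toTorus]
    simpa [this] using hη
  · rintro x ⟨h1, h2⟩
    refine ⟨?_, fun k => ⟨(h2 k).1.le, (h2 k).2⟩⟩
    have h1' : ‖toTorus x‖ < η := h1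
    rw [Function.mem_support]
    exact (lt_max_of_lt_right (by linarith)).ne'

/-- The form of Weyl's criterion used below: densities which are nearly constant near the origin of
the unit cell have there nearly their mean value. -/
lemma eventually_norm_sub_mean_le {W : ℝ → 𝔼 d → ℂ} {C : ℝ}
    (hm : ∀ L, AEStronglyMeasurable (W L) (volume.restrict (cell d)))
    (hb : ∀ᶠ L in atTop, ∀ x ∈ cell d, ‖W L x‖ ≤ C)
    (hk : ∀ k : Fin d → ℤ, k ≠ 0 → Tendsto (fun L =>
      ∫ x in cell d, chi ((2 * Real.pi) • latticePoint k) x * W L x) atTop (𝓝 0))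
    {η : ℝ} (hη : 0 < η) {ε : ℝ} (hε : 0 < ε) :
    ∃ κ : 𝔼 d → ℝ, (∀ x, 0 ≤ κ x) ∧ IntegrableOn κ (cell d) ∧
      (∫ x in cell d, κ x = 1) ∧ (∀ x ∈ cell d, κ x ≠ 0 → ‖x‖ ≤ √d * η) ∧
      ∀ᶠ L in atTop, IntegrableOn (fun x => (κ x : ℂ) * W L x) (cell d) ∧
        ‖(∫ x in cell d, (κ x : ℂ) * W L x) - ∫ x in cell d, W L x‖ ≤ ε := by
  set I := ∫ x in cell d, max 0 (η - ‖toTorus x‖) with hI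
  have hI0 : 0 < I := integral_tent_pos hη
  have hc : Continuous fun x : 𝔼 d => max 0 (η - ‖toTorus x‖) := by
    have := continuous_toTorus (d := d)
    fun_prop
  have hi := integrable_of_continuous_of_isBounded hc (isBounded_cell (d := d))
  refine ⟨fun x => I⁻¹ * max 0 (η - ‖toTorus x‖),
    fun x => mul_nonneg (inv_nonneg.2 hI0.le) (le_max_left _ _), hi.const_mul _, ?_, ?_, ?_⟩
  · rw [integral_const_mul, ← hI, inv_mul_cancel₀ hI0.ne']
  · exact fun x hx h => norm_le_of_tent_ne_zero hx hη (right_ne_zero_of_mul h)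
  have h := tendsto_integral_cell_sub_mean hm hb hk (tent d η)
  have hmean : ∫ y in cell d, tent d η (toTorus y) = (I : ℂ) := by
    rw [hI, ← integral_complex_ofReal]; rfl
  rw [hmean] at h
  have hWi : ∀ᶠ L in atTop, IntegrableOn (W L) (cell d) := hb.mono fun L hL =>
    Integrable.of_bound (hm L) C ((ae_restrict_mem measurableSet_cell).mono hL)
  filter_upwards [Metric.tendsto_nhds.1 h (I * ε) (by positivity), hWi] with L hL hLi
  rw [dist_zero_right] at hL
  have hu : Continuous fun x : 𝔼 d => tent d η (toTorus x) :=
    (tent d η).continuous.comp continuous_toTorus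
  have hui : IntegrableOn (fun x : 𝔼 d => tent d η (toTorus x) * W L x) (cell d) :=
    hLi.bdd_mul (c := ‖tent d η‖) hu.aestronglyMeasurable
      (ae_of_all _ fun x => (tent d η).norm_coe_le_norm _)
  have heq : ∀ x : 𝔼 d, ((I⁻¹ * max 0 (η - ‖toTorus x‖) : ℝ) : ℂ) * W L x
      = (I : ℂ)⁻¹ * (tent d η (toTorus x) * W L x) := fun x => by
    simp only [tent, ContinuousMap.coe_mk]; push_cast; ring
  simp_rw [heq]
  refine ⟨hui.const_mul _, ?_⟩
  have hIc : (I : ℂ) ≠ 0 := by exact_mod_cast hI0.ne'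
  have h2 : ∫ x in cell d, (tent d η (toTorus x) - (I : ℂ)) * W L x
      = (∫ x in cell d, tent d η (toTorus x) * W L x) - I * ∫ x in cell d, W L x := by
    rw [← integral_const_mul, ← integral_sub hui (hLi.const_mul _)]
    simp_rw [sub_mul]
  have h3 : (∫ x in cell d, (I : ℂ)⁻¹ * (tent d η (toTorus x) * W L x)) - ∫ x in cell d, W L x
      = (I : ℂ)⁻¹ * ∫ x in cell d, (tent d η (toTorus x) - (I : ℂ)) * W L x := by
    rw [h2, integral_const_mul, mul_sub, ← mul_assoc, inv_mul_cancel₀ hIc, one_mul]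
  rw [h3, norm_mul, norm_inv, Complex.norm_real, Real.norm_eq_abs, abs_of_pos hI0,
    inv_mul_le_iff₀ hI0]
  exact hL.le

/-- The Fourier transform of the ball at the translates of `θ` by `2π ℤ^d` are the Fourier
coefficients in `x` of the exponential sum over the lattice ball centred at `-x`. -/
lemma integral_cell_chi_mul_shiftedSum (L : ℝ) (θ : 𝔼 d) (k : Fin d → ℤ) :
    ∫ x in cell d, chi ((2 * Real.pi) • latticePoint k) x * (chi θ x * shiftedSum L x θ)
      = ballFT L (θ + (2 * Real.pi) • latticePoint k) := by
  rw [ballFT, setIntegral_closedBall_eq_integral_cell (by fun_prop)]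
  refine integral_congr_ae (ae_of_all _ fun x => ?_)
  simp only [shiftedSum, Finset.mul_sum]
  refine Finset.sum_congr rfl fun j _ => ?_
  split_ifs
  · have h1 : chi ((2 * Real.pi) • latticePoint k) (latticePoint j) = 1 := by
      rw [← mFourier_toTorus]
      have : toTorus (latticePoint j) = 0 := by
        ext i
        simp only [toTorus, latticePoint_apply, Pi.zero_apply]
        exact (AddCircle.coe_eq_zero_iff 1).2 ⟨j i, by simp⟩
      rw [this]
      simp [UnitAddTorus.mFourier]
    rw [chi_add_left, chi_add, chi_add, h1]
    ring
  · simp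

/-! ### Lattice points in thin shells -/

lemma aestronglyMeasurable_shiftedSum (L : ℝ) (θ : 𝔼 d) :
    AEStronglyMeasurable (fun x => chi θ x * shiftedSum L x θ) (volume.restrict (cell d)) :=
  (by fun_prop : Continuous fun x => chi θ x).aestronglyMeasurable.mul ((measurable_shiftedSum L).comp
    (by fun_prop : Measurable fun x => (x, θ))).aestronglyMeasurable

lemma integrableOn_chi_mul_shiftedSum (L : ℝ) (ξ θ : 𝔼 d) :
    IntegrableOn (fun x => chi ξ x * (chi θ x * shiftedSum L x θ)) (cell d) := by
  refine Integrable.of_bound ((by fun_prop : Continuous fun x => chi ξ x).aestronglyMeasurable.mul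
    (aestronglyMeasurable_shiftedSum L θ)) (ballPoints (0 : 𝔼 d) (L + √d)).card
    (ae_of_all _ fun x => ?_)
  rw [norm_mul, norm_mul, norm_chi, norm_chi, one_mul, one_mul]
  exact norm_shiftedSum_le L x θ

/-- At frequency zero the exponential sum counts points. -/
lemma shiftedSum_zero {L : ℝ} {x : 𝔼 d} (hx : x ∈ cell d) :
    shiftedSum L x 0 = ((ballPoints x L).card : ℂ) := by
  rw [shiftedSum_eq (norm_le_of_mem_cell hx), latticeSum]
  simp [chi_zero_left]

lemma ballFT_zero (L : ℝ) : ballFT L (0 : 𝔼 d) = (volume.real (Metric.closedBall (0 : 𝔼 d) L) : ℂ) := by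
  rw [ballFT]
  simp [chi_zero_left]

lemma ballPoints_mono (x : 𝔼 d) {r s : ℝ} (h : r ≤ s) : ballPoints x r ⊆ ballPoints x s :=
  fun j hj => by
    rw [mem_ballPoints] at hj ⊢
    exact hj.trans h

lemma norm_freq_pos {k : Fin d → ℤ} (hk : k ≠ 0) : 0 < ‖(2 * Real.pi) • latticePoint k‖ := by
  rw [norm_pos_iff]
  intro h
  refine hk (funext fun i => ?_)
  have h1 := congrArg (fun x : 𝔼 d => x i) h
  have := Real.pi_ne_zero
  simpa [latticePoint_apply, this] using h1

/-- Away from the origin the Fourier transform of the ball is `O(L^{n/2})`, which for `n ≥ 1` is of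
smaller order than the surface area. -/
lemma tendsto_ballFT_div (hn : 1 ≤ n) {ξ : 𝔼 (n + 1)} (hξ : 0 < ‖ξ‖) (b : ℝ) :
    Tendsto (fun L : ℝ => ((L : ℂ) ^ n)⁻¹ * ballFT (L + b) ξ) atTop (𝓝 0) := by
  obtain ⟨A, hA, hb⟩ := exists_ballFTReal_bound n
  set D : ℝ := A * (2 ^ n / ‖ξ‖ ^ (n + 2)) with hD
  have hD0 : 0 ≤ D := by positivity
  have h1 : Tendsto (fun L : ℝ => √(D * (L ^ n)⁻¹)) atTop (𝓝 0) := by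
    have h2 : Tendsto (fun L : ℝ => D * (L ^ n)⁻¹) atTop (𝓝 (D * 0)) :=
      (tendsto_inv_atTop_zero.comp (tendsto_pow_atTop (by omega))).const_mul D
    have h3 := (Real.continuous_sqrt.tendsto _).comp h2
    rw [mul_zero, Real.sqrt_zero] at h3
    exact h3
  refine squeeze_zero_norm' ?_ h1
  filter_upwards [eventually_gt_atTop (|b| + 1)] with L hL
  have hb1 := abs_le.1 (le_refl |b|)
  have hb0 := abs_nonneg b
  have hL0 : 0 < L := by linarith
  have hLb : 0 < L + b := by linarith
  refine Real.le_sqrt_of_sq_le ?_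
  rw [ballFT_eq_real hLb, norm_mul, norm_inv, norm_pow, Complex.norm_real, Complex.norm_real,
    mul_pow, Real.norm_eq_abs, Real.norm_eq_abs, abs_of_pos hL0, sq_abs]
  have h4 := (hb (L + b) hLb).2 ‖ξ‖ hξ
  have h5 : (L + b) ^ n ≤ (2 * L) ^ n := by
    gcongr
    linarith
  have h6 : ballFTReal n (L + b) ‖ξ‖ ^ 2 ≤ D * L ^ n := by
    refine h4.trans ?_
    rw [hD, mul_assoc, div_mul_eq_mul_div, ← mul_pow]
    gcongr
  calc ((L ^ n)⁻¹) ^ 2 * ballFTReal n (L + b) ‖ξ‖ ^ 2 ≤ ((L ^ n)⁻¹) ^ 2 * (D * L ^ n) := by gcongr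
    _ = D * (L ^ n)⁻¹ := by field_simp

/-- In dimension at least two, thin shells of radius `L` and width `η` contain `O(η L^{d-1})`
lattice points once `L` is large. -/
lemma exists_card_shellPoints_le_mul (hn : 1 ≤ n) : ∃ C : ℝ, 0 < C ∧ ∀ η : ℝ, 0 < η →
    ∀ᶠ L : ℝ in atTop, ((shellPoints (n + 1) L η).card : ℝ) ≤ C * η * L ^ n := by
  have hV := unitBallVolume_pos (n + 1)
  have hsq : 0 ≤ √(n + 1 : ℕ) := Real.sqrt_nonneg _
  set s : ℝ := √(n + 1 : ℕ) with hs
  set C₁ : ℝ := 2 * (n + 1) * 2 ^ n * unitBallVolume (n + 1) with hC₁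
  have hC₁0 : 0 < C₁ := by positivity
  refine ⟨C₁ * (2 + s) + 1, by positivity, fun η hη => ?_⟩
  -- A shell of half-width `b` contains, after any translation by `x` with `‖x‖ ≤ s η`, the shell of
  -- half-width `η`; its translates are equidistributed.
  set b : ℝ := (2 + s) * η with hb
  have hb0 : 0 < b := by positivity
  obtain ⟨C₂, hC₂, hcard⟩ := card_shellPoints_le n (a := b + s) (by positivity)
  set W : ℝ → 𝔼 (n + 1) → ℂ := fun L x => ((L : ℂ) ^ n)⁻¹ *
    (chi 0 x * shiftedSum (L + b) x 0 - chi 0 x * shiftedSum (L + -b) x 0) with hW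
  have hWeq : ∀ (L : ℝ) (x : 𝔼 (n + 1)), x ∈ cell (n + 1) →
      W L x = (((L ^ n)⁻¹ * (ballPoints x (L + b) \ ballPoints x (L + -b)).card : ℝ) : ℂ) := by
    intro L x hx
    simp only [hW]
    rw [shiftedSum_zero hx, shiftedSum_zero hx, chi_zero_left, one_mul, one_mul]
    have h1 := Finset.card_sdiff_add_card_eq_card (ballPoints_mono x (by linarith : L + -b ≤ L + b))
    rw [← h1]
    push_cast
    ring
  have hm : ∀ L, AEStronglyMeasurable (W L) (volume.restrict (cell (n + 1))) := fun L =>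
    ((aestronglyMeasurable_shiftedSum _ _).sub (aestronglyMeasurable_shiftedSum _ _)).const_mul _
  have hbd : ∀ᶠ L in atTop, ∀ x ∈ cell (n + 1), ‖W L x‖ ≤ C₂ := by
    filter_upwards [eventually_ge_atTop (b + s + s), eventually_gt_atTop 0] with L hL hL0 x hx
    rw [hWeq L x hx, Complex.norm_real, Real.norm_eq_abs, abs_of_nonneg (by positivity),
      inv_mul_le_iff₀ (by positivity)]
    refine le_trans ?_ ((hcard L hL).trans (le_of_eq (mul_comm _ _)))
    rw [Nat.cast_le]
    refine Finset.card_le_card fun j hj => ?_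
    rw [Finset.mem_sdiff, mem_ballPoints, mem_ballPoints, not_le] at hj
    rw [mem_shellPoints, abs_le]
    have hxs : ‖x‖ ≤ s := norm_le_of_mem_cell hx
    have h1 := norm_sub_le (latticePoint j + x) x
    have h2 := norm_add_le (latticePoint j) x
    rw [add_sub_cancel_right] at h1
    constructor <;> linarith [hj.1, hj.2]
  have hcoef : ∀ (L : ℝ) (k : Fin (n + 1) → ℤ),
      ∫ x in cell (n + 1), chi ((2 * Real.pi) • latticePoint k) x * W L x
        = ((L : ℂ) ^ n)⁻¹ * ballFT (L + b) (0 + (2 * Real.pi) • latticePoint k)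
          - ((L : ℂ) ^ n)⁻¹ * ballFT (L + -b) (0 + (2 * Real.pi) • latticePoint k) := fun L k => by
    rw [← integral_cell_chi_mul_shiftedSum, ← integral_cell_chi_mul_shiftedSum, ← mul_sub,
      ← integral_sub (integrableOn_chi_mul_shiftedSum _ _ _) (integrableOn_chi_mul_shiftedSum _ _ _),
      ← integral_const_mul]
    refine integral_congr_ae (ae_of_all _ fun x => ?_)
    simp only [hW]
    ring
  have hk : ∀ k : Fin (n + 1) → ℤ, k ≠ 0 → Tendsto (fun L =>
      ∫ x in cell (n + 1), chi ((2 * Real.pi) • latticePoint k) x * W L x) atTop (𝓝 0) := by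
    intro k hk
    simp_rw [hcoef, zero_add]
    have := (tendsto_ballFT_div hn (norm_freq_pos hk) b).sub (tendsto_ballFT_div hn (norm_freq_pos hk) (-b))
    rwa [sub_zero] at this
  obtain ⟨κ, hκ0, hκi, hκ1, hκs, hev⟩ := eventually_norm_sub_mean_le hm hbd hk hη hη
  filter_upwards [hev, eventually_gt_atTop b] with L ⟨hL1, hL⟩ hLb
  have hL0 : 0 < L := hb0.trans hLb
  set N : ℝ := ((shellPoints (n + 1) L η).card : ℝ) with hN
  have hmean : ‖∫ x in cell (n + 1), W L x‖ ≤ C₁ * b := by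
    have h0 := hcoef L 0
    simp only [latticePoint_zero, smul_zero, chi_zero_left, one_mul, add_zero] at h0
    rw [h0, ← mul_sub, ballFT_zero, ballFT_zero, ← Complex.ofReal_sub, norm_mul, norm_inv, norm_pow,
      Complex.norm_real, Complex.norm_real, Real.norm_eq_abs, abs_of_pos hL0,
      inv_mul_le_iff₀ (by positivity)]
    have hsub : Metric.closedBall (0 : 𝔼 (n + 1)) (L + -b) ⊆ Metric.closedBall 0 (L + b) :=
      Metric.closedBall_subset_closedBall (by linarith)
    rw [← measureReal_sdiff hsub Metric.isClosed_closedBall.measurableSet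
      measure_closedBall_lt_top.ne, Real.norm_eq_abs, abs_of_nonneg measureReal_nonneg]
    refine (measureReal_mono (fun y hy => ?_) (isBounded_shell _ _).measure_lt_top.ne).trans
      ((volume_real_shell_le hb0.le hLb.le).trans (le_of_eq (by ring)))
    rw [Set.mem_sdiff, mem_closedBall_zero_iff, mem_closedBall_zero_iff, not_le] at hy
    rw [mem_shell, abs_le]
    constructor <;> linarith [hy.1, hy.2]
  have hlow : (L ^ n)⁻¹ * N ≤ (∫ x in cell (n + 1), (κ x : ℂ) * W L x).re := by
    have h1 : ∫ x in cell (n + 1), κ x * ((L ^ n)⁻¹ * N) = (L ^ n)⁻¹ * N := by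
      rw [integral_mul_const, hκ1, one_mul]
    rw [← h1, ← Complex.reCLM_apply, ← Complex.reCLM.integral_comp_comm hL1]
    refine setIntegral_mono_on (hκi.mul_const _) (Complex.reCLM.integrable_comp hL1) measurableSet_cell
      fun x hx => ?_
    rw [Complex.reCLM_apply, Complex.re_ofReal_mul, hWeq L x hx, Complex.ofReal_re]
    by_cases hx0 : κ x = 0
    · simp [hx0]
    have hxη := hκs x hx hx0
    refine mul_le_mul_of_nonneg_left (mul_le_mul_of_nonneg_left ?_ (by positivity)) (hκ0 x)
    rw [hN, Nat.cast_le]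
    refine Finset.card_le_card fun j hj => ?_
    rw [mem_shellPoints, abs_le] at hj
    rw [Finset.mem_sdiff, mem_ballPoints, mem_ballPoints, not_le]
    have h1 := norm_sub_le (latticePoint j + x) x
    have h2 := norm_add_le (latticePoint j) x
    rw [add_sub_cancel_right] at h1
    have h3 : b = 2 * η + s * η := by rw [hb]; ring
    constructor <;> linarith [hj.1, hj.2]
  have h1 := Complex.re_le_norm (∫ x in cell (n + 1), (κ x : ℂ) * W L x)
  have h2 := norm_le_norm_sub_add (∫ x in cell (n + 1), (κ x : ℂ) * W L x) (∫ x in cell (n + 1), W L x)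
  have h3 : (L ^ n)⁻¹ * N ≤ C₁ * b + η := by linarith
  rw [inv_mul_le_iff₀ (by positivity)] at h3
  refine h3.trans (le_of_eq ?_)
  rw [hb]; ring

/-! ### Correlations of the Fourier transform of the ball -/

lemma tendsto_integral_exp_norm_add (hn : 1 ≤ n) {g : 𝔼 (n + 1) → ℂ} (hg : Integrable g)
    {p : 𝔼 (n + 1)} (hp : p ≠ 0) {σ : ℝ} (hσ : |σ| = 1) :
    Tendsto (fun L : ℝ => ∫ θ, g θ * Complex.exp (L * (‖θ‖ + σ * ‖θ + p‖ : ℝ) * Complex.I))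
      atTop (𝓝 0) := by
  refine tendsto_integral_exp_of_ray hg (by fun_prop) ?_
  filter_upwards [ae_sphere_notMem_span hn p] with ω hω
  exact exists_deriv_ray_pos (norm_eq_of_mem_sphere ω) hω hσ hp

lemma tendsto_integral_exp_two_norm {g : 𝔼 (n + 1) → ℂ} (hg : Integrable g) :
    Tendsto (fun L : ℝ => ∫ θ, g θ * Complex.exp (L * (‖θ‖ + ‖θ‖ : ℝ) * Complex.I))
      atTop (𝓝 0) := by
  refine tendsto_integral_exp_of_ray hg (by fun_prop) (ae_of_all _ fun ω => ⟨fun _ => 1 + 1, fun r hr => ?_⟩)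
  have h1 : HasDerivAt (fun r : ℝ => ‖r • (ω : 𝔼 (n + 1))‖) 1 r := by
    have : HasDerivAt (fun r : ℝ => r) 1 r := hasDerivAt_id r
    refine this.congr_of_eventuallyEq ?_
    filter_upwards [lt_mem_nhds hr] with s hs
    rw [norm_smul, norm_eq_of_mem_sphere, mul_one, Real.norm_eq_abs, abs_of_pos hs]
  exact ⟨h1.add h1, by norm_num⟩

lemma re_mul_exp_mul_re_mul_exp (z : ℂ) (s t : ℝ) :
    (z * Complex.exp (s * Complex.I)).re * (z * Complex.exp (t * Complex.I)).re
      = ((z ^ 2 / 2) * Complex.exp ((s + 1 * t : ℝ) * Complex.I)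
        + (‖z‖ ^ 2 / 2 : ℝ) * Complex.exp ((s + -1 * t : ℝ) * Complex.I)).re := by
  have h1 : Complex.exp ((s + 1 * t : ℝ) * Complex.I)
      = Complex.exp (s * Complex.I) * Complex.exp (t * Complex.I) := by
    rw [← Complex.exp_add]; congr 1; push_cast; ring
  have h2 : Complex.exp ((s + -1 * t : ℝ) * Complex.I)
      = Complex.exp (s * Complex.I) * (starRingEnd ℂ) (Complex.exp (t * Complex.I)) := by
    rw [← Complex.exp_conj, ← Complex.exp_add]; congr 1; simp; ring
  have h3 : ((‖z‖ ^ 2 / 2 : ℝ) : ℂ) = z * (starRingEnd ℂ) z / 2 := by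
    rw [Complex.mul_conj, Complex.normSq_eq_norm_sq]; push_cast; ring
  rw [h1, h2, h3]
  set a := Complex.exp (s * Complex.I)
  set b := Complex.exp (t * Complex.I)
  have h4 : z ^ 2 / 2 * (a * b) + z * (starRingEnd ℂ) z / 2 * (a * (starRingEnd ℂ) b)
      = z * a * ((z * b + (starRingEnd ℂ) (z * b)) / 2) := by rw [map_mul]; ring
  have h5 : ((2 * (z * b).re : ℝ) : ℂ) / 2 = (((z * b).re : ℝ) : ℂ) := by push_cast; ring
  rw [h4, Complex.add_conj, h5, Complex.re_mul_ofReal]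

/-- Products of two profiles average to zero, unless their phases agree. -/
lemma tendsto_integral_profile_mul (hn : 1 ≤ n) {z : ℂ} {C : ℝ} (hC : 0 < C)
    (hz : ∀ s ≥ 1, |normalizedProfile n s - (z * Complex.exp (s * Complex.I)).re| ≤ C / s)
    {g : 𝔼 (n + 1) → ℝ} (hg : Integrable g) (p : 𝔼 (n + 1)) {a : ℝ} (ha : 0 < a)
    (hsupp : ∀ θ, g θ ≠ 0 → a ≤ ‖θ‖ ∧ a ≤ ‖θ + p‖) :
    Tendsto (fun L : ℝ => ∫ θ, g θ * (normalizedProfile n (L * ‖θ‖) * normalizedProfile n (L * ‖θ + p‖)))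
      atTop (𝓝 (if p = 0 then ‖z‖ ^ 2 / 2 * ∫ θ, g θ else 0)) := by
  obtain ⟨H, hH, hHb⟩ := exists_normalizedProfile_bound n
  have hhc := continuous_normalizedProfile (n := n)
  have hgc : Integrable (fun θ => (g θ : ℂ)) := hg.ofReal
  set E : ℝ → ℝ → 𝔼 (n + 1) → ℂ := fun σ L θ =>
    Complex.exp (L * (‖θ‖ + σ * ‖θ + p‖ : ℝ) * Complex.I) with hE
  have hEn : ∀ σ L θ, ‖E σ L θ‖ = 1 := fun σ L θ => by
    simp only [hE]; rw [← Complex.ofReal_mul, Complex.norm_exp_ofReal_mul_I]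
  have hEc : ∀ σ L, Continuous (E σ L) := fun σ L => by simp only [hE]; fun_prop
  have hEi : ∀ σ L, Integrable fun θ => (g θ : ℂ) * E σ L θ := fun σ L =>
    hgc.mul_bdd (c := 1) (hEc σ L).aestronglyMeasurable (ae_of_all _ fun θ => (hEn σ L θ).le)
  -- `T` is the integral with both profiles replaced by their asymptotics, split into the phases with
  -- sum and difference of the two norms; only the difference can be constant, namely if `p = 0`
  set T : ℝ → ℝ := fun L => ((z ^ 2 / 2) * (∫ θ, (g θ : ℂ) * E 1 L θ)
    + (‖z‖ ^ 2 / 2 : ℝ) * ∫ θ, (g θ : ℂ) * E (-1) L θ).re with hT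
  have hTeq : ∀ L : ℝ, T L = ∫ θ, g θ * ((z * Complex.exp ((L * ‖θ‖ : ℝ) * Complex.I)).re
      * (z * Complex.exp ((L * ‖θ + p‖ : ℝ) * Complex.I)).re) := fun L => by
    have h1 : Integrable (fun θ => (z ^ 2 / 2) * ((g θ : ℂ) * E 1 L θ)
        + (‖z‖ ^ 2 / 2 : ℝ) * ((g θ : ℂ) * E (-1) L θ)) :=
      ((hEi 1 L).const_mul _).add ((hEi (-1) L).const_mul _)
    have h2 : (∫ θ, ((z ^ 2 / 2) * ((g θ : ℂ) * E 1 L θ)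
        + (‖z‖ ^ 2 / 2 : ℝ) * ((g θ : ℂ) * E (-1) L θ)))
        = (z ^ 2 / 2) * (∫ θ, (g θ : ℂ) * E 1 L θ)
          + (‖z‖ ^ 2 / 2 : ℝ) * ∫ θ, (g θ : ℂ) * E (-1) L θ := by
      refine (integral_add ((hEi 1 L).const_mul _) ((hEi (-1) L).const_mul _)).trans ?_
      rw [integral_const_mul, integral_const_mul]
    simp only [hT]
    rw [← h2, ← Complex.reCLM_apply, ← Complex.reCLM.integral_comp_comm h1]
    refine integral_congr_ae (ae_of_all _ fun θ => ?_)
    simp only [Complex.reCLM_apply]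
    rw [re_mul_exp_mul_re_mul_exp, ← Complex.re_ofReal_mul]
    congr 1
    simp only [hE]
    have h3 : ∀ σ : ℝ, ((L : ℂ) * (‖θ‖ + σ * ‖θ + p‖ : ℝ)) = ((L * ‖θ‖ + σ * (L * ‖θ + p‖) : ℝ) : ℂ) :=
      fun σ => by push_cast; ring
    rw [h3, h3]
    ring
  have hTlim : Tendsto T atTop (𝓝 (if p = 0 then ‖z‖ ^ 2 / 2 * ∫ θ, g θ else 0)) := by
    have hlim : Tendsto (fun L => (z ^ 2 / 2) * (∫ θ, (g θ : ℂ) * E 1 L θ)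
        + (‖z‖ ^ 2 / 2 : ℝ) * ∫ θ, (g θ : ℂ) * E (-1) L θ) atTop
        (𝓝 ((z ^ 2 / 2) * 0 + (‖z‖ ^ 2 / 2 : ℝ) * (if p = 0 then ((∫ θ, g θ : ℝ) : ℂ) else 0))) := by
      split_ifs with hp
      · subst hp
        refine Tendsto.add (Tendsto.const_mul _ ?_) (Tendsto.const_mul _ ?_)
        · refine (tendsto_integral_exp_two_norm hgc).congr fun L => ?_
          simp only [hE, add_zero, one_mul]
        · refine tendsto_const_nhds.congr fun L => ?_
          rw [← integral_complex_ofReal]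
          refine integral_congr_ae (ae_of_all _ fun θ => ?_)
          simp [hE]
      · refine Tendsto.add (Tendsto.const_mul _ ?_) (Tendsto.const_mul _ ?_)
        · exact tendsto_integral_exp_norm_add hn hgc hp (by simp)
        · exact tendsto_integral_exp_norm_add hn hgc hp (by simp)
    have := (Complex.continuous_re.tendsto _).comp hlim
    refine this.trans_eq ?_
    congr 1
    split_ifs
    · rw [mul_zero, zero_add, ← Complex.ofReal_mul, Complex.ofReal_re]
    · simp
  have hdiff : Tendsto (fun L : ℝ => (∫ θ, g θ * (normalizedProfile n (L * ‖θ‖)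
      * normalizedProfile n (L * ‖θ + p‖))) - T L) atTop (𝓝 0) := by
    have h0 : Tendsto (fun L : ℝ => (C / a * (H + ‖z‖) * ∫ θ, |g θ|) * L⁻¹) atTop (𝓝 0) := by
      have := tendsto_inv_atTop_zero.const_mul (C / a * (H + ‖z‖) * ∫ θ, |g θ|)
      rwa [mul_zero] at this
    refine squeeze_zero_norm' ?_ h0
    filter_upwards [eventually_ge_atTop (1 / a)] with L hL
    have hL0 : 0 < L := lt_of_lt_of_le (by positivity) hL
    have hRz : ∀ s : ℝ, |(z * Complex.exp (s * Complex.I)).re| ≤ ‖z‖ := fun s => by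
      refine (Complex.abs_re_le_norm _).trans ?_
      rw [norm_mul, Complex.norm_exp_ofReal_mul_I, mul_one]
    have hi1 : Integrable fun θ => g θ * (normalizedProfile n (L * ‖θ‖) * normalizedProfile n (L * ‖θ + p‖)) := by
      refine hg.mul_bdd (c := H * H) (by fun_prop : Continuous fun θ : 𝔼 (n + 1) =>
        normalizedProfile n (L * ‖θ‖) * normalizedProfile n (L * ‖θ + p‖)).aestronglyMeasurable
        (ae_of_all _ fun θ => ?_)
      rw [norm_mul]
      exact mul_le_mul (hHb _ (by positivity)) (hHb _ (by positivity)) (norm_nonneg _) hH.le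
    have hi2 : Integrable fun θ => g θ * ((z * Complex.exp ((L * ‖θ‖ : ℝ) * Complex.I)).re
      * (z * Complex.exp ((L * ‖θ + p‖ : ℝ) * Complex.I)).re) := by
      refine hg.mul_bdd (c := ‖z‖ * ‖z‖) (by fun_prop : Continuous fun θ : 𝔼 (n + 1) =>
        (z * Complex.exp ((L * ‖θ‖ : ℝ) * Complex.I)).re
      * (z * Complex.exp ((L * ‖θ + p‖ : ℝ) * Complex.I)).re).aestronglyMeasurable
        (ae_of_all _ fun θ => ?_)
      rw [norm_mul]
      exact mul_le_mul (hRz _) (hRz _) (norm_nonneg _) (norm_nonneg _)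
    rw [hTeq, ← integral_sub hi1 hi2, mul_right_comm, ← integral_const_mul]
    refine norm_integral_le_of_norm_le (hg.abs.const_mul _) (ae_of_all _ fun θ => ?_)
    by_cases hgθ : g θ = 0
    · simp [hgθ]
    obtain ⟨h1, h2⟩ := hsupp θ hgθ
    have hstep : ∀ r : ℝ, a ≤ r → |normalizedProfile n (L * r) - (z * Complex.exp ((L * r : ℝ) * Complex.I)).re|
        ≤ C / a * L⁻¹ := fun r hr => by
      have h3 : 1 ≤ L * r := by
        rw [div_le_iff₀ ha] at hL
        exact hL.trans (mul_le_mul_of_nonneg_left hr hL0.le)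
      refine (hz _ h3).trans ?_
      calc C / (L * r) ≤ C / (L * a) := by gcongr
        _ = C / a * L⁻¹ := by field_simp
    have e1 := hstep _ h1
    have e2 := hstep _ h2
    have e3 := hHb (L * ‖θ + p‖) (by positivity)
    have e4 := hRz (L * ‖θ‖)
    rw [← mul_sub, norm_mul, Real.norm_eq_abs, Real.norm_eq_abs, mul_comm |g θ|]
    refine mul_le_mul_of_nonneg_right ?_ (abs_nonneg _)
    set A1 := normalizedProfile n (L * ‖θ‖)
    set A2 := normalizedProfile n (L * ‖θ + p‖)
    set B1 := (z * Complex.exp ((L * ‖θ‖ : ℝ) * Complex.I)).re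
    set B2 := (z * Complex.exp ((L * ‖θ + p‖ : ℝ) * Complex.I)).re
    have hpos : 0 ≤ C / a * L⁻¹ := by positivity
    calc |A1 * A2 - B1 * B2| = |(A1 - B1) * A2 + B1 * (A2 - B2)| := by congr 1; ring
      _ ≤ |(A1 - B1) * A2| + |B1 * (A2 - B2)| := abs_add_le _ _
      _ = |A1 - B1| * |A2| + |B1| * |A2 - B2| := by rw [abs_mul, abs_mul]
      _ ≤ (C / a * L⁻¹) * H + ‖z‖ * (C / a * L⁻¹) :=
          add_le_add (mul_le_mul e1 e3 (abs_nonneg _) hpos) (mul_le_mul e4 e2 (abs_nonneg _) (norm_nonneg _))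
      _ = _ := by ring
  have := hdiff.add hTlim
  rw [zero_add] at this
  exact this.congr fun L => by ring

/-- The frequency cube has distance at least `π` from the other points of `2π ℤ^d`. -/
lemma pi_le_norm_add_freq {θ : 𝔼 d} (hθ : θ ∈ freqCube d) {k : Fin d → ℤ} (hk : k ≠ 0) :
    Real.pi ≤ ‖θ + (2 * Real.pi) • latticePoint k‖ := by
  obtain ⟨i, hi⟩ : ∃ i, k i ≠ 0 := by
    by_contra! h; exact hk (funext h)
  refine le_trans ?_ (PiLp.norm_apply_le (θ + (2 * Real.pi) • latticePoint k) i)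
  have h1 := hθ i
  have h2 : (1 : ℝ) ≤ |(k i : ℝ)| := by exact_mod_cast Int.one_le_abs hi
  have hpi := Real.pi_pos
  rw [PiLp.add_apply, PiLp.smul_apply, latticePoint_apply, smul_eq_mul, Real.norm_eq_abs]
  have h3 : |2 * Real.pi * (k i : ℝ)| = 2 * Real.pi * |(k i : ℝ)| := by
    rw [abs_mul, abs_of_pos (by positivity)]
  have h4 : |θ i| ≤ Real.pi := abs_le.2 h1
  have h5 := abs_sub_abs_le_abs_sub (2 * Real.pi * (k i : ℝ)) (-θ i)
  rw [abs_neg, sub_neg_eq_add, add_comm] at h5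
  nlinarith

/-- A weight which vanishes outside the frequency cube and within distance `δ` of the origin, where
the normalized profile has not yet reached its asymptotic regime. -/
structure IsPuncturedWeight (f : 𝔼 d → ℝ) (M δ : ℝ) : Prop extends IsWeight f M where
  radius_pos : 0 < δ
  mem_freqCube : ∀ θ, f θ ≠ 0 → θ ∈ freqCube d
  le_norm : ∀ θ, f θ ≠ 0 → δ ≤ ‖θ‖

/-- The density `L^{-n} f(θ) b_L(θ) b_L(θ + 2π k)` is a fixed function times a product of two
normalized profiles. -/
lemma IsPuncturedWeight.mul_ballFTReal_mul {f : 𝔼 (n + 1) → ℝ} {M δ L : ℝ}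
    (hf : IsPuncturedWeight f M δ) (hL : 0 < L) {p θ : 𝔼 (n + 1)} (hp : f θ ≠ 0 → 0 < ‖θ + p‖) :
    (L ^ n)⁻¹ * (f θ * ballFTReal n L ‖θ‖ * ballFTReal n L ‖θ + p‖)
      = (f θ * (unitBallVolume n ^ 2 * (‖θ‖ ^ (-(((n : ℝ) + 2) / 2)) * ‖θ + p‖ ^ (-(((n : ℝ) + 2) / 2)))))
        * (normalizedProfile n (L * ‖θ‖) * normalizedProfile n (L * ‖θ + p‖)) := by
  by_cases h0 : f θ = 0
  · simp [h0]
  rw [ballFTReal_eq hL (hf.radius_pos.trans_le (hf.le_norm θ h0)), ballFTReal_eq hL (hp h0)]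
  have h1 : L ^ n = L ^ ((n : ℝ) / 2) * L ^ ((n : ℝ) / 2) := by
    rw [← Real.rpow_add hL, add_halves, Real.rpow_natCast]
  have h2 : L ^ ((n : ℝ) / 2) ≠ 0 := (Real.rpow_pos_of_pos hL _).ne'
  rw [h1]
  field_simp

/-- The correlations of the Fourier transform of the ball at points differing by a nonzero element
of `2π ℤ^d` are negligible. -/
lemma IsPuncturedWeight.exists_tendsto_correlation (hn : 1 ≤ n) {f : 𝔼 (n + 1) → ℝ} {M δ : ℝ}
    (hf : IsPuncturedWeight f M δ) (hpos : 0 < ∫ θ in freqCube (n + 1), f θ) :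
    ∃ w : ℝ, 0 < w ∧ ∀ k : Fin (n + 1) → ℤ, Tendsto (fun L : ℝ => ((L : ℂ) ^ n)⁻¹ *
      ∫ θ in freqCube (n + 1), ((f θ * ballFTReal n L ‖θ‖ : ℝ) : ℂ)
        * ballFT L (θ + (2 * Real.pi) • latticePoint k)) atTop (𝓝 (if k = 0 then (w : ℂ) else 0)) := by
  obtain ⟨z, C, hz0, hC, hz⟩ := exists_normalizedProfile_asymptotic n
  have hV := unitBallVolume_pos n
  have hδ := hf.radius_pos
  have hpi := Real.pi_pos
  have hM := hf.bound_nonneg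
  set e : ℝ := -(((n : ℝ) + 2) / 2) with he
  have he0 : e ≤ 0 := by rw [he]; have : (0 : ℝ) ≤ n := Nat.cast_nonneg n; linarith
  set a : ℝ := min δ Real.pi with ha
  have ha0 : 0 < a := lt_min hδ hpi
  set g : 𝔼 (n + 1) → 𝔼 (n + 1) → ℝ := fun p θ =>
    f θ * (unitBallVolume n ^ 2 * (‖θ‖ ^ e * ‖θ + p‖ ^ e)) with hg
  have hga : ∀ (k : Fin (n + 1) → ℤ) θ, f θ ≠ 0 →
      a ≤ ‖θ‖ ∧ a ≤ ‖θ + (2 * Real.pi) • latticePoint k‖ := fun k θ h => by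
    have h1 : a ≤ ‖θ‖ := (min_le_left _ _).trans (hf.le_norm θ h)
    refine ⟨h1, ?_⟩
    by_cases hk : k = 0
    · simpa [hk, latticePoint_zero] using h1
    · exact (min_le_right _ _).trans (pi_le_norm_add_freq (hf.mem_freqCube θ h) hk)
  have hgi : ∀ k : Fin (n + 1) → ℤ, Integrable (g ((2 * Real.pi) • latticePoint k)) := fun k => by
    have hm : Measurable (g ((2 * Real.pi) • latticePoint k)) := by
      have := hf.measurable
      simp only [hg]
      fun_prop
    have h1 : IntegrableOn (g ((2 * Real.pi) • latticePoint k)) (freqCube (n + 1)) := by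
      refine Integrable.of_bound hm.aestronglyMeasurable (M * (unitBallVolume n ^ 2 * (a ^ e * a ^ e)))
        (ae_of_all _ fun θ => ?_)
      by_cases h0 : f θ = 0
      · simp only [hg, h0, zero_mul, norm_zero]
        have : 0 < a ^ e := Real.rpow_pos_of_pos ha0 _
        positivity
      · obtain ⟨h1, h2⟩ := hga k θ h0
        have h3 : ∀ r : ℝ, a ≤ r → r ^ e ≤ a ^ e := fun r hr =>
          Real.rpow_le_rpow_of_nonpos ha0 hr he0
        have h4 : ∀ r : ℝ, a ≤ r → 0 < r ^ e := fun r hr => Real.rpow_pos_of_pos (ha0.trans_le hr) _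
        have e1 := h4 _ h1
        have e2 := h4 _ h2
        have e3 := hf.nonneg θ
        rw [Real.norm_eq_abs, abs_of_nonneg (by simp only [hg]; positivity)]
        simp only [hg]
        have e4 := h3 _ h1
        have e5 := h3 _ h2
        have e6 := hf.le θ
        gcongr
    refine (integrableOn_iff_integrable_of_support_subset fun θ hθ => ?_).1 h1
    exact hf.mem_freqCube θ fun h => hθ (by simp only [hg, h, zero_mul])
  have hI0 : 0 < ∫ θ, g 0 θ := by
    have hg0 : Integrable (g 0) := by simpa [latticePoint_zero] using hgi 0
    have hnn : ∀ θ, 0 ≤ g 0 θ := fun θ => by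
      have := hf.nonneg θ
      simp only [hg]; positivity
    rw [integral_pos_iff_support_of_nonneg hnn hg0]
    have h1 : 0 < volume (Function.support f ∩ freqCube (n + 1)) :=
      (setIntegral_pos_iff_support_of_nonneg_ae (ae_of_all _ hf.nonneg)
        (hf.integrableOn isBounded_freqCube)).1 hpos
    refine h1.trans_le (measure_mono fun θ hθ => ?_)
    have h2 := hδ.trans_le (hf.le_norm θ hθ.1)
    have h3 : 0 < ‖θ‖ ^ e := Real.rpow_pos_of_pos h2 _
    have h4 : f θ ≠ 0 := hθ.1
    rw [Function.mem_support]
    simp only [hg, add_zero]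
    positivity
  refine ⟨‖z‖ ^ 2 / 2 * ∫ θ, g 0 θ, mul_pos (by have := norm_pos_iff.2 hz0; positivity) hI0, fun k => ?_⟩
  set p : 𝔼 (n + 1) := (2 * Real.pi) • latticePoint k with hp
  have h := tendsto_integral_profile_mul hn hC hz (hgi k) p ha0 fun θ hθ =>
    hga k θ fun h => hθ (by simp only [hg, h, zero_mul])
  have hpk : p = 0 ↔ k = 0 :=
    ⟨fun h0 => by_contra fun hk => (norm_freq_pos hk).ne' (by rw [← hp, h0, norm_zero]),
      fun h0 => by rw [hp, h0, latticePoint_zero, smul_zero]⟩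
  have h' := (Complex.continuous_ofReal.tendsto _).comp h
  have hlim : ((if p = 0 then ‖z‖ ^ 2 / 2 * ∫ θ, g p θ else 0 : ℝ) : ℂ)
      = if k = 0 then ((‖z‖ ^ 2 / 2 * ∫ θ, g 0 θ : ℝ) : ℂ) else 0 := by
    by_cases hk : k = 0
    · rw [if_pos hk, if_pos (hpk.2 hk), hpk.2 hk]
    · rw [if_neg hk, if_neg (mt hpk.1 hk), Complex.ofReal_zero]
  rw [hlim] at h'
  refine h'.congr' ?_
  filter_upwards [eventually_gt_atTop 0] with L hL
  have h1 : ∫ θ in freqCube (n + 1), ((f θ * ballFTReal n L ‖θ‖ : ℝ) : ℂ) * ballFT L (θ + p)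
      = ((∫ θ, f θ * ballFTReal n L ‖θ‖ * ballFTReal n L ‖θ + p‖ : ℝ) : ℂ) := by
    rw [setIntegral_eq_integral_of_forall_compl_eq_zero, ← integral_complex_ofReal]
    · refine integral_congr_ae (ae_of_all _ fun θ => ?_)
      simp only
      rw [ballFT_eq_real hL, ← Complex.ofReal_mul]
    · intro θ hθ
      have : f θ = 0 := by_contra fun h => hθ (hf.mem_freqCube θ h)
      simp [this]
  rw [h1]
  simp only [Function.comp]
  have h2 : ∀ θ, g p θ * (normalizedProfile n (L * ‖θ‖) * normalizedProfile n (L * ‖θ + p‖))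
      = (L ^ n)⁻¹ * (f θ * ballFTReal n L ‖θ‖ * ballFTReal n L ‖θ + p‖) := fun θ =>
    (hf.mul_ballFTReal_mul hL fun h => ha0.trans_le (hga k θ h).2).symm
  rw [integral_congr_ae (ae_of_all _ h2)]
  rw [integral_const_mul]
  push_cast
  rfl

/-! ### The surface-order lower bound -/

lemma IsWeight.integrableOn_mul_norm_sq {f : 𝔼 d → ℝ} {M : ℝ} (hf : IsWeight f M) {E : 𝔼 d → ℂ}
    (hE : Measurable E) {N : ℝ} (hN : ∀ θ, ‖E θ‖ ≤ N) :
    IntegrableOn (fun θ => f θ * ‖E θ‖ ^ 2) (freqCube d) := by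
  refine hf.integrableOn_mul (g := fun θ => ‖E θ‖ ^ 2) (Integrable.of_bound
    (hE.norm.pow_const 2).aestronglyMeasurable (N ^ 2) (ae_of_all _ fun θ => ?_))
  rw [norm_pow, norm_norm]
  exact pow_le_pow_left₀ (norm_nonneg _) (hN θ) 2

/-- The Cauchy-Schwarz inequality for a weight. -/
lemma IsWeight.norm_sq_integral_mul_le {f : 𝔼 d → ℝ} {M : ℝ} (hf : IsWeight f M) {u : 𝔼 d → ℝ}
    (hu : Continuous u) {E : 𝔼 d → ℂ} (hE : Measurable E) {N : ℝ} (hN : ∀ θ, ‖E θ‖ ≤ N) :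
    ‖∫ θ in freqCube d, ((f θ * u θ : ℝ) : ℂ) * E θ‖ ^ 2
      ≤ (∫ θ in freqCube d, f θ * u θ ^ 2) * ∫ θ in freqCube d, f θ * ‖E θ‖ ^ 2 := by
  have hsq : ∀ θ, √(f θ) ^ 2 = f θ := fun θ => Real.sq_sqrt (hf.nonneg θ)
  have h1 : ∀ θ, (√(f θ) * |u θ|) ^ 2 = f θ * u θ ^ 2 := fun θ => by rw [mul_pow, hsq, sq_abs]
  have h2 : ∀ θ, (√(f θ) * ‖E θ‖) ^ 2 = f θ * ‖E θ‖ ^ 2 := fun θ => by rw [mul_pow, hsq]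
  have h3 : ∀ θ, (√(f θ) * |u θ|) * (√(f θ) * ‖E θ‖) = f θ * (|u θ| * ‖E θ‖) := fun θ => by
    rw [mul_mul_mul_comm, ← sq, hsq]
  have hi1 : IntegrableOn (fun θ => f θ * u θ ^ 2) (freqCube d) :=
    hf.integrableOn_mul (g := fun θ => u θ ^ 2)
      (integrable_of_continuous_of_isBounded (hu.pow 2) isBounded_freqCube)
  have hi2 := hf.integrableOn_mul_norm_sq hE hN
  have hi3 : IntegrableOn (fun θ => f θ * (|u θ| * ‖E θ‖)) (freqCube d) := by
    have hu1 : IntegrableOn (fun θ => |u θ|) (freqCube d) :=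
      integrable_of_continuous_of_isBounded hu.abs isBounded_freqCube
    exact hf.integrableOn_mul (g := fun θ => |u θ| * ‖E θ‖)
      (hu1.mul_bdd (c := N) hE.norm.aestronglyMeasurable (ae_of_all _ fun θ => by
        rw [norm_norm]; exact hN θ))
  have hcs := sq_integral_mul_le (ν := volume.restrict (freqCube d)) (f := fun θ => √(f θ) * |u θ|)
    (g := fun θ => √(f θ) * ‖E θ‖) (by simp_rw [h1]; exact hi1) (by simp_rw [h2]; exact hi2)
    (by simp_rw [h3]; exact hi3)
  simp_rw [h1, h2, h3] at hcs
  refine le_trans (pow_le_pow_left₀ (norm_nonneg _) ?_ 2) hcs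
  refine (norm_integral_le_integral_norm _).trans (le_of_eq ?_)
  refine integral_congr_ae (ae_of_all _ fun θ => ?_)
  simp only
  rw [norm_mul, Complex.norm_real, norm_mul, Real.norm_eq_abs, Real.norm_eq_abs,
    abs_of_nonneg (hf.nonneg θ), mul_assoc]

/-- The normalized correlation of the Fourier transform of the ball with the exponential sum over
the lattice ball centred at `-x`. -/
noncomputable def ballCorrelation (f : 𝔼 (n + 1) → ℝ) (L : ℝ) (x : 𝔼 (n + 1)) : ℂ :=
  ((L : ℂ) ^ n)⁻¹ * ∫ θ in freqCube (n + 1), ((f θ * ballFTReal n L ‖θ‖ : ℝ) : ℂ)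
    * (chi θ x * shiftedSum L x θ)

lemma norm_chi_mul_shiftedSum_le (L : ℝ) (x θ : 𝔼 d) :
    ‖chi θ x * shiftedSum L x θ‖ ≤ (ballPoints (0 : 𝔼 d) (L + √d)).card := by
  rw [norm_mul, norm_chi, one_mul]
  exact norm_shiftedSum_le L x θ

lemma measurable_chi_mul_shiftedSum (L : ℝ) :
    Measurable fun q : (𝔼 d) × (𝔼 d) => chi q.2 q.1 * shiftedSum L q.1 q.2 :=
  (by fun_prop : Continuous fun q : (𝔼 d) × (𝔼 d) => chi q.2 q.1).measurable.mul (measurable_shiftedSum L)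

lemma IsWeight.measurable_correlation_density {f : 𝔼 (n + 1) → ℝ} {M : ℝ} (hf : IsWeight f M) (L : ℝ) :
    Measurable fun q : (𝔼 (n + 1)) × (𝔼 (n + 1)) => ((f q.2 * ballFTReal n L ‖q.2‖ : ℝ) : ℂ)
      * (chi q.2 q.1 * shiftedSum L q.1 q.2) := by
  refine Measurable.mul (Complex.measurable_ofReal.comp ?_) (measurable_chi_mul_shiftedSum L)
  exact (hf.measurable.comp measurable_snd).mul
    (((continuous_ballFTReal L).measurable.comp measurable_norm).comp measurable_snd)

lemma IsWeight.aestronglyMeasurable_ballCorrelation {f : 𝔼 (n + 1) → ℝ} {M : ℝ} (hf : IsWeight f M)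
    (L : ℝ) : AEStronglyMeasurable (ballCorrelation f L) (volume.restrict (cell (n + 1))) :=
  (((hf.measurable_correlation_density L).stronglyMeasurable.integral_prod_right).const_mul
    _).aestronglyMeasurable

/-- The Fourier coefficients of the correlation, as a function on the unit cell. -/
lemma IsWeight.integral_cell_chi_mul_ballCorrelation {f : 𝔼 (n + 1) → ℝ} {M : ℝ} (hf : IsWeight f M)
    {L : ℝ} (hL : 0 < L) (k : Fin (n + 1) → ℤ) :
    ∫ x in cell (n + 1), chi ((2 * Real.pi) • latticePoint k) x * ballCorrelation f L x
      = ((L : ℂ) ^ n)⁻¹ * ∫ θ in freqCube (n + 1), ((f θ * ballFTReal n L ‖θ‖ : ℝ) : ℂ)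
        * ballFT L (θ + (2 * Real.pi) • latticePoint k) := by
  obtain ⟨A, hA, hb⟩ := exists_ballFTReal_bound n
  set B : ℝ := √(A * L ^ (2 * (n + 1))) with hB
  have hbB : ∀ r, |ballFTReal n L r| ≤ B := fun r =>
    Real.abs_le_sqrt ((hb L hL).1 r)
  set P : ℝ := ((ballPoints (0 : 𝔼 (n + 1)) (L + √(n + 1 : ℕ))).card : ℝ) with hP
  have hM := hf.bound_nonneg
  set F : 𝔼 (n + 1) → 𝔼 (n + 1) → ℂ := fun x θ => chi ((2 * Real.pi) • latticePoint k) x *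
    (((f θ * ballFTReal n L ‖θ‖ : ℝ) : ℂ) * (chi θ x * shiftedSum L x θ)) with hF
  have hFm : Measurable (Function.uncurry F) :=
    (by fun_prop : Continuous fun q : (𝔼 (n + 1)) × (𝔼 (n + 1)) =>
      chi ((2 * Real.pi) • latticePoint k) q.1).measurable.mul (hf.measurable_correlation_density L)
  have hFi : Integrable (Function.uncurry F)
      ((volume.restrict (cell (n + 1))).prod (volume.restrict (freqCube (n + 1)))) := by
    refine Integrable.of_bound hFm.aestronglyMeasurable (M * B * P) (ae_of_all _ fun q => ?_)
    simp only [Function.uncurry, hF]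
    rw [norm_mul, norm_chi, one_mul, norm_mul, Complex.norm_real, norm_mul, Real.norm_eq_abs,
      Real.norm_eq_abs, abs_of_nonneg (hf.nonneg _)]
    have h1 := hf.le q.2
    have h2 := hbB ‖q.2‖
    have h3 := norm_chi_mul_shiftedSum_le L q.1 q.2
    have h4 := hf.nonneg q.2
    gcongr
  calc ∫ x in cell (n + 1), chi ((2 * Real.pi) • latticePoint k) x * ballCorrelation f L x
      = ((L : ℂ) ^ n)⁻¹ * ∫ x in cell (n + 1), ∫ θ in freqCube (n + 1), F x θ := by
        rw [← integral_const_mul]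
        refine integral_congr_ae (ae_of_all _ fun x => ?_)
        simp only [ballCorrelation, hF]
        rw [integral_const_mul]
        ring
    _ = ((L : ℂ) ^ n)⁻¹ * ∫ θ in freqCube (n + 1), ∫ x in cell (n + 1), F x θ := by
        rw [integral_integral_swap hFi]
    _ = _ := by
        congr 1
        refine integral_congr_ae (ae_of_all _ fun θ => ?_)
        simp only [hF]
        rw [← integral_cell_chi_mul_shiftedSum, ← integral_const_mul]
        refine integral_congr_ae (ae_of_all _ fun x => ?_)
        simp only
        ring

lemma IsPuncturedWeight.exists_integral_ballFTReal_sq_le {f : 𝔼 (n + 1) → ℝ} {M δ : ℝ}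
    (hf : IsPuncturedWeight f M δ) : ∃ C : ℝ, 0 < C ∧ ∀ L > 0,
      ∫ θ in freqCube (n + 1), f θ * ballFTReal n L ‖θ‖ ^ 2 ≤ C * L ^ n := by
  obtain ⟨A, hA, hb⟩ := exists_ballFTReal_bound n
  have hδ := hf.radius_pos
  have hfi := hf.integrableOn (isBounded_freqCube (d := n + 1))
  have hI : 0 ≤ ∫ θ in freqCube (n + 1), f θ := integral_nonneg hf.nonneg
  refine ⟨A / δ ^ (n + 2) * (∫ θ in freqCube (n + 1), f θ) + 1, by positivity, fun L hL => ?_⟩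
  have hc : Continuous fun θ : 𝔼 (n + 1) => ballFTReal n L ‖θ‖ ^ 2 :=
    ((continuous_ballFTReal L).comp continuous_norm).pow 2
  calc ∫ θ in freqCube (n + 1), f θ * ballFTReal n L ‖θ‖ ^ 2
      ≤ ∫ θ in freqCube (n + 1), f θ * (A / δ ^ (n + 2) * L ^ n) := by
        refine integral_mono (hf.integrableOn_mul
          (integrable_of_continuous_of_isBounded hc isBounded_freqCube)) (hfi.mul_const _) fun θ => ?_
        by_cases h0 : f θ = 0
        · simp [h0]
        have h1 := hf.le_norm θ h0
        refine mul_le_mul_of_nonneg_left (((hb L hL).2 ‖θ‖ (hδ.trans_le h1)).trans ?_) (hf.nonneg θ)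
        rw [div_mul_eq_mul_div, ← mul_div_assoc]
        gcongr
    _ = A / δ ^ (n + 2) * (∫ θ in freqCube (n + 1), f θ) * L ^ n := by rw [integral_mul_const]; ring
    _ ≤ _ := by
        have : 0 ≤ L ^ n := by positivity
        nlinarith

lemma IsPuncturedWeight.exists_integral_latticeSum_sq_le {f : 𝔼 (n + 1) → ℝ} {M δ : ℝ}
    (hf : IsPuncturedWeight f M δ) : ∃ C : ℝ, 0 < C ∧ ∀ L ≥ 2 * √(n + 1 : ℕ),
      ∫ θ in freqCube (n + 1), f θ * ‖latticeSum (ballPoints 0 L) θ‖ ^ 2 ≤ C * L ^ n := by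
  obtain ⟨C₁, hC₁, h1⟩ := exists_comparison n
  obtain ⟨C₂, hC₂, h2⟩ := hf.exists_integral_ballFTReal_sq_le
  have hM := hf.bound_nonneg
  refine ⟨C₁ * C₂ + C₁ * M, by positivity, fun L hL => ?_⟩
  have hL0 : 0 < L := lt_of_lt_of_le (by positivity) hL
  have h3 := (h1 f M hf.toIsWeight L hL).1
  have h4 := mul_le_mul_of_nonneg_left (h2 L hL0) hC₁.le
  linarith

/-- How much the exponential sum changes when the ball is moved. -/
lemma IsWeight.integral_norm_sq_shift_le {f : 𝔼 (n + 1) → ℝ} {M : ℝ} (hf : IsWeight f M) {L ρ : ℝ}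
    {x : 𝔼 (n + 1)} (hx : x ∈ cell (n + 1)) (hρ : ‖x‖ ≤ ρ) :
    ∫ θ in freqCube (n + 1), f θ * ‖chi θ x * shiftedSum L x θ - latticeSum (ballPoints 0 L) θ‖ ^ 2
      ≤ 2 * M * ((2 * Real.pi) ^ (n + 1) * (shellPoints (n + 1) L ρ).card)
        + 2 * (√(n + 1 : ℕ) * Real.pi * ρ) ^ 2
          * ∫ θ in freqCube (n + 1), f θ * ‖latticeSum (ballPoints 0 L) θ‖ ^ 2 := by
  have hM := hf.bound_nonneg
  have hpi := Real.pi_pos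
  set R : ℝ := √(n + 1 : ℕ) * Real.pi with hR
  have hR0 : 0 ≤ R := by positivity
  have hρ0 : 0 ≤ ρ := (norm_nonneg _).trans hρ
  set D := latticeSum (ballPoints (0 : 𝔼 (n + 1)) L) with hD
  set D' := latticeSum (ballPoints x L) with hD'
  have hDc : Continuous D := continuous_latticeSum _
  have hDc' : Continuous D' := continuous_latticeSum _
  have hint : ∀ {g : 𝔼 (n + 1) → ℝ}, Continuous g → IntegrableOn (fun θ => f θ * g θ) (freqCube (n + 1)) :=
    fun hg => hf.integrableOn_mul (integrable_of_continuous_of_isBounded hg isBounded_freqCube)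
  have hs : ∀ θ, shiftedSum L x θ = D' θ := fun θ => shiftedSum_eq (norm_le_of_mem_cell hx) θ
  simp_rw [hs]
  have hc1 : Continuous fun θ => ‖D' θ - D θ‖ ^ 2 := by fun_prop
  have hc2 : Continuous fun θ => ‖D θ‖ ^ 2 := by fun_prop
  have hc3 : Continuous fun θ => ‖chi θ x * D' θ - D θ‖ ^ 2 := by fun_prop
  have hi1 : IntegrableOn (fun θ => ‖D' θ - D θ‖ ^ 2) (freqCube (n + 1)) :=
    integrable_of_continuous_of_isBounded hc1 isBounded_freqCube
  calc ∫ θ in freqCube (n + 1), f θ * ‖chi θ x * D' θ - D θ‖ ^ 2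
      ≤ ∫ θ in freqCube (n + 1), (2 * M * ‖D' θ - D θ‖ ^ 2 + 2 * (R * ρ) ^ 2 * (f θ * ‖D θ‖ ^ 2)) := by
        refine setIntegral_mono_on (hint hc3) ((hi1.const_mul _).add ((hint hc2).const_mul _))
          measurableSet_freqCube fun θ hθ => ?_
        have h1 : ‖chi θ x * D' θ - D θ‖ ≤ ‖D' θ - D θ‖ + R * ρ * ‖D θ‖ := by
          have h2 : chi θ x * D' θ - D θ = chi θ x * (D' θ - D θ) + (chi θ x - 1) * D θ := by ring
          rw [h2]
          refine (norm_add_le _ _).trans ?_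
          rw [norm_mul, norm_mul, norm_chi, one_mul]
          have h3 : ‖θ‖ ≤ R := norm_le_of_coord_le hpi.le fun k => abs_le.2 (hθ k)
          have h4 := (norm_chi_sub_one_le θ x).trans (mul_le_mul h3 hρ (norm_nonneg _) hR0)
          gcongr
        have h5 : ‖chi θ x * D' θ - D θ‖ ^ 2 ≤ 2 * ‖D' θ - D θ‖ ^ 2 + 2 * (R * ρ) ^ 2 * ‖D θ‖ ^ 2 := by
          refine (pow_le_pow_left₀ (norm_nonneg _) h1 2).trans ?_
          nlinarith [sq_nonneg (‖D' θ - D θ‖ - R * ρ * ‖D θ‖)]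
        have h6 := mul_le_mul_of_nonneg_left h5 (hf.nonneg θ)
        have h7 := mul_le_mul_of_nonneg_right (hf.le θ) (sq_nonneg ‖D' θ - D θ‖)
        linarith
    _ = 2 * M * (∫ θ in freqCube (n + 1), ‖D' θ - D θ‖ ^ 2)
        + 2 * (R * ρ) ^ 2 * ∫ θ in freqCube (n + 1), f θ * ‖D θ‖ ^ 2 := by
        refine (integral_add (hi1.const_mul _) ((hint hc2).const_mul _)).trans ?_
        rw [integral_const_mul, integral_const_mul]
    _ ≤ _ := by
        rw [hD, hD', integral_norm_sq_latticeSum_sub]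
        have h1 : ((symmDiff (ballPoints x L) (ballPoints 0 L)).card : ℝ)
            ≤ (shellPoints (n + 1) L ρ).card :=
          Nat.cast_le.2 (Finset.card_le_card ((symmDiff_ballPoints_subset x L).trans (shellPoints_mono hρ)))
        gcongr

lemma shiftedSum_origin (L : ℝ) (θ : 𝔼 d) : shiftedSum L 0 θ = latticeSum (ballPoints 0 L) θ :=
  shiftedSum_eq (by simp) θ

lemma measurable_chi_mul_shiftedSum_right (L : ℝ) (x : 𝔼 d) :
    Measurable fun θ => chi θ x * shiftedSum L x θ := by
  have h : Measurable (Function.uncurry (shiftedSum (d := d) L)) := measurable_shiftedSum L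
  have h1 : Measurable (shiftedSum L x) := h.of_uncurry_left
  exact (by fun_prop : Continuous fun θ => chi θ x).measurable.mul h1

/-- Cauchy-Schwarz for a correlation with the Fourier transform of the ball, at surface scale. -/
lemma IsWeight.norm_sq_correlation_le {f : 𝔼 (n + 1) → ℝ} {M : ℝ} (hf : IsWeight f M) {L C q N : ℝ}
    (hL : 0 < L) (hC : 0 ≤ C) (hb : ∫ θ in freqCube (n + 1), f θ * ballFTReal n L ‖θ‖ ^ 2 ≤ C * L ^ n)
    {E : 𝔼 (n + 1) → ℂ} (hE : Measurable E) (hN : ∀ θ, ‖E θ‖ ≤ N)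
    (hq : ∫ θ in freqCube (n + 1), f θ * ‖E θ‖ ^ 2 ≤ q * L ^ n) :
    ‖((L : ℂ) ^ n)⁻¹ * ∫ θ in freqCube (n + 1), ((f θ * ballFTReal n L ‖θ‖ : ℝ) : ℂ) * E θ‖ ^ 2
      ≤ C * q := by
  have h1 := hf.norm_sq_integral_mul_le ((continuous_ballFTReal (n := n) L).comp continuous_norm) hE hN
  have h0 : 0 ≤ ∫ θ in freqCube (n + 1), f θ * ‖E θ‖ ^ 2 :=
    integral_nonneg fun θ => mul_nonneg (hf.nonneg θ) (sq_nonneg _)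
  have h2 := h1.trans (mul_le_mul hb hq h0 (by positivity))
  rw [norm_mul, norm_inv, norm_pow, Complex.norm_real, Real.norm_eq_abs, abs_of_pos hL, mul_pow]
  calc ((L ^ n)⁻¹) ^ 2 * ‖∫ θ in freqCube (n + 1), ((f θ * ballFTReal n L ‖θ‖ : ℝ) : ℂ) * E θ‖ ^ 2
      ≤ ((L ^ n)⁻¹) ^ 2 * (C * L ^ n * (q * L ^ n)) := mul_le_mul_of_nonneg_left h2 (by positivity)
    _ = C * q := by field_simp

lemma IsWeight.norm_sq_ballCorrelation_zero_le {f : 𝔼 (n + 1) → ℝ} {M : ℝ} (hf : IsWeight f M)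
    {L C : ℝ} (hL : 0 < L) (hC : 0 ≤ C)
    (hb : ∫ θ in freqCube (n + 1), f θ * ballFTReal n L ‖θ‖ ^ 2 ≤ C * L ^ n) :
    ‖ballCorrelation f L 0‖ ^ 2
      ≤ C * ((∫ θ in freqCube (n + 1), f θ * ‖latticeSum (ballPoints 0 L) θ‖ ^ 2) / L ^ n) := by
  have hLn : 0 < L ^ n := by positivity
  refine hf.norm_sq_correlation_le hL hC hb (measurable_chi_mul_shiftedSum_right L 0)
    (norm_chi_mul_shiftedSum_le L 0) ?_
  rw [div_mul_cancel₀ _ hLn.ne']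
  simp_rw [chi_zero, one_mul, shiftedSum_origin]
  exact le_rfl

lemma IsWeight.norm_sq_ballCorrelation_sub_le {f : 𝔼 (n + 1) → ℝ} {M : ℝ} (hf : IsWeight f M)
    {L C C' c₀ ρ : ℝ} (hL : 0 < L) (hC : 0 ≤ C)
    (hb : ∫ θ in freqCube (n + 1), f θ * ballFTReal n L ‖θ‖ ^ 2 ≤ C * L ^ n)
    (hD : ∫ θ in freqCube (n + 1), f θ * ‖latticeSum (ballPoints 0 L) θ‖ ^ 2 ≤ C' * L ^ n)
    {x : 𝔼 (n + 1)} (hx : x ∈ cell (n + 1)) (hρ : ‖x‖ ≤ ρ)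
    (hc₀ : ((shellPoints (n + 1) L ρ).card : ℝ) ≤ c₀ * L ^ n) :
    ‖ballCorrelation f L x - ballCorrelation f L 0‖ ^ 2
      ≤ C * (2 * M * ((2 * Real.pi) ^ (n + 1) * c₀)
        + 2 * (√(n + 1 : ℕ) * Real.pi * ρ) ^ 2 * C') := by
  have hM := hf.bound_nonneg
  have hpi := Real.pi_pos
  have hEb : ∀ θ : 𝔼 (n + 1), ‖chi θ x * shiftedSum L x θ - latticeSum (ballPoints 0 L) θ‖
      ≤ (ballPoints (0 : 𝔼 (n + 1)) (L + √(n + 1 : ℕ))).card + (ballPoints (0 : 𝔼 (n + 1)) L).card :=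
    fun θ => (norm_sub_le _ _).trans
      (add_le_add (norm_chi_mul_shiftedSum_le L x θ) (norm_latticeSum_le _ θ))
  have h1 := (hf.integral_norm_sq_shift_le (L := L) hx hρ).trans (add_le_add
    (mul_le_mul_of_nonneg_left (mul_le_mul_of_nonneg_left hc₀ (by positivity)) (by positivity))
    (mul_le_mul_of_nonneg_left hD (by positivity)))
  have h2 := hf.norm_sq_correlation_le hL hC hb
    ((measurable_chi_mul_shiftedSum_right L x).sub (continuous_latticeSum (ballPoints 0 L)).measurable) hEb
    (q := 2 * M * ((2 * Real.pi) ^ (n + 1) * c₀) + 2 * (√(n + 1 : ℕ) * Real.pi * ρ) ^ 2 * C')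
    (h1.trans (le_of_eq (by ring)))
  refine le_trans (le_of_eq ?_) h2
  congr 2
  simp only [ballCorrelation]
  rw [← mul_sub]
  congr 1
  have hi : ∀ {E : 𝔼 (n + 1) → ℂ}, Measurable E → ∀ {N : ℝ}, (∀ θ, ‖E θ‖ ≤ N) →
      IntegrableOn (fun θ => ((f θ * ballFTReal n L ‖θ‖ : ℝ) : ℂ) * E θ) (freqCube (n + 1)) := by
    intro E hE N hN
    have h3 : IntegrableOn (fun θ => f θ * ballFTReal n L ‖θ‖) (freqCube (n + 1)) :=
      hf.integrableOn_mul (integrable_of_continuous_of_isBounded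
        ((continuous_ballFTReal L).comp continuous_norm) isBounded_freqCube)
    have h4 : IntegrableOn (fun θ => ((f θ * ballFTReal n L ‖θ‖ : ℝ) : ℂ)) (freqCube (n + 1)) :=
      h3.ofReal
    exact h4.mul_bdd (c := N) hE.aestronglyMeasurable (ae_of_all _ hN)
  rw [← integral_sub (hi (measurable_chi_mul_shiftedSum_right L x) (norm_chi_mul_shiftedSum_le L x))
    (hi (measurable_chi_mul_shiftedSum_right L 0) (norm_chi_mul_shiftedSum_le L 0))]
  refine integral_congr_ae (ae_of_all _ fun θ => ?_)
  simp only
  rw [chi_zero, one_mul, shiftedSum_origin, Pi.sub_apply, mul_sub]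

/-- The mean square of the exponential sum over a lattice ball against a punctured weight is at
least of surface order. -/
lemma IsPuncturedWeight.exists_le_integral_latticeSum_sq (hn : 1 ≤ n) {f : 𝔼 (n + 1) → ℝ} {M δ : ℝ}
    (hf : IsPuncturedWeight f M δ) (hpos : 0 < ∫ θ in freqCube (n + 1), f θ) :
    ∃ a : ℝ, 0 < a ∧ ∀ᶠ L : ℝ in atTop,
      a * L ^ n ≤ ∫ θ in freqCube (n + 1), f θ * ‖latticeSum (ballPoints 0 L) θ‖ ^ 2 := by
  obtain ⟨w, hw, hlim⟩ := hf.exists_tendsto_correlation hn hpos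
  obtain ⟨C₁, hC₁, hb⟩ := hf.exists_integral_ballFTReal_sq_le
  obtain ⟨C₂, hC₂, hD⟩ := hf.exists_integral_latticeSum_sq_le
  obtain ⟨C₃, hC₃, hshell⟩ := exists_card_shellPoints_le_mul (n := n) hn
  obtain ⟨C₄, hC₄, hshell'⟩ := card_shellPoints_le n (Real.sqrt_nonneg (n + 1 : ℕ))
  have hM := hf.bound_nonneg
  have hpi := Real.pi_pos
  have hs0 : 0 < √(n + 1 : ℕ) := Real.sqrt_pos.2 (by positivity)
  set s : ℝ := √(n + 1 : ℕ) with hs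
  set W := ballCorrelation f with hW
  set Q : ℝ → ℝ := fun L => ∫ θ in freqCube (n + 1), f θ * ‖latticeSum (ballPoints 0 L) θ‖ ^ 2 with hQ
  have hW0 : ∀ L > 0, ‖W L 0‖ ^ 2 ≤ C₁ * (Q L / L ^ n) := fun L hL =>
    hf.norm_sq_ballCorrelation_zero_le hL hC₁.le (hb L hL)
  have hWd : ∀ L ≥ 2 * s, ∀ x ∈ cell (n + 1), ∀ ρ, ‖x‖ ≤ ρ → ∀ c₀ : ℝ,
      ((shellPoints (n + 1) L ρ).card : ℝ) ≤ c₀ * L ^ n →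
      ‖W L x - W L 0‖ ^ 2 ≤ C₁ * (2 * M * ((2 * Real.pi) ^ (n + 1) * c₀)
        + 2 * (s * Real.pi * ρ) ^ 2 * C₂) := by
    intro L hL x hx ρ hρ c₀ hc₀
    have hL0 : 0 < L := lt_of_lt_of_le (by positivity) hL
    exact hf.norm_sq_ballCorrelation_sub_le hL0 hC₁.le (hb L hL0) (hD L hL) hx hρ hc₀
  -- the correlation is bounded, uniformly over the cell
  set K₁ : ℝ := C₁ * (2 * M * ((2 * Real.pi) ^ (n + 1) * C₄) + 2 * (s * Real.pi * s) ^ 2 * C₂) with hK₁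
  have hWb : ∀ᶠ L in atTop, ∀ x ∈ cell (n + 1), ‖W L x‖ ≤ √K₁ + √(C₁ * C₂) := by
    filter_upwards [eventually_ge_atTop (2 * s)] with L hL x hx
    have hL0 : 0 < L := lt_of_lt_of_le (by positivity) hL
    have h1 := hWd L hL x hx s (norm_le_of_mem_cell hx) C₄ (hshell' L (by linarith))
    have h2 : ‖W L 0‖ ^ 2 ≤ C₁ * C₂ := (hW0 L hL0).trans (by
      refine mul_le_mul_of_nonneg_left ?_ hC₁.le
      rw [div_le_iff₀ (by positivity)]
      exact hD L hL)
    have h3 := norm_le_norm_sub_add (W L x) (W L 0)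
    exact h3.trans (add_le_add (Real.le_sqrt_of_sq_le h1) (Real.le_sqrt_of_sq_le h2))
  have hcoef : ∀ k : Fin (n + 1) → ℤ, Tendsto (fun L =>
      ∫ x in cell (n + 1), chi ((2 * Real.pi) • latticePoint k) x * W L x) atTop
      (𝓝 (if k = 0 then (w : ℂ) else 0)) := fun k => by
    refine (hlim k).congr' ?_
    filter_upwards [eventually_gt_atTop 0] with L hL
    exact (hf.integral_cell_chi_mul_ballCorrelation hL k).symm
  have hmean : Tendsto (fun L => ∫ x in cell (n + 1), W L x) atTop (𝓝 (w : ℂ)) := by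
    have h0 := hcoef 0
    rw [if_pos rfl] at h0
    refine h0.congr fun L => ?_
    simp only [latticePoint_zero, smul_zero, chi_zero_left, one_mul]
  -- the radius `ρ` makes the increments of the correlation smaller than `w / 4`
  set K₂ : ℝ := C₁ * (2 * M * ((2 * Real.pi) ^ (n + 1) * C₃) + 2 * (s * Real.pi) ^ 2 * C₂) with hK₂
  have hK₂0 : 0 ≤ K₂ := by positivity
  set ρ : ℝ := min 1 (w ^ 2 / (16 * (K₂ + 1))) with hρ
  have hρ0 : 0 < ρ := lt_min one_pos (by positivity)
  have hρ1 : ρ ≤ 1 := min_le_left _ _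
  have hKρ : K₂ * ρ ≤ (w / 4) ^ 2 := by
    have h1 : ρ ≤ w ^ 2 / (16 * (K₂ + 1)) := min_le_right _ _
    rw [le_div_iff₀ (by positivity)] at h1
    nlinarith
  obtain ⟨κ, hκ0, hκi, hκ1, hκs, hev⟩ := eventually_norm_sub_mean_le
    hf.aestronglyMeasurable_ballCorrelation hWb
    (fun k hk => by have := hcoef k; rwa [if_neg hk] at this)
    (by positivity : 0 < ρ / s) (by positivity : 0 < w / 4)
  refine ⟨(w / 4) ^ 2 / C₁, by positivity, ?_⟩
  filter_upwards [hev, Metric.tendsto_nhds.1 hmean (w / 4) (by positivity), hshell ρ hρ0,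
    eventually_ge_atTop (2 * s)] with L ⟨hL1, hL2⟩ hL3 hL4 hL
  have hL0 : 0 < L := lt_of_lt_of_le (by positivity) hL
  have hclose : ‖(∫ x in cell (n + 1), (κ x : ℂ) * W L x) - W L 0‖ ≤ w / 4 := by
    have hκc : IntegrableOn (fun x => (κ x : ℂ)) (cell (n + 1)) := hκi.ofReal
    have h1 : W L 0 = ∫ x in cell (n + 1), (κ x : ℂ) * W L 0 := by
      rw [integral_mul_const, integral_complex_ofReal, hκ1, Complex.ofReal_one, one_mul]
    have h2 : (∫ x in cell (n + 1), (κ x : ℂ) * W L x) - W L 0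
        = ∫ x in cell (n + 1), (κ x : ℂ) * (W L x - W L 0) := by
      conv_lhs => rw [h1]
      rw [← integral_sub hL1 (hκc.mul_const _)]
      refine integral_congr_ae (ae_of_all _ fun x => ?_)
      simp only [hW, mul_sub]
    have h3 : ∫ x in cell (n + 1), κ x * (w / 4) = w / 4 := by rw [integral_mul_const, hκ1, one_mul]
    rw [h2, ← h3]
    refine norm_integral_le_of_norm_le (hκi.mul_const _) ?_
    filter_upwards [ae_restrict_mem measurableSet_cell] with x hx
    rw [norm_mul, Complex.norm_real, Real.norm_eq_abs, abs_of_nonneg (hκ0 x)]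
    by_cases hx0 : κ x = 0
    · simp [hx0]
    have hxρ : ‖x‖ ≤ ρ := (hκs x hx hx0).trans (le_of_eq (mul_div_cancel₀ _ hs0.ne'))
    refine mul_le_mul_of_nonneg_left (abs_le_of_sq_le_sq' ?_ (by positivity)).2 (hκ0 x)
    refine (hWd L hL x hx ρ hxρ (C₃ * ρ) hL4).trans (le_trans ?_ hKρ)
    have h4 : ρ ^ 2 ≤ ρ := by nlinarith
    calc C₁ * (2 * M * ((2 * Real.pi) ^ (n + 1) * (C₃ * ρ)) + 2 * (s * Real.pi * ρ) ^ 2 * C₂)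
        = C₁ * (2 * M * ((2 * Real.pi) ^ (n + 1) * C₃) * ρ + 2 * (s * Real.pi) ^ 2 * C₂ * ρ ^ 2) := by ring
      _ ≤ C₁ * (2 * M * ((2 * Real.pi) ^ (n + 1) * C₃) * ρ + 2 * (s * Real.pi) ^ 2 * C₂ * ρ) := by gcongr
      _ = K₂ * ρ := by rw [hK₂]; ring
  -- `w`, the mean of `W L`, its average against `κ` and `W L 0` are consecutively `w / 4`-close
  have hlow : w / 4 ≤ ‖W L 0‖ := by
    rw [dist_eq_norm] at hL3
    have h1 : ‖(w : ℂ)‖ = w := by rw [Complex.norm_real, Real.norm_eq_abs, abs_of_pos hw]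
    set J := ∫ x in cell (n + 1), W L x
    set I := ∫ x in cell (n + 1), (κ x : ℂ) * W L x
    have h2 : (w : ℂ) = -(J - w) + (-(I - J)) + (I - W L 0) + W L 0 := by ring
    have h3 := norm_add_le (-(J - w) + (-(I - J)) + (I - W L 0)) (W L 0)
    have h4 := norm_add₃_le (a := -(J - w)) (b := -(I - J)) (c := I - W L 0)
    rw [← h2, h1] at h3
    rw [norm_neg, norm_neg] at h4
    linarith
  have h1 := (pow_le_pow_left₀ (by positivity) hlow 2).trans (hW0 L hL0)
  have hLn : 0 < L ^ n := by positivity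
  rw [div_mul_eq_mul_div, div_le_iff₀ hC₁]
  rw [← mul_div_assoc, le_div_iff₀ hLn] at h1
  linarith

/-- Removing a small ball from the support of a weight. -/
lemma IsWeight.exists_punctured {f : 𝔼 (n + 1) → ℝ} {M : ℝ} (hf : IsWeight f M)
    (hpos : 0 < ∫ θ in freqCube (n + 1), f θ) :
    ∃ (g : 𝔼 (n + 1) → ℝ) (δ : ℝ), IsPuncturedWeight g M δ ∧ (∀ θ, g θ ≤ f θ) ∧
      0 < ∫ θ in freqCube (n + 1), g θ := by
  classical
  set I := ∫ θ in freqCube (n + 1), f θ with hI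
  have hV := unitBallVolume_pos (n + 1)
  set V := unitBallVolume (n + 1) with hVdef
  have hM := hf.bound_nonneg
  set δ : ℝ := min 1 (I / (2 * (M * V + 1))) with hδ
  have hδ0 : 0 < δ := lt_min one_pos (by positivity)
  have hδ1 : δ ≤ 1 := min_le_left _ _
  have hδI : M * V * δ ≤ I / 2 := by
    have h1 : δ ≤ I / (2 * (M * V + 1)) := min_le_right _ _
    rw [le_div_iff₀ (by positivity)] at h1
    nlinarith
  set s : Set (𝔼 (n + 1)) := freqCube (n + 1) \ Metric.ball 0 δ with hs
  have hsm : MeasurableSet s := measurableSet_freqCube.diff measurableSet_ball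
  have hmem : ∀ θ, s.indicator f θ ≠ 0 → θ ∈ s := fun θ h => by
    by_contra h'
    exact h (Set.indicator_of_notMem h' _)
  have hle : ∀ θ, s.indicator f θ ≤ f θ := Set.indicator_le_self' fun θ _ => hf.nonneg θ
  have hfi := hf.integrableOn (isBounded_freqCube (d := n + 1))
  refine ⟨s.indicator f, δ, ⟨⟨hf.measurable.indicator hsm, fun θ => Set.indicator_nonneg
    (fun θ _ => hf.nonneg θ) θ, fun θ => (hle θ).trans (hf.le θ)⟩, hδ0, fun θ h => (hmem θ h).1,
    fun θ h => ?_⟩, hle, ?_⟩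
  · have := (hmem θ h).2
    rwa [mem_ball_zero_iff, not_lt] at this
  · have h1 := integral_inter_add_sdiff (s := freqCube (n + 1)) (t := Metric.ball (0 : 𝔼 (n + 1)) δ)
      measurableSet_ball hfi
    have h2 : ∫ θ in freqCube (n + 1) ∩ Metric.ball 0 δ, f θ ≤ I / 2 := by
      have hfin : IntegrableOn (fun _ : 𝔼 (n + 1) => M) (Metric.closedBall 0 δ) :=
        integrable_of_continuous_of_isBounded continuous_const Metric.isBounded_closedBall
      have hsub : freqCube (n + 1) ∩ Metric.ball 0 δ ⊆ Metric.closedBall 0 δ :=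
        Set.inter_subset_right.trans Metric.ball_subset_closedBall
      calc ∫ θ in freqCube (n + 1) ∩ Metric.ball 0 δ, f θ
          ≤ ∫ θ in Metric.closedBall 0 δ, f θ :=
            setIntegral_mono_set (hf.integrableOn Metric.isBounded_closedBall)
              (ae_of_all _ hf.nonneg) (LE.le.eventuallyLE hsub)
        _ ≤ ∫ _θ in Metric.closedBall (0 : 𝔼 (n + 1)) δ, M :=
            integral_mono (hf.integrableOn Metric.isBounded_closedBall) hfin hf.le
        _ = δ ^ (n + 1) * V * M := by
            rw [setIntegral_const, smul_eq_mul, volume_real_closedBall hδ0.le]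
        _ ≤ δ * V * M := by
            have : δ ^ (n + 1) ≤ δ := pow_le_of_le_one hδ0.le hδ1 (by omega)
            gcongr
        _ ≤ I / 2 := by linarith
    have h3 : ∫ θ in freqCube (n + 1), s.indicator f θ = ∫ θ in s, f θ := by
      rw [setIntegral_indicator hsm, Set.inter_eq_right.2 Set.sdiff_subset]
    rw [h3]
    have h4 : 0 < I := hpos
    rw [← hI] at h1
    linarith

/-! ### The one-dimensional case -/

lemma sum_ballPoints_one {L : ℝ} (hL : 0 ≤ L) (F : (Fin 1 → ℤ) → ℂ) :
    ∑ j ∈ ballPoints (0 : 𝔼 1) L, F j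
      = ∑ k ∈ Finset.range (2 * ⌊L⌋₊ + 1), F fun _ => (k : ℤ) - ⌊L⌋₊ := by
  symm
  refine Finset.sum_bij (fun k _ => fun _ => (k : ℤ) - ⌊L⌋₊) (fun k hk => ?_) (fun k _ l _ h => ?_)
    (fun j hj => ?_) fun k _ => rfl
  · rw [Finset.mem_range] at hk
    rw [mem_ballPoints, add_zero, EuclideanSpace.norm_eq]
    simp only [Finset.univ_unique, Finset.sum_singleton, latticePoint_apply]
    rw [Real.sqrt_sq (norm_nonneg _), Real.norm_eq_abs]
    have h1 : |(k : ℤ) - (⌊L⌋₊ : ℤ)| ≤ ⌊L⌋₊ := by rw [abs_le]; constructor <;> omega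
    have h2 : |(((k : ℤ) - (⌊L⌋₊ : ℤ) : ℤ) : ℝ)| ≤ ⌊L⌋₊ := by exact_mod_cast h1
    exact h2.trans (Nat.floor_le hL)
  · have h1 : (k : ℤ) - ⌊L⌋₊ = (l : ℤ) - ⌊L⌋₊ := congrFun h 0
    omega
  · rw [mem_ballPoints, add_zero, EuclideanSpace.norm_eq] at hj
    simp only [Finset.univ_unique, Finset.sum_singleton, latticePoint_apply] at hj
    rw [Real.sqrt_sq (norm_nonneg _), Real.norm_eq_abs] at hj
    have h1 : (j default).natAbs ≤ ⌊L⌋₊ := by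
      rw [Nat.le_floor_iff hL, Nat.cast_natAbs]
      exact_mod_cast hj
    refine ⟨(j default + ⌊L⌋₊).toNat, ?_, ?_⟩
    · rw [Finset.mem_range]; omega
    · ext i
      rw [Subsingleton.elim i default]
      omega

/-- Telescoping of the geometric sum over an interval. -/
lemma two_sub_re_chi_le {L : ℝ} (hL : 0 ≤ L) (θ : 𝔼 1) :
    2 - 2 * (chi θ (latticePoint fun _ => (2 * ⌊L⌋₊ + 1 : ℤ))).re
      ≤ 4 * ‖latticeSum (ballPoints 0 L) θ‖ ^ 2 := by
  set m : ℤ := ((⌊L⌋₊ : ℕ) : ℤ) with hm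
  set F : ℕ → ℂ := fun k => chi θ (latticePoint fun _ => (k : ℤ) - m) with hF
  set e : ℂ := chi θ (latticePoint fun _ => 1) with he
  have hstep : ∀ k, F (k + 1) = e * F k := fun k => by
    simp only [hF, he]
    rw [← chi_add, ← latticePoint_add]
    congr 2
    ext i
    simp only [Pi.add_apply]
    push_cast; ring
  have h1 : (e - 1) * latticeSum (ballPoints 0 L) θ = F (2 * ⌊L⌋₊ + 1) - F 0 := by
    rw [latticeSum, sum_ballPoints_one hL, ← Finset.sum_range_sub, Finset.mul_sum]
    refine Finset.sum_congr rfl fun k _ => ?_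
    rw [hstep, sub_mul, one_mul]
  have h2 : F (2 * ⌊L⌋₊ + 1) = chi θ (latticePoint fun _ => (2 * m + 1 : ℤ)) * F 0 := by
    simp only [hF]
    rw [← chi_add, ← latticePoint_add]
    congr 2
    ext i
    simp only [Pi.add_apply]
    push_cast; ring
  set c := chi θ (latticePoint fun _ => (2 * m + 1 : ℤ)) with hc
  have hc1 : ‖c‖ = 1 := norm_chi _ _
  have h3 : ‖c - 1‖ ^ 2 = 2 - 2 * c.re := by
    have h4 : c.re * c.re + c.im * c.im = 1 := by
      rw [← Complex.normSq_apply, Complex.normSq_eq_norm_sq, hc1, one_pow]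
    rw [← Complex.normSq_eq_norm_sq, Complex.normSq_apply]
    simp only [Complex.sub_re, Complex.sub_im, Complex.one_re, Complex.one_im]
    linarith
  have h5 : ‖(e - 1) * latticeSum (ballPoints 0 L) θ‖ = ‖c - 1‖ := by
    rw [h1, h2, ← sub_one_mul, norm_mul, hF]
    simp only
    rw [norm_chi, mul_one]
  have h6 : ‖e - 1‖ ≤ 2 := by
    refine (norm_sub_le _ _).trans ?_
    rw [he, norm_chi, norm_one]; norm_num
  rw [← h3, ← h5, norm_mul, mul_pow]
  have h7 := pow_le_pow_left₀ (norm_nonneg _) h6 2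
  refine (mul_le_mul_of_nonneg_right h7 (sq_nonneg _)).trans (le_of_eq ?_)
  norm_num

/-- `|D_L|² ≥ (1 - Re e^{iθ(2⌊L⌋+1)}) / 2`, and the oscillating term disappears in the limit. -/
lemma IsWeight.exists_le_integral_latticeSum_sq_one {f : 𝔼 1 → ℝ} {M : ℝ} (hf : IsWeight f M)
    (hpos : 0 < ∫ θ in freqCube 1, f θ) :
    ∃ a : ℝ, 0 < a ∧ ∀ᶠ L : ℝ in atTop,
      a ≤ ∫ θ in freqCube 1, f θ * ‖latticeSum (ballPoints 0 L) θ‖ ^ 2 := by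
  set I := ∫ θ in freqCube 1, f θ with hI
  set y : ℝ → 𝔼 1 := fun L => latticePoint fun _ => (2 * ⌊L⌋₊ + 1 : ℤ) with hy
  have hfi := hf.integrableOn (isBounded_freqCube (d := 1))
  have hfc : IntegrableOn (fun θ => (f θ : ℂ)) (freqCube 1) := hfi.ofReal
  have hRL := tendsto_integral_exp_inner_smul_cocompact (V := 𝔼 1)
    (f := (freqCube 1).indicator fun θ => (f θ : ℂ))
  have hcob : Tendsto (fun L => (-(2 * Real.pi)⁻¹) • y L) atTop (cocompact (𝔼 1)) := by
    rw [← Metric.cobounded_eq_cocompact, ← tendsto_norm_atTop_iff_cobounded]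
    have h1 : ∀ᶠ L : ℝ in atTop, (2 * Real.pi)⁻¹ * L ≤ ‖(-(2 * Real.pi)⁻¹) • y L‖ := by
      filter_upwards [eventually_ge_atTop 0] with L hL
      have hpi := Real.pi_pos
      rw [norm_smul, norm_neg, Real.norm_eq_abs, abs_of_pos (by positivity)]
      refine mul_le_mul_of_nonneg_left ?_ (by positivity)
      refine le_trans ?_ (PiLp.norm_apply_le (y L) 0)
      simp only [hy, latticePoint_apply]
      rw [Real.norm_eq_abs]
      have h2 := (Nat.lt_floor_add_one L).le
      refine le_trans ?_ (le_abs_self _)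
      push_cast
      have : (0 : ℝ) ≤ ⌊L⌋₊ := Nat.cast_nonneg _
      linarith
    exact tendsto_atTop_mono' _ h1 (tendsto_id.const_mul_atTop (by have := Real.pi_pos; positivity))
  have hlim : Tendsto (fun L => ∫ θ in freqCube 1, (f θ : ℂ) * chi θ (y L)) atTop (𝓝 0) := by
    refine (hRL.comp hcob).congr fun L => ?_
    simp only [Function.comp]
    rw [← integral_indicator measurableSet_freqCube]
    refine integral_congr_ae (ae_of_all _ fun θ => ?_)
    by_cases hθ : θ ∈ freqCube 1
    · simp only [Set.indicator_of_mem hθ]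
      rw [Circle.smul_def, Real.fourierChar_apply, smul_eq_mul, mul_comm, chi, inner_smul_right]
      congr 2
      have hpi : (Real.pi : ℂ) ≠ 0 := by exact_mod_cast Real.pi_ne_zero
      push_cast
      field_simp
    · simp only [Set.indicator_of_notMem hθ, smul_zero]
  refine ⟨I / 4, by positivity, ?_⟩
  filter_upwards [Metric.tendsto_nhds.1 hlim (I / 2) (by positivity), eventually_ge_atTop 0] with L hL hL0
  rw [dist_zero_right] at hL
  have hci : IntegrableOn (fun θ => (f θ : ℂ) * chi θ (y L)) (freqCube 1) :=
    hfc.mul_bdd (c := 1) (by fun_prop : Continuous fun θ => chi θ (y L)).aestronglyMeasurable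
      (ae_of_all _ fun θ => (norm_chi _ _).le)
  have hre : (∫ θ in freqCube 1, (f θ : ℂ) * chi θ (y L)).re = ∫ θ in freqCube 1, f θ * (chi θ (y L)).re := by
    rw [← Complex.reCLM_apply, ← Complex.reCLM.integral_comp_comm hci]
    refine integral_congr_ae (ae_of_all _ fun θ => ?_)
    simp only [Complex.reCLM_apply, Complex.re_ofReal_mul]
  have hri : IntegrableOn (fun θ => f θ * (chi θ (y L)).re) (freqCube 1) :=
    hf.integrableOn_mul (g := fun θ => (chi θ (y L)).re)
      (integrable_of_continuous_of_isBounded (by fun_prop) isBounded_freqCube)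
  have hDi : IntegrableOn (fun θ => f θ * ‖latticeSum (ballPoints 0 L) θ‖ ^ 2) (freqCube 1) :=
    hf.integrableOn_mul (g := fun θ => ‖latticeSum (ballPoints 0 L) θ‖ ^ 2)
      (integrable_of_continuous_of_isBounded (by fun_prop) isBounded_freqCube)
  have hmono : ∫ θ in freqCube 1, (2 * f θ - 2 * (f θ * (chi θ (y L)).re))
      ≤ ∫ θ in freqCube 1, 4 * (f θ * ‖latticeSum (ballPoints 0 L) θ‖ ^ 2) := by
    refine integral_mono ((hfi.const_mul 2).sub (hri.const_mul 2)) (hDi.const_mul 4) fun θ => ?_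
    have := mul_le_mul_of_nonneg_left (two_sub_re_chi_le hL0 θ) (hf.nonneg θ)
    simp only
    linarith
  have h1 : ∫ θ in freqCube 1, (2 * f θ - 2 * (f θ * (chi θ (y L)).re))
      = 2 * I - 2 * ∫ θ in freqCube 1, f θ * (chi θ (y L)).re := by
    refine (integral_sub (hfi.const_mul 2) (hri.const_mul 2)).trans ?_
    rw [integral_const_mul, integral_const_mul]
  rw [h1, integral_const_mul, ← hre] at hmono
  have h2 := Complex.re_le_norm (∫ θ in freqCube 1, (f θ : ℂ) * chi θ (y L))
  linarith

/-- The mean square of the exponential sum over a lattice ball is at least of surface order. -/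
lemma IsWeight.exists_le_integral_latticeSum_sq {f : 𝔼 (n + 1) → ℝ} {M : ℝ} (hf : IsWeight f M)
    (hpos : 0 < ∫ θ in freqCube (n + 1), f θ) :
    ∃ a L₀ : ℝ, 0 < a ∧ 0 < L₀ ∧ ∀ L > L₀,
      a * L ^ n ≤ ∫ θ in freqCube (n + 1), f θ * ‖latticeSum (ballPoints 0 L) θ‖ ^ 2 := by
  have key : ∃ a : ℝ, 0 < a ∧ ∀ᶠ L : ℝ in atTop,
      a * L ^ n ≤ ∫ θ in freqCube (n + 1), f θ * ‖latticeSum (ballPoints 0 L) θ‖ ^ 2 := by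
    rcases n with _ | n
    · obtain ⟨a, ha, h⟩ := hf.exists_le_integral_latticeSum_sq_one hpos
      refine ⟨a, ha, h.mono fun L hL => ?_⟩
      rwa [pow_zero, mul_one]
    · obtain ⟨g, δ, hg, hgf, hgpos⟩ := hf.exists_punctured hpos
      obtain ⟨a, ha, h⟩ := hg.exists_le_integral_latticeSum_sq (by omega) hgpos
      refine ⟨a, ha, h.mono fun L hL => hL.trans ?_⟩
      have hc : Continuous fun θ : 𝔼 (n + 1 + 1) => ‖latticeSum (ballPoints 0 L) θ‖ ^ 2 := by fun_prop
      have hi := integrable_of_continuous_of_isBounded hc (isBounded_freqCube (d := n + 1 + 1))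
      exact integral_mono (hg.integrableOn_mul hi) (hf.integrableOn_mul hi) fun θ =>
        mul_le_mul_of_nonneg_right (hgf θ) (sq_nonneg _)
  obtain ⟨a, ha, h⟩ := key
  obtain ⟨L₀, hL₀⟩ := eventually_atTop.1 h
  exact ⟨a, max 1 L₀, ha, lt_max_of_lt_left one_pos, fun L hL => hL₀ L ((le_max_right _ _).trans hL.le)⟩

/-! ### Variance and structure function -/

/-- The structure function agrees almost everywhere with a weight of positive integral. -/
lemma exists_isWeight {Ω : Type*} [MeasurableSpace Ω] {μ : Measure Ω} {X : (Fin d → ℤ) → Ω → ℝ}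
    (hL2 : ∀ i, MemLp (X i) 2 μ) {K : (Fin d → ℤ) → ℝ}
    (hcov : ∀ i j, ∫ ω, X i ω * X j ω ∂μ = K (i - j)) (hvar : K 0 = 1)
    {S : 𝔼 d → ℝ} (hS : IsFourierTransformOf S K)
    (hbdd : ∃ M : ℝ, ∀ ξ ∈ freqCube d, |S ξ| ≤ M) :
    ∃ (f : 𝔼 d → ℝ) (M : ℝ), IsWeight f M ∧ (∀ᵐ θ ∂(volume.restrict (freqCube d)), f θ = S θ) ∧
      0 < ∫ θ in freqCube d, f θ := by
  have hSi := integrable_of_bdd hS.1 hbdd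
  have h0 := ae_nonneg_of_posSemidef hS hSi (covariance_posSemidef hL2 hcov)
  obtain ⟨M, hM⟩ := hbdd
  have hzero : (0 : 𝔼 d) ∈ freqCube d := fun k => by simp [Real.pi_pos.le]
  have hM0 : 0 ≤ M := (abs_nonneg _).trans (hM 0 hzero)
  set f : 𝔼 d → ℝ := fun θ => max 0 (min (hS.1.mk S θ) M) with hf
  have hfS : ∀ᵐ θ ∂(volume.restrict (freqCube d)), f θ = S θ := by
    filter_upwards [h0, hS.1.ae_eq_mk, ae_restrict_mem measurableSet_freqCube] with θ h1 h2 h3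
    simp only [hf]
    have h1' : 0 ≤ S θ := h1
    rw [← h2, min_eq_left ((le_abs_self _).trans (hM θ h3)), max_eq_right h1']
  refine ⟨f, M, ⟨?_, fun θ => le_max_left _ _, fun θ => max_le hM0 (min_le_right _ _)⟩, hfS, ?_⟩
  · exact measurable_const.max (hS.1.stronglyMeasurable_mk.measurable.min measurable_const)
  · have h1 := integral_mul_chi hS hSi 0
    simp only [latticePoint_zero, chi_zero, one_mul, neg_zero, hvar] at h1
    rw [integral_complex_ofReal] at h1
    rw [integral_congr_ae hfS]
    have h2 : ∫ θ in freqCube d, S θ = (2 * Real.pi) ^ d := by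
      have h3 : ((∫ θ in freqCube d, S θ : ℝ) : ℂ) = (((2 * Real.pi) ^ d : ℝ) : ℂ) := by
        rw [h1]; push_cast; ring
      exact_mod_cast h3
    rw [h2]
    have := Real.pi_pos
    positivity

lemma ballFluctuation_congr {f S : 𝔼 d → ℝ} (h : ∀ᵐ θ ∂(volume.restrict (freqCube d)), f θ = S θ)
    (c L : ℝ) : ballFluctuation S c L = ballFluctuation f c L := by
  have h1 : ∫ ξ in freqCube d ∩ {ξ | ‖ξ‖ ≤ c / L}, S ξ = ∫ ξ in freqCube d ∩ {ξ | ‖ξ‖ ≤ c / L}, f ξ :=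
    integral_congr_ae ((ae_restrict_of_ae_restrict_of_subset Set.inter_subset_left h).mono fun _ => Eq.symm)
  have h2 : ∫ ξ in freqCube d ∩ {ξ | c / L < ‖ξ‖}, S ξ / ‖ξ‖ ^ (d + 1)
      = ∫ ξ in freqCube d ∩ {ξ | c / L < ‖ξ‖}, f ξ / ‖ξ‖ ^ (d + 1) :=
    integral_congr_ae ((ae_restrict_of_ae_restrict_of_subset Set.inter_subset_left h).mono fun ξ hξ => by
      simp only [hξ])
  rw [ballFluctuation, ballFluctuation, h1, h2]

/-- The upper bound: both the Fourier transform of the ball and the error of the lattice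
approximation are controlled by `ballFluctuation`. -/
lemma IsWeight.exists_integral_latticeSum_sq_le {f : 𝔼 (n + 1) → ℝ} {M : ℝ} (hf : IsWeight f M)
    (hpos : 0 < ∫ θ in freqCube (n + 1), f θ) {c : ℝ} (hc : 0 < c) :
    ∃ C L₀ : ℝ, 0 < C ∧ 0 < L₀ ∧ ∀ L > L₀,
      ∫ θ in freqCube (n + 1), f θ * ‖latticeSum (ballPoints 0 L) θ‖ ^ 2 ≤ C * ballFluctuation f c L := by
  obtain ⟨C, hC, hcmp⟩ := exists_comparison n
  obtain ⟨A, hA, hup⟩ := exists_integral_ballFTReal_sq_le n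
  obtain ⟨a, L₀, ha, hL₀, hlow⟩ := exists_le_ballFluctuation hf hpos hc
  have hM := hf.bound_nonneg
  refine ⟨C * A + C * M / a, max L₀ (2 * √(n + 1 : ℕ)), by positivity, lt_max_of_lt_left hL₀,
    fun L hL => ?_⟩
  have h1 := (hcmp f M hf L ((le_max_right _ _).trans hL.le)).1
  have hL1 : L₀ < L := (le_max_left _ _).trans_lt hL
  have h2 := mul_le_mul_of_nonneg_left (hup f M hf c hc L (hL₀.trans hL1)) hC.le
  have h3 := mul_le_mul_of_nonneg_left (hlow L hL1) (by positivity : 0 ≤ C * M / a)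
  have h4 : C * M / a * (a * L ^ n) = C * M * L ^ n := by field_simp
  linarith

/-- The lower bound for a weight which is regular at the origin. -/
lemma IsWeight.exists_ballFluctuation_le_integral {f S : 𝔼 (n + 1) → ℝ} {M : ℝ} (hf : IsWeight f M)
    (hpos : 0 < ∫ θ in freqCube (n + 1), f θ)
    (hfS : ∀ᵐ θ ∂(volume.restrict (freqCube (n + 1))), f θ = S θ) (hS : IsRegularAtOrigin S)
    {c : ℝ} (hc : 0 < c) :
    ∃ C L₀ : ℝ, 0 < C ∧ 0 < L₀ ∧ ∀ L > L₀,
      ballFluctuation f c L ≤ C * ∫ θ in freqCube (n + 1), f θ * ‖latticeSum (ballPoints 0 L) θ‖ ^ 2 := by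
  obtain ⟨C, hC, hcmp⟩ := exists_comparison n
  obtain ⟨A, D, L₁, hA, hD, hL₁, hreg⟩ := exists_ballFluctuation_le hf hfS hS hc
  obtain ⟨a, L₀, ha, hL₀, hlow⟩ := hf.exists_le_integral_latticeSum_sq hpos
  have hM := hf.bound_nonneg
  refine ⟨2 * A + (A * (C * M) + D) / a, max (max L₀ L₁) (2 * √(n + 1 : ℕ)), by positivity,
    lt_max_of_lt_left (lt_max_of_lt_left hL₀), fun L hL => ?_⟩
  have h1 := mul_le_mul_of_nonneg_left (hcmp f M hf L ((le_max_right _ _).trans hL.le)).2 hA.le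
  have hL01 : max L₀ L₁ < L := (le_max_left _ _).trans_lt hL
  have h2 := hreg L ((le_max_right _ _).trans_lt hL01)
  have h3 := mul_le_mul_of_nonneg_left (hlow L ((le_max_left _ _).trans_lt hL01))
    (by positivity : 0 ≤ (A * (C * M) + D) / a)
  have h4 : (A * (C * M) + D) / a * (a * L ^ n) = A * (C * M * L ^ n) + D * L ^ n := by field_simp
  linarith

end LatticeBall

open LatticeBall

theorem theorem1 {Ω : Type*} [MeasurableSpace Ω] (μ : Measure Ω) [IsProbabilityMeasure μ]
    (d : ℕ) (hd : 1 ≤ d) (X : (Fin d → ℤ) → Ω → ℝ) (hL2 : ∀ i, MemLp (X i) 2 μ)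
    (hmean : ∀ i, ∫ ω, X i ω ∂μ = 0)
    (K : (Fin d → ℤ) → ℝ) (hcov : ∀ i j, ∫ ω, X i ω * X j ω ∂μ = K (i - j)) (hvar : K 0 = 1)
    (S : EuclideanSpace ℝ (Fin d) → ℝ) (hS : IsFourierTransformOf S K)
    (hbdd : ∃ M : ℝ, ∀ ξ ∈ freqCube d, |S ξ| ≤ M) (c : ℝ) (hc : 0 < c) :
    (∃ C L₀ : ℝ, 0 < C ∧ 0 < L₀ ∧ ∀ L > L₀,
      ProbabilityTheory.variance (localMass X (Metric.closedBall 0 L)) μ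
        ≤ C * ballFluctuation S c L) ∧
    (IsRegularAtOrigin S →
      IsThetaAtInfinity
        (fun L => ProbabilityTheory.variance (localMass X (Metric.closedBall 0 L)) μ)
        (fun L => ballFluctuation S c L)) := by
  obtain ⟨n, rfl⟩ : ∃ n, d = n + 1 := ⟨d - 1, by omega⟩
  obtain ⟨f, M, hf, hfS, hpos⟩ := exists_isWeight hL2 hcov hvar hS hbdd
  set P : ℝ := (2 * Real.pi) ^ (n + 1) with hP
  have hP0 : 0 < P := by have := Real.pi_pos; positivity
  have hVar : ∀ L, P * ProbabilityTheory.variance (localMass X (Metric.closedBall 0 L)) μ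
      = ∫ θ in freqCube (n + 1), f θ * ‖latticeSum (ballPoints 0 L) θ‖ ^ 2 := fun L => by
    rw [variance_localMass hS (integrable_of_bdd hS.1 hbdd) hL2 hmean hcov L]
    refine integral_congr_ae (hfS.mono fun θ hθ => ?_)
    simp only [hθ]
  obtain ⟨C, L₀, hC, hL₀, hup⟩ := hf.exists_integral_latticeSum_sq_le hpos hc
  have hup' : ∀ L > L₀, ProbabilityTheory.variance (localMass X (Metric.closedBall 0 L)) μ
      ≤ C / P * ballFluctuation S c L := fun L hL => by
    have h := hup L hL
    rw [← hVar, ← ballFluctuation_congr hfS] at h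
    rw [div_mul_eq_mul_div, le_div_iff₀ hP0, mul_comm]
    exact h
  refine ⟨⟨C / P, L₀, by positivity, hL₀, hup'⟩, fun hreg => ?_⟩
  obtain ⟨C', L₁, hC', hL₁, hlow⟩ := hf.exists_ballFluctuation_le_integral hpos hfS hreg hc
  refine ⟨1 / (C' * P), C / P, max L₀ L₁, by positivity, by positivity, lt_max_of_lt_left hL₀,
    fun L hL => ⟨?_, hup' L ((le_max_left _ _).trans_lt hL)⟩⟩
  have h := hlow L ((le_max_right _ _).trans_lt hL)
  rw [← hVar, ← ballFluctuation_congr hfS] at h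
  rw [div_mul_eq_mul_div, one_mul, div_le_iff₀ (by positivity)]
  linarith
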